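/- Let $\mathbb K$ be a field of characteristic zero, $G$ an abelian group with identity $e$, and $\chi:G\times G\to\mathbb K^\times$ an anti-symmetric bicharacter, i.e. $\chi(g,h)\chi(h,g)=1$, $\chi(g,hk)=\chi(g,h)\chi(g,k)$ and $\chi(gh,k)=\chi(g,k)\chi(h,k)$. Let $\mathfrak g=\bigoplus_{g\in G}\mathfrak g_g$ be a color Lie algebra: a $G$-graded vector space with a bilinear bracket such that $[\mathfrak g_g,\mathfrak g_h]\subseteq\mathfrak g_{gh}$, $[a,b]=-\chi(|a|,|b|)[b,a]$ and $\chi(|c|,|a|)[a,[b,c]]+\chi(|a|,|b|)[b,[c,a]]+\chi(|b|,|c|)[c,[a,b]]=0$ for homogeneous $a,b,c$. Let $U=\mathcal U(\mathfrak g)$ be its enveloping algebra, the quotient of the tensor algebra of $\mathfrak g$ by the ideal generated by the elements $a\otimes b-\chi(|a|,|b|)\,b\otimes a-[a,b]$ ($a,b$ homogeneous), with product $\circ$, its $G$-grading, and the filtration in which $U_n$ is spanned by the products of at most $n$ elements of $\mathfrak g$ ($U_{-1}=0$). Let $A=\mathrm{gr}(U)=\bigoplus_n \mathrm{gr}^n(U)$,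 $\mathrm{gr}^n(U)=U_n/U_{n-1}$, with projections $\pi_n:U_n\to \mathrm{gr}^n(U)$, product $\pi_n(u)\bullet\pi_m(v)=\pi_{n+m}(u\circ v)$ and the induced $G$-grading. Theorem. (1) There is a unique bilinear bracket on $A$ with $\{\pi_n(u),\pi_m(v)\}=\pi_{n+m-1}(u\circ v-\chi(|u|,|v|)\,v\circ u)$ for all $G$-homogeneous $u\in U_n$, $v\in U_m$ (in particular $u\circ v-\chi(|u|,|v|)\,v\circ u\in U_{n+m-1}$). It makes $A$ a color Poisson algebra: $A$ is a unital associative $G$-graded algebra with $ab=\chi(|a|,|b|)ba$, $\{\,,\}$ satisfies the three conditions of a color Lie bracket, and $\{a,bc\}=\{a,b\}c+\chi(|a|,|b|)\,b\{a,c\}$ for homogeneous $a,b,c$. (2) There is a unique linear map $\omega:A\to U$ (the color symmetrization map) such that for all $p\ge 0$ and homogeneous $X_1,\dots,X_p\in\mathfrak g$ (on the left, $X_i$ stands for its class in $\mathrm{gr}^1(U)$) $$\omega(X_1\bullet\cdots\bullet X_p)=\frac1{p!}\sum_{\sigma\in S_p}\ \Big(\prod_{r<s,\ \sigma^{-1}(r)>\sigma^{-1}(s)}\chi(|X_r|,|X_s|)\Big)\,X_{\sigma(1)}\circ\cdots\circ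 X_{\sigma(p)} .$$ It is bijective, and $U=\bigoplus_{j\ge0}\omega(\mathrm{gr}^j(U))$. Write $x_k$ for the component of $x\in U$ in $\omega(\mathrm{gr}^k(U))$, with $x_k=0$ for $k<0$. (3) For $u\in \mathrm{gr}^p(U)$ and $v\in \mathrm{gr}^q(U)$ put $$u\star_t v=\sum_{n\ge0}t^n\,\omega^{-1}\big((\omega(u)\circ\omega(v))_{p+q-n}\big)=\sum_{n\ge 0}t^n m_n(u,v),$$ and extend $\mathbb K$-bilinearly to $A$ and $\mathbb K[[t]]$-bilinearly to $A[[t]]$ by $\big(\sum_i t^ia_i\big)\star_t\big(\sum_j t^jb_j\big)=\sum_{n,i,j}t^{n+i+j}m_n(a_i,b_j)$. Then $\star_t$ is a graded star product on the color Poisson algebra $A$: $\star_t$ is associative on $A[[t]]$ with unit $1$, $m_0$ is the product $\bullet$ of $A$, every $m_n$ has $G$-degree $e$ (that is, $m_n(A_g,A_h)\subseteq A_{gh}$), and $$m_1(a,b)-\chi(|a|,|b|)\,m_1(b,a)=\{a,b\}\qquad\text{for all homogeneous } a,b\in A .$$ In the sum defining $u\star_t v$ only the terms with $n\le p+q$ occur,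 and if $p+q\ge1$ only those with $n\le p+q-1$. -/

import Mathlib

open scoped DirectSum PowerSeries

noncomputable section

universe uK uG uL uA

/-- An anti-symmetric bicharacter (commutation factor) on an abelian group `G`. -/
structure AntisymmBicharacter (K : Type uK) (G : Type uG) [Field K] [CommGroup G] where
  toFun : G → G → Kˣ
  mul_swap : ∀ g h, toFun g h * toFun h g = 1
  map_mul_right : ∀ g h k, toFun g (h * k) = toFun g h * toFun g k
  map_mul_left : ∀ g h k, toFun (g * h) k = toFun g k * toFun h k

instance {K : Type uK} {G : Type uG} [Field K] [CommGroup G] :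
    CoeFun (AntisymmBicharacter K G) (fun _ => G → G → Kˣ) :=
  ⟨AntisymmBicharacter.toFun⟩

/-- The bilinear map `B` is a color Lie bracket for the family `𝒜` of homogeneous subspaces. -/
structure IsColorLieBracket {K : Type uK} {G : Type uG} {A : Type uA} [Field K] [CommGroup G]
    [AddCommGroup A] [Module K A] (χ : AntisymmBicharacter K G) (𝒜 : G → Submodule K A)
    (B : A →ₗ[K] A →ₗ[K] A) : Prop where
  mem : ∀ ⦃g h : G⦄ ⦃a b : A⦄, a ∈ 𝒜 g → b ∈ 𝒜 h → B a b ∈ 𝒜 (g * h)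
  skew : ∀ ⦃g h : G⦄ ⦃a b : A⦄, a ∈ 𝒜 g → b ∈ 𝒜 h → B a b = -((χ g h : K) • B b a)
  jacobi : ∀ ⦃g h k : G⦄ ⦃a b c : A⦄, a ∈ 𝒜 g → b ∈ 𝒜 h → c ∈ 𝒜 k →
    (χ k g : K) • B a (B b c) + (χ g h : K) • B b (B c a) + (χ h k : K) • B c (B a b) = 0

/-- A `G`-graded color Lie algebra structure on the vector space `L`. -/
structure ColorLieAlgebra {K : Type uK} {G : Type uG} [Field K] [CommGroup G] [DecidableEq G]
    (χ : AntisymmBicharacter K G) (L : Type uL) [AddCommGroup L] [Module K L] where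
  grading : G → Submodule K L
  isInternal : DirectSum.IsInternal grading
  bracket : L →ₗ[K] L →ₗ[K] L
  isColorLieBracket : IsColorLieBracket χ grading bracket

/-! ### Filtered algebras and their associated graded algebras -/

/-- An increasing `ℕ`-indexed multiplicative filtration of an algebra. -/
structure AlgFiltration (K : Type uK) (A : Type uA) [Field K] [Ring A] [Algebra K A] where
  fil : ℕ → Submodule K A
  mono : Monotone fil
  one_mem : (1 : A) ∈ fil 0
  mul_mem : ∀ ⦃n m : ℕ⦄ ⦃u v : A⦄, u ∈ fil n → v ∈ fil m → u * v ∈ fil (n + m)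

namespace AlgFiltration

variable {K : Type uK} {A : Type uA} [Field K] [Ring A] [Algebra K A] (F : AlgFiltration K A)

/-- The preceding step `A_{n-1}` of the filtration, where `A_{-1} = 0`. -/
def pred : ℕ → Submodule K A
  | 0 => ⊥
  | n + 1 => F.fil n

/-- The quotient `gr^n(A) = A_n / A_{n-1}`. -/
def gr (n : ℕ) : Type uA := F.fil n ⧸ (F.pred n).submoduleOf (F.fil n)

instance (n : ℕ) : AddCommGroup (F.gr n) :=
  inferInstanceAs (AddCommGroup (F.fil n ⧸ (F.pred n).submoduleOf (F.fil n)))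

instance (n : ℕ) : Module K (F.gr n) :=
  inferInstanceAs (Module K (F.fil n ⧸ (F.pred n).submoduleOf (F.fil n)))

/-- The canonical projection `π_n : A_n → gr^n(A)`. -/
def proj (n : ℕ) : F.fil n →ₗ[K] F.gr n := ((F.pred n).submoduleOf (F.fil n)).mkQ

theorem proj_surjective (n : ℕ) : Function.Surjective (F.proj n) :=
  Submodule.mkQ_surjective _

theorem proj_eq_zero {n : ℕ} (u : F.fil n) (h : (u : A) ∈ F.pred n) : F.proj n u = 0 :=
  (Submodule.Quotient.mk_eq_zero _).2 h

theorem mul_mem_pred_left {n m : ℕ} {u v : A} (hu : u ∈ F.pred n) (hv : v ∈ F.fil m) :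
    u * v ∈ F.pred (n + m) := by
  cases n with
  | zero =>
    have h0 : u = 0 := hu
    simp [h0]
  | succ n =>
    rw [Nat.succ_add]
    exact F.mul_mem hu hv

theorem mul_mem_pred_right {n m : ℕ} {u v : A} (hu : u ∈ F.fil n) (hv : v ∈ F.pred m) :
    u * v ∈ F.pred (n + m) := by
  cases m with
  | zero =>
    have h0 : v = 0 := hv
    simp [h0]
  | succ m => exact F.mul_mem hu hv

/-- The product `A_n × A_m → A_{n+m}`. -/
def filMul (n m : ℕ) : F.fil n →ₗ[K] F.fil m →ₗ[K] F.fil (n + m) :=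
  LinearMap.mk₂ K (fun u v => ⟨(u : A) * v, F.mul_mem u.2 v.2⟩)
    (fun _ _ _ => Subtype.ext (add_mul _ _ _))
    (fun _ _ _ => Subtype.ext (smul_mul_assoc _ _ _))
    (fun _ _ _ => Subtype.ext (mul_add _ _ _))
    (fun _ _ _ => Subtype.ext (mul_smul_comm _ _ _))

/-- The product `gr^n(A) × gr^m(A) → gr^{n+m}(A)`, `π_n(u) π_m(v) = π_{n+m}(u v)`. -/
def grMul (n m : ℕ) : F.gr n →ₗ[K] F.gr m →ₗ[K] F.gr (n + m) :=
  Submodule.liftQ _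
    (LinearMap.flip (Submodule.liftQ _ (((F.filMul n m).compr₂ (F.proj (n + m))).flip) (by
      intro v hv
      refine LinearMap.ext fun u => F.proj_eq_zero _ ?_
      exact F.mul_mem_pred_right u.2 hv)))
    (by
      intro u hu
      refine LinearMap.ext fun y => ?_
      obtain ⟨v, rfl⟩ := F.proj_surjective m y
      exact F.proj_eq_zero _ (F.mul_mem_pred_left hu v.2))

theorem grMul_proj {n m : ℕ} (u : F.fil n) (v : F.fil m) :
    F.grMul n m (F.proj n u) (F.proj m v) =
      F.proj (n + m) ⟨(u : A) * v, F.mul_mem u.2 v.2⟩ := rfl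

theorem mk_proj_eq {n m : ℕ} (h : n = m) (u : F.fil n) (v : F.fil m) (huv : (u : A) = v) :
    (GradedMonoid.mk n (F.proj n u) : GradedMonoid F.gr) = GradedMonoid.mk m (F.proj m v) := by
  subst h
  rw [Subtype.ext huv]

instance grGOne : GradedMonoid.GOne F.gr where
  one := F.proj 0 ⟨1, F.one_mem⟩

instance grGMul : GradedMonoid.GMul F.gr where
  mul {n m} a b := F.grMul n m a b

instance grGMonoid : GradedMonoid.GMonoid F.gr where
  one_mul := by
    rintro ⟨n, a⟩
    obtain ⟨u, rfl⟩ := F.proj_surjective n a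
    exact F.mk_proj_eq (Nat.zero_add n) _ _ (one_mul _)
  mul_one := by
    rintro ⟨n, a⟩
    obtain ⟨u, rfl⟩ := F.proj_surjective n a
    exact F.mk_proj_eq (Nat.add_zero n) _ _ (mul_one _)
  mul_assoc := by
    rintro ⟨n, a⟩ ⟨m, b⟩ ⟨l, c⟩
    obtain ⟨u, rfl⟩ := F.proj_surjective n a
    obtain ⟨v, rfl⟩ := F.proj_surjective m b
    obtain ⟨w, rfl⟩ := F.proj_surjective l c
    exact F.mk_proj_eq (Nat.add_assoc n m l) _ _ (mul_assoc _ _ _)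

instance grGRing : DirectSum.GRing F.gr where
  mul_zero {n m} a := map_zero (F.grMul n m a)
  zero_mul {n m} b := LinearMap.map_zero₂ (F.grMul n m) b
  mul_add {n m} a b c := map_add (F.grMul n m a) b c
  add_mul {n m} a b c := LinearMap.map_add₂ (F.grMul n m) a b c
  natCast k := k • F.proj 0 ⟨1, F.one_mem⟩
  natCast_zero := zero_smul ℕ _
  natCast_succ k := succ_nsmul _ k
  intCast k := k • F.proj 0 ⟨1, F.one_mem⟩
  intCast_ofNat k := natCast_zsmul _ k
  intCast_negSucc_ofNat k := negSucc_zsmul _ k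

instance grGAlgebra : DirectSum.GAlgebra K F.gr where
  toFun := ((LinearMap.toSpanSingleton K (F.gr 0) (F.proj 0 ⟨1, F.one_mem⟩))).toAddMonoidHom
  map_one := one_smul K (F.proj 0 ⟨1, F.one_mem⟩)
  map_mul r s := by
    have h := F.mk_proj_eq (Nat.add_zero 0).symm
      ((r * s) • (⟨1, F.one_mem⟩ : F.fil 0))
      ⟨_, F.mul_mem (r • (⟨1, F.one_mem⟩ : F.fil 0)).2 (s • (⟨1, F.one_mem⟩ : F.fil 0)).2⟩
      (by simp [mul_smul, smul_comm r s])
    exact h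
  commutes r := by
    rintro ⟨n, a⟩
    obtain ⟨u, rfl⟩ := F.proj_surjective n a
    have h := F.mk_proj_eq (Nat.add_comm 0 n)
      ⟨_, F.mul_mem (r • (⟨1, F.one_mem⟩ : F.fil 0)).2 u.2⟩
      ⟨_, F.mul_mem u.2 (r • (⟨1, F.one_mem⟩ : F.fil 0)).2⟩
      (by simp)
    exact h
  smul_def r := by
    rintro ⟨n, a⟩
    obtain ⟨u, rfl⟩ := F.proj_surjective n a
    have h := F.mk_proj_eq (Nat.zero_add n).symm (r • u)
      ⟨_, F.mul_mem (r • (⟨1, F.one_mem⟩ : F.fil 0)).2 u.2⟩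
      (by simp)
    exact h

/-- The associated graded algebra `gr(A) = ⨁ gr^n(A)`, with its product coming from `grMul`. -/
abbrev Gr : Type uA := ⨁ n, F.gr n

/-- The canonical projection `π_n`, with values in `gr(A)`. -/
def toGr (n : ℕ) : F.fil n →ₗ[K] F.Gr := DirectSum.lof K ℕ F.gr n ∘ₗ F.proj n

/-- For a linear isomorphism `ω : gr(A) ≃ A`, the projection `x ↦ x_k` of
`A = ⨁ ω(gr^j(A))` onto its summand `ω(gr^k(A))`. -/
def component (ω : F.Gr ≃ₗ[K] A) (k : ℕ) : A →ₗ[K] A :=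
  ω.toLinearMap ∘ₗ DirectSum.lof K ℕ F.gr k ∘ₗ DirectSum.component K ℕ F.gr k ∘ₗ
    ω.symm.toLinearMap

/-- The bilinear map `gr^p(A) × gr^q(A) → gr(A)`, `(u, v) ↦ ω⁻¹((ω(u) ω(v))_{p+q-n})`,
which is zero if `p + q - n` is negative. -/
def starPiece (ω : F.Gr ≃ₗ[K] A) (n p q : ℕ) : F.gr p →ₗ[K] F.gr q →ₗ[K] F.Gr :=
  if n ≤ p + q then
    ((LinearMap.mul K A).compl₁₂ (ω.toLinearMap ∘ₗ DirectSum.lof K ℕ F.gr p)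
      (ω.toLinearMap ∘ₗ DirectSum.lof K ℕ F.gr q)).compr₂
        (ω.symm.toLinearMap ∘ₗ F.component ω (p + q - n))
  else 0

/-- The coefficient of `t^n` in the product `u ⋆ v`: the bilinear extension to `gr(A)` of the
maps `starPiece`. -/
def starCoeff (ω : F.Gr ≃ₗ[K] A) (n : ℕ) : F.Gr →ₗ[K] F.Gr →ₗ[K] F.Gr :=
  DirectSum.toModule K ℕ (F.Gr →ₗ[K] F.Gr) fun p =>
    (DirectSum.toModule K ℕ (F.gr p →ₗ[K] F.Gr) fun q => (F.starPiece ω n p q).flip).flip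

end AlgFiltration

/-! ### The enveloping algebra -/

namespace ColorLieAlgebra

variable {K : Type uK} {G : Type uG} {L : Type uL} [Field K] [CommGroup G] [DecidableEq G]
  [AddCommGroup L] [Module K L] {χ : AntisymmBicharacter K G} (𝔤 : ColorLieAlgebra χ L)

/-- The relations `a ⊗ b = χ(|a|,|b|) b ⊗ a + [a,b]` for homogeneous `a`, `b`. -/
inductive Rel : TensorAlgebra K L → TensorAlgebra K L → Prop
  | commutator {g h : G} {a b : L} (ha : a ∈ 𝔤.grading g) (hb : b ∈ 𝔤.grading h) :
      Rel (TensorAlgebra.ι K a * TensorAlgebra.ι K b)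
        ((χ g h : K) • (TensorAlgebra.ι K b * TensorAlgebra.ι K a) +
          TensorAlgebra.ι K (𝔤.bracket a b))

/-- The universal enveloping algebra `U(𝔤)`. -/
def U : Type (max uK uL) := RingQuot 𝔤.Rel

instance : Ring 𝔤.U := inferInstanceAs (Ring (RingQuot 𝔤.Rel))

instance : Algebra K 𝔤.U := inferInstanceAs (Algebra K (RingQuot 𝔤.Rel))

/-- The canonical map `𝔤 → U(𝔤)`. -/
def ι : L →ₗ[K] 𝔤.U :=
  (RingQuot.mkAlgHom K 𝔤.Rel).toLinearMap ∘ₗ TensorAlgebra.ι K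

/-- The subspace `U_n` of `U(𝔤)` spanned by the products of at most `n` elements of `𝔤`. -/
def filSubmodule (n : ℕ) : Submodule K 𝔤.U :=
  Submodule.span K {y | ∃ l : List L, l.length ≤ n ∧ y = (l.map 𝔤.ι).prod}

/-- The canonical filtration of `U(𝔤)`. -/
def filtration : AlgFiltration K 𝔤.U where
  fil := 𝔤.filSubmodule
  mono := fun _ _ hnm => Submodule.span_mono
    (fun _ ⟨l, hl, hy⟩ => ⟨l, hl.trans hnm, hy⟩)
  one_mem := Submodule.subset_span ⟨[], le_rfl, by simp⟩
  mul_mem := by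
    intro n m u v hu hv
    have h : 𝔤.filSubmodule n * 𝔤.filSubmodule m ≤ 𝔤.filSubmodule (n + m) := by
      rw [filSubmodule, filSubmodule, Submodule.span_mul_span, Submodule.span_le]
      rintro _ ⟨_, ⟨l, hl, rfl⟩, _, ⟨l', hl', rfl⟩, rfl⟩
      exact Submodule.subset_span ⟨l ++ l', by simp; omega, by simp⟩
    exact h (Submodule.mul_mem_mul hu hv)

/-- The homogeneous subspace of degree `g` of `U(𝔤)`: it is spanned by the products
`x_1 ⋯ x_n` of homogeneous elements of `𝔤` with `|x_1| ⋯ |x_n| = g`. -/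
def uGrading (g : G) : Submodule K 𝔤.U :=
  Submodule.span K {y | ∃ l : List (G × L), (∀ x ∈ l, x.2 ∈ 𝔤.grading x.1) ∧
    (l.map Prod.fst).prod = g ∧ y = (l.map fun x => 𝔤.ι x.2).prod}

/-- The associated graded algebra `gr(U(𝔤))`. -/
abbrev GrU : Type (max uK uL) := 𝔤.filtration.Gr

/-- The homogeneous subspace of `G`-degree `g` of `gr(U(𝔤))`: it is spanned by the classes
`π_n(u)` of the elements `u` of degree `g` in `U_n`. -/
def grGrading (g : G) : Submodule K 𝔤.GrU :=
  Submodule.span K {y | ∃ (n : ℕ) (u : 𝔤.filtration.fil n),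
    (u : 𝔤.U) ∈ 𝔤.uGrading g ∧ y = 𝔤.filtration.toGr n u}

/-- The canonical map `𝔤 → gr^1(U(𝔤)) ⊆ gr(U(𝔤))`. -/
def ιGr (x : L) : 𝔤.GrU :=
  𝔤.filtration.toGr 1 ⟨𝔤.ι x, Submodule.subset_span ⟨[x], le_rfl, by simp⟩⟩

/-- `P` is the bracket `{π_n(u), π_m(v)} = π_{n+m-1}(uv - χ(|u|,|v|) vu)` on `gr(U(𝔤))`.
(If `n = m = 0`, then `uv - χ(|u|,|v|) vu = 0` and the truncation of `n + m - 1` is harmless.) -/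
def IsCommutatorBracket (P : 𝔤.GrU →ₗ[K] 𝔤.GrU →ₗ[K] 𝔤.GrU) : Prop :=
  ∀ (n m : ℕ) (g h : G) (u : 𝔤.filtration.fil n) (v : 𝔤.filtration.fil m),
    (u : 𝔤.U) ∈ 𝔤.uGrading g → (v : 𝔤.U) ∈ 𝔤.uGrading h →
    ∃ hw : (u : 𝔤.U) * v - (χ g h : K) • ((v : 𝔤.U) * u) ∈ 𝔤.filtration.fil (n + m - 1),
      P (𝔤.filtration.toGr n u) (𝔤.filtration.toGr m v) =
        𝔤.filtration.toGr (n + m - 1)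
          ⟨(u : 𝔤.U) * v - (χ g h : K) • ((v : 𝔤.U) * u), hw⟩

/-- The sign of a permutation `σ` of homogeneous elements of degrees `d_1, …, d_p`: the product of
the `χ(d_r, d_s)` over the pairs `r < s` with `σ⁻¹(r) > σ⁻¹(s)`. -/
def colorSign (χ : AntisymmBicharacter K G) {p : ℕ} (d : Fin p → G)
    (σ : Equiv.Perm (Fin p)) : K :=
  ∏ x : Fin p × Fin p with x.1 < x.2 ∧ σ.symm x.2 < σ.symm x.1, (χ (d x.1) (d x.2) : K)

/-- `ω : gr(U(𝔤)) → U(𝔤)` is the color symmetrization map. -/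
def IsSymmetrization (ω : 𝔤.GrU →ₗ[K] 𝔤.U) : Prop :=
  ∀ (p : ℕ) (d : Fin p → G) (x : Fin p → L), (∀ i, x i ∈ 𝔤.grading (d i)) →
    ω (List.ofFn fun i => 𝔤.ιGr (x i)).prod =
      ((p.factorial : K)⁻¹) • ∑ σ : Equiv.Perm (Fin p),
        colorSign χ d σ • (List.ofFn fun i => 𝔤.ι (x (σ i))).prod

end ColorLieAlgebra

/-! ### Color Poisson algebras and star products -/

/-- The `K⟦t⟧`-bilinear product `(∑ t^i a_i) ⋆ (∑ t^j b_j) = ∑ t^{n+i+j} m_n(a_i, b_j)` on `A⟦t⟧`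
given by a sequence of bilinear maps `m_n`. -/
def formalMul {K : Type uK} {A : Type uA} [Field K] [Ring A] [Algebra K A]
    (m : ℕ → A →ₗ[K] A →ₗ[K] A) (a b : A⟦X⟧) : A⟦X⟧ :=
  PowerSeries.mk fun r => ∑ x ∈ Finset.HasAntidiagonal.antidiagonal r, ∑ y ∈ Finset.HasAntidiagonal.antidiagonal x.2,
    m x.1 (PowerSeries.coeff y.1 a) (PowerSeries.coeff y.2 b)

section Poisson

variable {K : Type uK} {G : Type uG} {A : Type uA} [Field K] [CommGroup G] [DecidableEq G]
  [Ring A] [Algebra K A]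

/-- `A` is a unital associative `G`-graded `χ`-commutative algebra, and `P` is a color Lie bracket
on it with the color Leibniz rule. -/
structure IsColorPoissonAlgebra (χ : AntisymmBicharacter K G) (𝒜 : G → Submodule K A)
    (P : A →ₗ[K] A →ₗ[K] A) : Prop where
  isInternal : DirectSum.IsInternal 𝒜
  one_mem : (1 : A) ∈ 𝒜 1
  mul_mem : ∀ ⦃g h : G⦄ ⦃a b : A⦄, a ∈ 𝒜 g → b ∈ 𝒜 h → a * b ∈ 𝒜 (g * h)
  mul_comm : ∀ ⦃g h : G⦄ ⦃a b : A⦄, a ∈ 𝒜 g → b ∈ 𝒜 h → a * b = (χ g h : K) • (b * a)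
  isColorLieBracket : IsColorLieBracket χ 𝒜 P
  leibniz : ∀ ⦃g h k : G⦄ ⦃a b c : A⦄, a ∈ 𝒜 g → b ∈ 𝒜 h → c ∈ 𝒜 k →
    P a (b * c) = P a b * c + (χ g h : K) • (b * P a c)

/-- `m_t = ∑ t^n m_n` is a graded (unital) associative deformation of the `G`-graded algebra `A`:
`m_0` is the product of `A`, every `m_n` has degree `e`, and the product on `A⟦t⟧` is associative
with unit `1`. -/
structure IsGradedDeformation (𝒜 : G → Submodule K A) (m : ℕ → A →ₗ[K] A →ₗ[K] A) : Prop where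
  coeff_zero : ∀ a b, m 0 a b = a * b
  mem : ∀ (n : ℕ) ⦃g h : G⦄ ⦃a b : A⦄, a ∈ 𝒜 g → b ∈ 𝒜 h → m n a b ∈ 𝒜 (g * h)
  assoc : ∀ a b c : A⟦X⟧, formalMul m (formalMul m a b) c = formalMul m a (formalMul m b c)
  one_mul : ∀ a : A⟦X⟧, formalMul m 1 a = a
  mul_one : ∀ a : A⟦X⟧, formalMul m a 1 = a

/-- `m_t = ∑ t^n m_n` is a graded star product on the color Poisson algebra `(A, P)`. -/
structure IsGradedStarProduct (χ : AntisymmBicharacter K G) (𝒜 : G → Submodule K A)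
    (P : A →ₗ[K] A →ₗ[K] A) (m : ℕ → A →ₗ[K] A →ₗ[K] A) : Prop where
  isColorPoissonAlgebra : IsColorPoissonAlgebra χ 𝒜 P
  isGradedDeformation : IsGradedDeformation 𝒜 m
  bracket_eq : ∀ ⦃g h : G⦄ ⦃a b : A⦄, a ∈ 𝒜 g → b ∈ 𝒜 h →
    m 1 a b - (χ g h : K) • m 1 b a = P a b

end Poisson

end

/-! The substance is that ω is well defined on gr(U), and this is where a PBW theorem is needed.
Call a linear map Φ on T(L) compatible in degree n if Φ(t) = Φ(σ_i t) + Φ(β_i t) on T^n, where σ_i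
is the colored swap of the letters i, i+1 and β_i brackets them. A map compatible in every degree
factors through U (`exists_linearMap_U`). In characteristic zero, a Φ compatible up to degree n can
be changed in higher degrees so as to be compatible everywhere (`exists_extension`,
`exists_respectsRel`): the operators (x, v) ↦ (σ_i x, Φ(β_i x) + v) on T^{n+1} × V satisfy the
Coxeter relations of a symmetric group, by Jacobi, skew-symmetry and compatibility in degree n, and
averaging over that group (`exists_symmetrizer`) yields the new values in degree n+1. Applied to the
symmetrization of T^p, extended by zero, this gives a map U → U which symmetrizes p-fold products
and kills U_{p-1}. Hence it descends to gr^p(U) (`exists_isSymmetrization`).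

Reordering p factors costs only the color sign modulo U_{p-1} (`mkU_tprod_perm`), so ω(π_n(u)) ≡ u
modulo U_{n-1}. Every linear map with this property is bijective, by induction along the filtration
(`IsSplitting.bijective`).

The G-degree is detected by the algebra map U → U[G], x ↦ x g for x of degree g. Its coefficients
are filtered projections, which makes the grading of gr(U) direct and extends the color commutator
bilinearly to U. That commutator satisfies the Leibniz and Jacobi identities in U itself and lands
one filtration step below the product. Taking classes gives the Poisson structure.

Finally, m_n(u, v) is the component of degree p+q-n of ω(u)ω(v). Associativity of the star product
is associativity of U sorted by components (`sum_symbolAt_map`). The map m_0 is the top symbol of a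
product, and the color antisymmetrization of m_1 is the symbol of a color commutator. The term n =
p+q is the component in gr^0, which is the augmentation of U: it is multiplicative and vanishes on
ω(gr^p) for p > 0. -/

noncomputable section

/-! ### Preliminaries: decompositions and averaging over Coxeter generators. -/

/-- A family of submodules which spans and admits separating projections is a decomposition. -/
theorem DirectSum.isInternal_of_projections {R ι M : Type*} [Ring R] [AddCommGroup M] [Module R M]
    [DecidableEq ι] (𝒜 : ι → Submodule R M) (p : ι → M →ₗ[R] M)
    (hp : ∀ i, ∀ a ∈ 𝒜 i, p i a = a) (hp' : ∀ i j, i ≠ j → ∀ a ∈ 𝒜 j, p i a = 0)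
    (hsup : ∀ a, a ∈ ⨆ i, 𝒜 i) : DirectSum.IsInternal 𝒜 := by
  rw [DirectSum.isInternal_submodule_iff_iSupIndep_and_iSup_eq_top]
  refine ⟨fun i => ?_, eq_top_iff.2 fun a _ => hsup a⟩
  rw [Submodule.disjoint_def]
  intro x hx hx'
  have h : (⨆ j, ⨆ (_ : j ≠ i), 𝒜 j) ≤ LinearMap.ker (p i) :=
    iSup₂_le fun j hj a ha => hp' i j hj.symm a ha
  rw [← hp i x hx]
  exact h hx'

/-- Elements satisfying the Coxeter relations of the symmetric group (relative to an idempotent `e`)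
admit a symmetrizer. -/
theorem exists_symmetrizer {K R : Type*} [Field K] [CharZero K] [Ring R] [Algebra K R]
    (s : ℕ → R) (e : R) (n : ℕ) (hsq : ∀ i < n, s i * s i = e) (hse : ∀ i < n, s i * e = s i)
    (hee : e * e = e) (hes : ∀ i < n, e * s i = s i)
    (hcomm : ∀ i j, i + 2 ≤ j → j < n → s i * s j = s j * s i)
    (hbraid : ∀ i, i + 1 < n → s i * s (i + 1) * s i = s (i + 1) * s i * s (i + 1)) :
    ∃ P : R, P * e = P ∧ (∀ i < n, P * s i = P) ∧
      ∀ r : R, e * r = r → (∀ i < n, s i * r = r) → P * r = r := by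
  induction n with
  | zero => exact ⟨e, hee, by simp, fun r hr _ => hr⟩
  | succ n ih =>
    obtain ⟨P, hPe, hPs, hPr⟩ := ih (fun i hi => hsq i (by omega)) (fun i hi => hse i (by omega))
      (fun i hi => hes i (by omega)) (fun i j hij hj => hcomm i j hij (by omega))
      (fun i hi => hbraid i (by omega))
    -- `C m` is s_n s_{n-1} ⋯ s_{n-m+1}. For m ≤ n+1 these stand for the n+2 cosets of the subgroup
    -- generated by s_0, …, s_{n-1}.
    obtain ⟨C, C0, CS⟩ : ∃ C : ℕ → R, C 0 = e ∧ ∀ m, C (m + 1) = C m * s (n - m) :=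
      ⟨fun m => Nat.rec e (fun m c => c * s (n - m)) m, rfl, fun _ => rfl⟩
    have Ce : ∀ m, m ≤ n + 1 → C m * e = C m := by
      intro m hm
      cases m with
      | zero => rw [C0, hee]
      | succ m => rw [CS, mul_assoc, hse _ (by omega)]
    -- The generators occurring in `C m` have index at least i+2, so they commute with s_i.
    have Clow : ∀ m i, m ≤ n + 1 → i + m < n → C m * s i = s i * C m := by
      intro m
      induction m with
      | zero => intro i _ hi; rw [C0, hes i (by omega), hse i (by omega)]
      | succ m ihm =>
        intro i hm hi
        rw [CS, mul_assoc, ← hcomm i (n - m) (by omega) (by omega), ← mul_assoc,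
          ihm i (by omega) (by omega), mul_assoc]
    -- A generator passing through a descending run that contains s_{i+1} s_i drops its index by
    -- one; this is the braid relation.
    have Chigh : ∀ m i, m ≤ n + 1 → i < n → n < i + m → C m * s (i + 1) = s i * C m := by
      intro m
      induction m with
      | zero => intro i _ hi hi'; omega
      | succ m ihm =>
        intro i hm hi hi'
        by_cases h : n = i + m
        · obtain ⟨m, rfl⟩ : ∃ k, m = k + 1 := ⟨m - 1, by omega⟩
          have h1 : n - (m + 1) = i := by omega
          have h2 : n - m = i + 1 := by omega
          rw [CS, CS, h1, h2, mul_assoc, mul_assoc, ← mul_assoc (s (i + 1)),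
            ← hbraid i (by omega), ← mul_assoc, ← mul_assoc, Clow m i (by omega) (by omega)]
          simp only [mul_assoc]
        · rw [CS, mul_assoc, hcomm (n - m) (i + 1) (by omega) (by omega), ← mul_assoc,
            ihm i (by omega) hi (by omega), mul_assoc]
    -- Right multiplication by s_i permutes the elements P C_m. It exchanges m = n-i and m = n+1-i,
    -- by the recursion for `C` and s_i² = e; for the other m a generator of the subgroup moves to
    -- the left and is absorbed by P. The average of the P C_m is therefore invariant.
    have key : ∀ i < n + 1, ∀ m ∈ Finset.range (n + 2),
        P * C m * s i = P * C (Equiv.swap (n - i) (n + 1 - i) m) := by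
      intro i hi m hm
      rw [Finset.mem_range] at hm
      rcases lt_trichotomy (i + m) n with h | h | h
      · rw [Equiv.swap_apply_of_ne_of_ne (by omega) (by omega), mul_assoc,
          Clow m i (by omega) h, ← mul_assoc, hPs i (by omega)]
      · have h1 : n - i = m := by omega
        have h2 : n + 1 - i = m + 1 := by omega
        rw [h1, h2, Equiv.swap_apply_left, CS, mul_assoc, show n - m = i by omega]
      · by_cases h' : i + m = n + 1
        · obtain ⟨m, rfl⟩ : ∃ k, m = k + 1 := ⟨m - 1, by omega⟩
          have h1 : n - i = m := by omega
          have h2 : n + 1 - i = m + 1 := by omega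
          rw [h1, h2, Equiv.swap_apply_right, CS, show n - m = i by omega, mul_assoc, mul_assoc,
            hsq i hi, Ce m (by omega)]
        · obtain ⟨i, rfl⟩ : ∃ k, i = k + 1 := ⟨i - 1, by omega⟩
          rw [Equiv.swap_apply_of_ne_of_ne (by omega) (by omega), mul_assoc,
            Chigh m i (by omega) (by omega) (by omega), ← mul_assoc, hPs i (by omega)]
    have hne : ((n + 2 : ℕ) : K) ≠ 0 := Nat.cast_ne_zero.2 (by omega)
    refine ⟨((n + 2 : ℕ) : K)⁻¹ • ∑ m ∈ Finset.range (n + 2), P * C m, ?_, ?_, ?_⟩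
    · rw [smul_mul_assoc, Finset.sum_mul]
      congr 1
      refine Finset.sum_congr rfl fun m hm => ?_
      rw [mul_assoc, Ce m (by rw [Finset.mem_range] at hm; omega)]
    · intro i hi
      rw [smul_mul_assoc, Finset.sum_mul, Finset.sum_congr rfl (key i hi)]
      congr 1
      have hmem : ∀ m ∈ Finset.range (n + 2),
          Equiv.swap (n - i) (n + 1 - i) m ∈ Finset.range (n + 2) := by
        intro m hm
        rw [Finset.mem_range] at hm ⊢
        rw [Equiv.swap_apply_def]
        split_ifs <;> omega
      exact Finset.sum_nbij' (fun m => Equiv.swap (n - i) (n + 1 - i) m)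
        (fun m => Equiv.swap (n - i) (n + 1 - i) m) hmem hmem (by simp) (by simp) (by simp)
    · intro r her hr
      have hC : ∀ m, m ≤ n + 1 → C m * r = r := by
        intro m
        induction m with
        | zero => intro _; rw [C0, her]
        | succ m ihm => intro hm; rw [CS, mul_assoc, hr _ (by omega), ihm (by omega)]
      rw [smul_mul_assoc, Finset.sum_mul, Finset.sum_congr rfl (g := fun _ => r), Finset.sum_const,
        Finset.card_range, ← Nat.cast_smul_eq_nsmul K, smul_smul, inv_mul_cancel₀ hne, one_smul]
      intro m hm
      rw [Finset.mem_range] at hm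
      rw [mul_assoc, hC m (by omega), hPr r her fun i hi => hr i (by omega)]

/-! ### The product on A⟦t⟧ attached to a sequence of bilinear maps. -/

section FormalMul

variable {K A : Type*} [Field K] [Ring A] [Algebra K A] {m : ℕ → A →ₗ[K] A →ₗ[K] A}

theorem coeff_formalMul (a b : A⟦X⟧) (r : ℕ) :
    PowerSeries.coeff r (formalMul m a b) =
      ∑ x ∈ Finset.HasAntidiagonal.antidiagonal r, ∑ y ∈ Finset.HasAntidiagonal.antidiagonal x.2,
        m x.1 (PowerSeries.coeff y.1 a) (PowerSeries.coeff y.2 b) :=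
  PowerSeries.coeff_mk _ _

/-- Both triple products expand into sums over decompositions r = n + n' + i + j + k, with n, n' the
orders of the two bilinear maps. Grouping n + n' = N leaves exactly the hypothesis for each N. -/
theorem formalMul_assoc
    (h : ∀ (N : ℕ) (a b c : A), ∑ x ∈ Finset.HasAntidiagonal.antidiagonal N, m x.1 (m x.2 a b) c =
      ∑ x ∈ Finset.HasAntidiagonal.antidiagonal N, m x.1 a (m x.2 b c)) (a b c : A⟦X⟧) :
    formalMul m (formalMul m a b) c = formalMul m a (formalMul m b c) := by
  ext r
  have h1 : PowerSeries.coeff r (formalMul m (formalMul m a b) c) =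
      ∑ z ∈ Finset.HasAntidiagonal.antidiagonal r, ∑ y ∈ Finset.HasAntidiagonal.antidiagonal z.2,
        ∑ w ∈ Finset.HasAntidiagonal.antidiagonal y.2, ∑ x ∈ Finset.HasAntidiagonal.antidiagonal z.1,
          m x.1 (m x.2 (PowerSeries.coeff y.1 a) (PowerSeries.coeff w.1 b))
            (PowerSeries.coeff w.2 c) := by
    simp only [coeff_formalMul, map_sum, LinearMap.sum_apply, Finset.sum_sigma']
    -- The regrouping collects the orders of the outer and inner map into one pair, and the
    -- exponents of the three series into the nested pairs i, (j, k).
    refine Finset.sum_nbij'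
      (fun q => ⟨(q.1.1 + q.2.2.1.1, q.2.2.1.2 + q.2.1.2),
        (q.2.2.2.1, q.2.2.2.2 + q.2.1.2), (q.2.2.2.2, q.2.1.2), (q.1.1, q.2.2.1.1)⟩)
      (fun q => ⟨(q.2.2.2.1, q.2.2.2.2 + q.1.2), (q.2.2.2.2 + (q.2.1.1 + q.2.2.1.1), q.2.2.1.2),
        (q.2.2.2.2, q.2.1.1 + q.2.2.1.1), (q.2.1.1, q.2.2.1.1)⟩) ?_ ?_ ?_ ?_ ?_
    all_goals
      rintro ⟨⟨a1, a2⟩, ⟨b1, b2⟩, ⟨c1, c2⟩, ⟨d1, d2⟩⟩ hq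
      simp only [Finset.mem_sigma, Finset.HasAntidiagonal.mem_antidiagonal] at hq ⊢
    · obtain ⟨rfl, rfl, rfl, rfl⟩ := hq
      simp [add_assoc, add_left_comm]
    · obtain ⟨rfl, rfl, rfl, rfl⟩ := hq
      simp [add_assoc, add_left_comm]
    · obtain ⟨rfl, rfl, rfl, rfl⟩ := hq
      simp [add_assoc]
    · obtain ⟨rfl, rfl, rfl, rfl⟩ := hq
      simp [add_assoc]
  have h2 : PowerSeries.coeff r (formalMul m a (formalMul m b c)) =
      ∑ z ∈ Finset.HasAntidiagonal.antidiagonal r, ∑ y ∈ Finset.HasAntidiagonal.antidiagonal z.2,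
        ∑ w ∈ Finset.HasAntidiagonal.antidiagonal y.2, ∑ x ∈ Finset.HasAntidiagonal.antidiagonal z.1,
          m x.1 (PowerSeries.coeff y.1 a) (m x.2 (PowerSeries.coeff w.1 b)
            (PowerSeries.coeff w.2 c)) := by
    simp only [coeff_formalMul, map_sum, Finset.sum_sigma']
    refine Finset.sum_nbij'
      (fun q => ⟨(q.1.1 + q.2.2.1.1, q.2.1.1 + q.2.2.1.2),
        (q.2.1.1, q.2.2.1.2), (q.2.2.2.1, q.2.2.2.2), (q.1.1, q.2.2.1.1)⟩)
      (fun q => ⟨(q.2.2.2.1, q.2.2.2.2 + q.1.2), (q.2.1.1, q.2.2.2.2 + q.2.1.2),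
        (q.2.2.2.2, q.2.1.2), (q.2.2.1.1, q.2.2.1.2)⟩) ?_ ?_ ?_ ?_ ?_
    all_goals
      rintro ⟨⟨a1, a2⟩, ⟨b1, b2⟩, ⟨c1, c2⟩, ⟨d1, d2⟩⟩ hq
      simp only [Finset.mem_sigma, Finset.HasAntidiagonal.mem_antidiagonal] at hq ⊢
    · obtain ⟨rfl, rfl, rfl, rfl⟩ := hq
      simp [add_assoc, add_left_comm]
    · obtain ⟨rfl, rfl, rfl, rfl⟩ := hq
      simp [add_assoc, add_left_comm]
    · obtain ⟨rfl, rfl, rfl, rfl⟩ := hq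
      simp [add_left_comm]
    · obtain ⟨rfl, rfl, rfl, rfl⟩ := hq
      simp [add_assoc, add_left_comm]
  rw [h1, h2]
  exact Finset.sum_congr rfl fun _ _ => Finset.sum_congr rfl fun _ _ =>
    Finset.sum_congr rfl fun _ _ => h _ _ _ _

theorem formalMul_C_C (a b : A) (r : ℕ) :
    PowerSeries.coeff r (formalMul m (PowerSeries.C a) (PowerSeries.C b)) = m r a b := by
  rw [coeff_formalMul, Finset.sum_eq_single (r, 0)]
  · simp
  · rintro ⟨i, j⟩ hij hne
    rw [Finset.HasAntidiagonal.mem_antidiagonal] at hij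
    refine Finset.sum_eq_zero ?_
    rintro ⟨k, l⟩ hkl
    rw [Finset.HasAntidiagonal.mem_antidiagonal] at hkl
    simp only [PowerSeries.coeff_C]
    by_cases hk : k = 0
    · have hl : l ≠ 0 := by
        rintro rfl
        refine hne (Prod.ext ?_ ?_) <;> simp only at * <;> omega
      simp [hl]
    · simp [hk]
  · simp

theorem formalMul_one_left (h0 : ∀ b, m 0 1 b = b) (h : ∀ n b, n ≠ 0 → m n 1 b = 0) (b : A⟦X⟧) :
    formalMul m 1 b = b := by
  ext r
  rw [coeff_formalMul, Finset.sum_eq_single (0, r), Finset.sum_eq_single (0, r)]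
  · simp [h0]
  · rintro ⟨i, j⟩ hij hne
    rw [Finset.HasAntidiagonal.mem_antidiagonal] at hij
    have hi : i ≠ 0 := by
      rintro rfl
      refine hne (Prod.ext rfl ?_)
      simp only at *
      omega
    simp [PowerSeries.coeff_one, hi]
  · simp
  · rintro ⟨i, j⟩ hij hne
    rw [Finset.HasAntidiagonal.mem_antidiagonal] at hij
    have hi : i ≠ 0 := by
      rintro rfl
      refine hne (Prod.ext rfl ?_)
      simp only at *
      omega
    refine Finset.sum_eq_zero fun y _ => ?_
    rw [PowerSeries.coeff_one]
    split_ifs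
    · exact h i _ hi
    · simp
  · simp

theorem formalMul_one_right (h0 : ∀ b, m 0 b 1 = b) (h : ∀ n b, n ≠ 0 → m n b 1 = 0) (b : A⟦X⟧) :
    formalMul m b 1 = b := by
  ext r
  rw [coeff_formalMul, Finset.sum_eq_single (0, r), Finset.sum_eq_single (r, 0)]
  · simp [h0]
  · rintro ⟨i, j⟩ hij hne
    rw [Finset.HasAntidiagonal.mem_antidiagonal] at hij
    have hi : j ≠ 0 := by
      rintro rfl
      refine hne (Prod.ext ?_ rfl)
      simp only at *
      omega
    simp [PowerSeries.coeff_one, hi]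
  · simp
  · rintro ⟨i, j⟩ hij hne
    rw [Finset.HasAntidiagonal.mem_antidiagonal] at hij
    have hi : i ≠ 0 := by
      rintro rfl
      refine hne (Prod.ext rfl ?_)
      simp only at *
      omega
    refine Finset.sum_eq_zero fun y _ => ?_
    rw [PowerSeries.coeff_one]
    split_ifs
    · exact h i _ hi
    · simp
  · simp

end FormalMul

/-! ### Words in the tensor algebra, colored swaps and brackets of adjacent letters. -/

namespace ColorLieAlgebra

open Module

variable {K G L I : Type*} [Field K] [CommGroup G] [DecidableEq G]
  [AddCommGroup L] [Module K L] {χ : AntisymmBicharacter K G} (𝔤 : ColorLieAlgebra χ L)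

/-- A basis of `L` adapted to the `G`-grading. -/
structure IsHomogeneousBasis (b : Basis I K L) (deg : I → G) : Prop where
  mem : ∀ i, b i ∈ 𝔤.grading (deg i)
  le_span : ∀ g, 𝔤.grading g ≤ Submodule.span K {x | ∃ i, deg i = g ∧ b i = x}

/-- The product of the basis vectors in a word. -/
def word (b : Basis I K L) (w : List I) : TensorAlgebra K L := (w.map fun i => TensorAlgebra.ι K (b i)).prod

@[simp] theorem word_nil (b : Basis I K L) : word b [] = 1 := rfl

@[simp] theorem word_cons (b : Basis I K L) (a : I) (w : List I) :
    word b (a :: w) = TensorAlgebra.ι K (b a) * word b w := by simp [word]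

/-- Since words form a basis, a linear map on the tensor algebra may be prescribed freely on words.
All operators below arise in this way. -/
theorem tensorAlgebra_basis_apply (b : Basis I K L) (w : FreeMonoid I) :
    b.tensorAlgebra w = word b w.toList := by
  rw [Basis.tensorAlgebra, Basis.map_apply, FreeAlgebra.basisFreeMonoid]
  induction w using FreeMonoid.inductionOn' with
  | one => simp [← MonoidAlgebra.one_def]
  | of_mul a w ih =>
    simp only [Basis.map_apply, Finsupp.coe_basisSingleOne, AlgEquiv.toLinearEquiv_apply,
      LinearEquiv.symm_trans_apply, FreeMonoid.toList_mul, FreeMonoid.toList_of,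
      List.singleton_append, word_cons] at ih ⊢
    rw [← ih]
    have h : (MonoidAlgebra.coeffLinearEquiv K).symm (Finsupp.single (FreeMonoid.of a * w) (1 : K)) =
        MonoidAlgebra.single (FreeMonoid.of a) 1 *
        (MonoidAlgebra.coeffLinearEquiv K).symm (Finsupp.single w (1 : K)) := by
      have := MonoidAlgebra.single_mul_single (FreeMonoid.of a) w (1 : K) 1
      rw [one_mul] at this
      exact this.symm
    change (TensorAlgebra.equivFreeAlgebra b).symm
      (FreeAlgebra.equivMonoidAlgebraFreeMonoid.symm _) = TensorAlgebra.ι K (b a) *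
      (TensorAlgebra.equivFreeAlgebra b).symm (FreeAlgebra.equivMonoidAlgebraFreeMonoid.symm _)
    rw [h, map_mul, map_mul]
    congr 1
    rw [← TensorAlgebra.equivFreeAlgebra_symm_ι]
    congr 1
    exact FreeAlgebra.equivMonoidAlgebraFreeMonoid.symm_apply_eq.2 (by
      simp [FreeAlgebra.equivMonoidAlgebraFreeMonoid])

/-- The linear map out of the tensor algebra with given values on words. -/
def ofWords (b : Basis I K L) {V : Type*} [AddCommGroup V] [Module K V] (f : List I → V) :
    TensorAlgebra K L →ₗ[K] V :=
  b.tensorAlgebra.constr K fun w => f w.toList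

@[simp] theorem ofWords_word (b : Basis I K L) {V : Type*} [AddCommGroup V] [Module K V]
    (f : List I → V) (w : List I) : ofWords b f (word b w) = f w := by
  have h := tensorAlgebra_basis_apply b (FreeMonoid.ofList w)
  rw [FreeMonoid.toList_ofList] at h
  rw [← h, ofWords, Basis.constr_basis, FreeMonoid.toList_ofList]

theorem hom_ext_word (b : Basis I K L) {V : Type*} [AddCommGroup V] [Module K V]
    {f f' : TensorAlgebra K L →ₗ[K] V} (h : ∀ w, f (word b w) = f' (word b w)) : f = f' :=
  b.tensorAlgebra.ext fun w => by rw [tensorAlgebra_basis_apply, h]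

/-- The homogeneous part of degree `n` of the tensor algebra. -/
abbrev tensorPow (K L : Type*) [Field K] [AddCommGroup L] [Module K L] (n : ℕ) :
    Submodule K (TensorAlgebra K L) := LinearMap.range (TensorAlgebra.ι K : L →ₗ[K] TensorAlgebra K L) ^ n

theorem ι_mul_mem_tensorPow (x : L) {n : ℕ} {t : TensorAlgebra K L} (ht : t ∈ tensorPow K L n) :
    TensorAlgebra.ι K x * t ∈ tensorPow K L (n + 1) := by
  rw [tensorPow, pow_succ']
  exact Submodule.mul_mem_mul ⟨x, rfl⟩ ht

theorem word_mem_tensorPow (b : Basis I K L) (w : List I) :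
    word b w ∈ tensorPow K L w.length := by
  induction w with
  | nil => simp [tensorPow]
  | cons a w ih => rw [word_cons]; exact ι_mul_mem_tensorPow _ ih

theorem tensorPow_le_span (b : Basis I K L) (n : ℕ) :
    tensorPow K L n ≤ Submodule.span K {t | ∃ w : List I, w.length = n ∧ word b w = t} := by
  induction n with
  | zero =>
    rw [tensorPow, pow_zero, Submodule.one_eq_span, Submodule.span_le]
    rintro _ rfl
    exact Submodule.subset_span ⟨[], rfl, rfl⟩
  | succ n ih =>
    have h : LinearMap.range (TensorAlgebra.ι K : L →ₗ[K] TensorAlgebra K L) ≤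
        Submodule.span K (Set.range fun i => TensorAlgebra.ι K (b i)) := by
      rw [← Function.comp_def (TensorAlgebra.ι K) b, Set.range_comp, Submodule.span_image, b.span_eq,
        Submodule.map_top]
    rw [tensorPow, pow_succ']
    refine (mul_le_mul' h ih).trans ?_
    rw [Submodule.span_mul_span, Submodule.span_le]
    rintro _ ⟨_, ⟨i, rfl⟩, _, ⟨w, rfl, rfl⟩, rfl⟩
    exact Submodule.subset_span ⟨i :: w, rfl, by simp⟩

theorem eqOn_tensorPow (b : Basis I K L) {V : Type*} [AddCommGroup V] [Module K V]
    {f f' : TensorAlgebra K L →ₗ[K] V} {n : ℕ}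
    (h : ∀ w : List I, w.length = n → f (word b w) = f' (word b w)) {t : TensorAlgebra K L}
    (ht : t ∈ tensorPow K L n) : f t = f' t := by
  have hle : Submodule.span K {t | ∃ w : List I, w.length = n ∧ word b w = t} ≤
      LinearMap.eqLocus f f' := by
    rw [Submodule.span_le]
    rintro _ ⟨w, hw, rfl⟩
    exact h w hw
  exact hle (tensorPow_le_span b n ht)

theorem mapsTo_tensorPow (b : Basis I K L) {V : Type*} [AddCommGroup V] [Module K V]
    {f : TensorAlgebra K L →ₗ[K] V} {n : ℕ} {N : Submodule K V}
    (h : ∀ w : List I, w.length = n → f (word b w) ∈ N) {t : TensorAlgebra K L}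
    (ht : t ∈ tensorPow K L n) : f t ∈ N := by
  have hle : Submodule.span K {t | ∃ w : List I, w.length = n ∧ word b w = t} ≤ N.comap f := by
    rw [Submodule.span_le]
    rintro _ ⟨w, hw, rfl⟩
    exact h w hw
  exact hle (tensorPow_le_span b n ht)

/-- The colored transposition of the letters in positions `i`, `i + 1` (zero on short words). -/
def swapWord (χ : AntisymmBicharacter K G) (b : Basis I K L) (deg : I → G) :
    ℕ → List I → TensorAlgebra K L
  | 0, x :: y :: w => (χ (deg x) (deg y) : K) • (TensorAlgebra.ι K (b y) * (TensorAlgebra.ι K (b x) * word b w))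
  | i + 1, x :: w => TensorAlgebra.ι K (b x) * swapWord χ b deg i w
  | _, _ => 0

/-- The bracket of the letters in positions `i`, `i + 1` (zero on short words). -/
def bracketWord (b : Basis I K L) : ℕ → List I → TensorAlgebra K L
  | 0, x :: y :: w => TensorAlgebra.ι K (𝔤.bracket (b x) (b y)) * word b w
  | i + 1, x :: w => TensorAlgebra.ι K (b x) * bracketWord b i w
  | _, _ => 0

/-- The linear extension of `swapWord`. -/
def swapAt (χ : AntisymmBicharacter K G) (b : Basis I K L) (deg : I → G) (i : ℕ) :
    TensorAlgebra K L →ₗ[K] TensorAlgebra K L := ofWords b (swapWord χ b deg i)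

/-- The linear extension of `bracketWord`. -/
def bracketAt (b : Basis I K L) (i : ℕ) : TensorAlgebra K L →ₗ[K] TensorAlgebra K L :=
  ofWords b (𝔤.bracketWord b i)

section Operators

variable (b : Basis I K L) (deg : I → G)

@[simp] theorem swapAt_one (i : ℕ) : swapAt χ b deg i 1 = 0 := by
  have h := ofWords_word b (swapWord χ b deg i) []
  rw [word_nil] at h
  rw [swapAt, h]
  cases i <;> rfl

@[simp] theorem bracketAt_one (i : ℕ) : 𝔤.bracketAt b i 1 = 0 := by
  have h := ofWords_word b (𝔤.bracketWord b i) []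
  rw [word_nil] at h
  rw [bracketAt, h]
  cases i <;> rfl

theorem eq_of_basis {V : Type*} [AddCommGroup V] [Module K V] {f f' : L →ₗ[K] V}
    (h : ∀ a, f (b a) = f' (b a)) (x : L) : f x = f' x := by
  rw [b.ext h]

-- Allowing an arbitrary first factor, and not only a basis letter, lets the later identities be
-- proved by peeling off first factors until the position is 0.
@[simp] theorem swapAt_succ_mul (i : ℕ) (x : L) (t : TensorAlgebra K L) :
    swapAt χ b deg (i + 1) (TensorAlgebra.ι K x * t) = TensorAlgebra.ι K x * swapAt χ b deg i t := by
  refine eq_of_basis b (f := swapAt χ b deg (i + 1) ∘ₗ LinearMap.mulRight K t ∘ₗ TensorAlgebra.ι K)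
    (f' := LinearMap.mulRight K (swapAt χ b deg i t) ∘ₗ TensorAlgebra.ι K) (fun a => ?_) x
  have h : swapAt χ b deg (i + 1) ∘ₗ LinearMap.mulLeft K (TensorAlgebra.ι K (b a)) =
      LinearMap.mulLeft K (TensorAlgebra.ι K (b a)) ∘ₗ swapAt χ b deg i := by
    refine hom_ext_word b fun w => ?_
    simp only [LinearMap.comp_apply, LinearMap.mulLeft_apply, ← word_cons]
    simp only [swapAt, ofWords_word, swapWord]
  exact LinearMap.congr_fun h t

@[simp] theorem bracketAt_succ_mul (i : ℕ) (x : L) (t : TensorAlgebra K L) :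
    𝔤.bracketAt b (i + 1) (TensorAlgebra.ι K x * t) = TensorAlgebra.ι K x * 𝔤.bracketAt b i t := by
  refine eq_of_basis b (f := 𝔤.bracketAt b (i + 1) ∘ₗ LinearMap.mulRight K t ∘ₗ TensorAlgebra.ι K)
    (f' := LinearMap.mulRight K (𝔤.bracketAt b i t) ∘ₗ TensorAlgebra.ι K) (fun a => ?_) x
  have h : 𝔤.bracketAt b (i + 1) ∘ₗ LinearMap.mulLeft K (TensorAlgebra.ι K (b a)) =
      LinearMap.mulLeft K (TensorAlgebra.ι K (b a)) ∘ₗ 𝔤.bracketAt b i := by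
    refine hom_ext_word b fun w => ?_
    simp only [LinearMap.comp_apply, LinearMap.mulLeft_apply, ← word_cons]
    simp only [bracketAt, ofWords_word, bracketWord]
  exact LinearMap.congr_fun h t

-- The factor 1 is kept because `word_cons` turns a one-letter word into this shape. For the same
-- reason `mul_one` is removed from the simp set in the case analyses on short words.
@[simp] theorem swapAt_zero_ι_mul_one (x : L) : swapAt χ b deg 0 (TensorAlgebra.ι K x * 1) = 0 := by
  refine eq_of_basis b (f := swapAt χ b deg 0 ∘ₗ LinearMap.mulRight K 1 ∘ₗ TensorAlgebra.ι K)
    (f' := 0) (fun a => ?_) x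
  have h := ofWords_word b (swapWord χ b deg 0) [a]
  rw [word_cons, word_nil] at h
  exact h

@[simp] theorem bracketAt_zero_ι_mul_one (x : L) : 𝔤.bracketAt b 0 (TensorAlgebra.ι K x * 1) = 0 := by
  refine eq_of_basis b (f := 𝔤.bracketAt b 0 ∘ₗ LinearMap.mulRight K 1 ∘ₗ TensorAlgebra.ι K)
    (f' := 0) (fun a => ?_) x
  have h := ofWords_word b (𝔤.bracketWord b 0) [a]
  rw [word_cons, word_nil] at h
  exact h

@[simp] theorem bracketAt_zero_mul (x y : L) (t : TensorAlgebra K L) :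
    𝔤.bracketAt b 0 (TensorAlgebra.ι K x * (TensorAlgebra.ι K y * t)) = TensorAlgebra.ι K (𝔤.bracket x y) * t := by
  refine eq_of_basis b (f := 𝔤.bracketAt b 0 ∘ₗ LinearMap.mulRight K (TensorAlgebra.ι K y * t) ∘ₗ TensorAlgebra.ι K)
    (f' := LinearMap.mulRight K t ∘ₗ TensorAlgebra.ι K ∘ₗ 𝔤.bracket.flip y) (fun a => ?_) x
  refine eq_of_basis b (f := 𝔤.bracketAt b 0 ∘ₗ LinearMap.mulLeft K (TensorAlgebra.ι K (b a)) ∘ₗ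
    LinearMap.mulRight K t ∘ₗ TensorAlgebra.ι K)
    (f' := LinearMap.mulRight K t ∘ₗ TensorAlgebra.ι K ∘ₗ 𝔤.bracket (b a)) (fun c => ?_) y
  have h : 𝔤.bracketAt b 0 ∘ₗ LinearMap.mulLeft K (TensorAlgebra.ι K (b a)) ∘ₗ LinearMap.mulLeft K (TensorAlgebra.ι K (b c)) =
      LinearMap.mulLeft K (TensorAlgebra.ι K (𝔤.bracket (b a) (b c))) := by
    refine hom_ext_word b fun w => ?_
    simp only [LinearMap.comp_apply, LinearMap.mulLeft_apply, ← word_cons]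
    simp only [bracketAt, ofWords_word, bracketWord]
  exact LinearMap.congr_fun h t

variable {b deg}

theorem eq_of_mem_grading (hb : 𝔤.IsHomogeneousBasis b deg) {V : Type*} [AddCommGroup V]
    [Module K V] {f f' : L →ₗ[K] V} {g : G} (h : ∀ a, deg a = g → f (b a) = f' (b a)) {x : L}
    (hx : x ∈ 𝔤.grading g) : f x = f' x := by
  have hle : Submodule.span K {x | ∃ i, deg i = g ∧ b i = x} ≤ LinearMap.eqLocus f f' := by
    rw [Submodule.span_le]
    rintro _ ⟨i, hi, rfl⟩
    exact h i hi
  exact hle (hb.le_span g hx)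

/-- The swap is defined on basis letters, but it must also be evaluated on letters such as [a, c],
which are homogeneous and need not belong to the basis. -/
theorem swapAt_zero_mul (hb : 𝔤.IsHomogeneousBasis b deg) {g h : G} {x y : L}
    (hx : x ∈ 𝔤.grading g) (hy : y ∈ 𝔤.grading h) (t : TensorAlgebra K L) :
    swapAt χ b deg 0 (TensorAlgebra.ι K x * (TensorAlgebra.ι K y * t)) = (χ g h : K) • (TensorAlgebra.ι K y * (TensorAlgebra.ι K x * t)) := by
  refine 𝔤.eq_of_mem_grading hb
    (f := swapAt χ b deg 0 ∘ₗ LinearMap.mulRight K (TensorAlgebra.ι K y * t) ∘ₗ TensorAlgebra.ι K)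
    (f' := (χ g h : K) • LinearMap.mulLeft K (TensorAlgebra.ι K y) ∘ₗ LinearMap.mulRight K t ∘ₗ TensorAlgebra.ι K)
    (fun a ha => ?_) hx
  refine 𝔤.eq_of_mem_grading hb (f := swapAt χ b deg 0 ∘ₗ LinearMap.mulLeft K (TensorAlgebra.ι K (b a)) ∘ₗ
    LinearMap.mulRight K t ∘ₗ TensorAlgebra.ι K)
    (f' := (χ g h : K) • LinearMap.mulRight K (TensorAlgebra.ι K (b a) * t) ∘ₗ TensorAlgebra.ι K) (fun c hc => ?_) hy
  have key : swapAt χ b deg 0 ∘ₗ LinearMap.mulLeft K (TensorAlgebra.ι K (b a)) ∘ₗ LinearMap.mulLeft K (TensorAlgebra.ι K (b c)) =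
      (χ g h : K) • LinearMap.mulLeft K (TensorAlgebra.ι K (b c)) ∘ₗ LinearMap.mulLeft K (TensorAlgebra.ι K (b a)) := by
    refine hom_ext_word b fun w => ?_
    simp only [LinearMap.comp_apply, LinearMap.smul_apply, LinearMap.mulLeft_apply, ← word_cons]
    simp only [swapAt, ofWords_word, swapWord, ha, hc]
    simp only [word_cons]
  exact LinearMap.congr_fun key t

theorem swapAt_zero_basis (hb : 𝔤.IsHomogeneousBasis b deg) (x y : I) (t : TensorAlgebra K L) :
    swapAt χ b deg 0 (TensorAlgebra.ι K (b x) * (TensorAlgebra.ι K (b y) * t)) =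
      (χ (deg x) (deg y) : K) • (TensorAlgebra.ι K (b y) * (TensorAlgebra.ι K (b x) * t)) :=
  𝔤.swapAt_zero_mul hb (hb.mem x) (hb.mem y) t

end Operators

end ColorLieAlgebra

namespace AntisymmBicharacter

variable {K G : Type*} [Field K] [CommGroup G] (χ : AntisymmBicharacter K G)

theorem coe_mul_swap (g h : G) : (χ g h : K) * χ h g = 1 := by
  rw [← Units.val_mul, χ.mul_swap, Units.val_one]

theorem coe_mul_right (g h k : G) : (χ g (h * k) : K) = χ g h * χ g k := by
  rw [χ.map_mul_right, Units.val_mul]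

theorem coe_mul_left (g h k : G) : (χ (g * h) k : K) = χ g k * χ h k := by
  rw [χ.map_mul_left, Units.val_mul]

@[simp] theorem one_left (h : G) : χ 1 h = 1 := by
  have := χ.map_mul_left 1 1 h
  simpa using this

@[simp] theorem one_right (h : G) : χ h 1 = 1 := by
  have := χ.map_mul_right h 1 1
  simpa using this

end AntisymmBicharacter

/-! ### Relations between the swap and bracket operators. -/

namespace ColorLieAlgebra

open Module

variable {K G L I : Type*} [Field K] [CommGroup G] [DecidableEq G]
  [AddCommGroup L] [Module K L] {χ : AntisymmBicharacter K G} (𝔤 : ColorLieAlgebra χ L)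
  {b : Basis I K L} {deg : I → G}

section Relations

variable (hb : 𝔤.IsHomogeneousBasis b deg)
include hb

theorem swapAt_mem {n : ℕ} (i : ℕ) {t : TensorAlgebra K L} (ht : t ∈ tensorPow K L n) :
    swapAt χ b deg i t ∈ tensorPow K L n := by
  refine mapsTo_tensorPow b (fun w hw => ?_) ht
  clear ht
  subst hw
  induction i generalizing w with
  | zero =>
    match w with
    | [] => simp
    | [a] => simp [-mul_one]
    | a :: c :: w =>
      rw [word_cons, word_cons, 𝔤.swapAt_zero_basis hb]
      exact Submodule.smul_mem _ _ (ι_mul_mem_tensorPow _ (ι_mul_mem_tensorPow _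
        (word_mem_tensorPow b w)))
  | succ i ih =>
    match w with
    | [] => simp
    | a :: w =>
      rw [word_cons, swapAt_succ_mul]
      exact ι_mul_mem_tensorPow _ (ih w)

omit hb in
theorem bracketAt_mem {n : ℕ} (i : ℕ) {t : TensorAlgebra K L} (ht : t ∈ tensorPow K L (n + 1)) :
    𝔤.bracketAt b i t ∈ tensorPow K L n := by
  refine mapsTo_tensorPow b (fun w hw => ?_) ht
  clear ht
  induction i generalizing w n with
  | zero =>
    match w with
    | [] => simp
    | [a] => simp [-mul_one]
    | a :: c :: w =>
      rw [word_cons, word_cons, bracketAt_zero_mul]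
      obtain rfl : w.length + 1 = n := by simpa using hw
      exact ι_mul_mem_tensorPow _ (word_mem_tensorPow b w)
  | succ i ih =>
    match w with
    | [] => simp
    | [a] => simp [-mul_one]
    | a :: c :: w =>
      obtain rfl : w.length + 1 = n := by simpa using hw
      rw [word_cons, bracketAt_succ_mul]
      exact ι_mul_mem_tensorPow _ (ih (c :: w) rfl)

/-- The bound on `i` matters: on words too short to have letters in both positions the swap is zero,
not the identity. -/
theorem swapAt_swapAt {n i : ℕ} (hi : i + 2 ≤ n) {t : TensorAlgebra K L}
    (ht : t ∈ tensorPow K L n) : swapAt χ b deg i (swapAt χ b deg i t) = t := by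
  refine eqOn_tensorPow b (f := swapAt χ b deg i ∘ₗ swapAt χ b deg i) (f' := LinearMap.id)
    (fun w hw => ?_) ht
  clear ht
  change swapAt χ b deg i (swapAt χ b deg i _) = word b w
  induction i generalizing w n with
  | zero =>
    match w with
    | [] => simp at hw; omega
    | [a] => simp at hw; omega
    | a :: c :: w =>
      rw [word_cons, word_cons, 𝔤.swapAt_zero_basis hb, map_smul, 𝔤.swapAt_zero_basis hb,
        smul_smul, χ.coe_mul_swap, one_smul]
  | succ i ih =>
    match w with
    | [] => simp at hw; omega
    | a :: w =>
      rw [word_cons, swapAt_succ_mul, swapAt_succ_mul, ih (n := w.length) _ w rfl]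
      simp at hw
      omega

/-- This is color skew-symmetry; it makes the twisted transpositions of `exists_extension`
involutive. -/
theorem bracketAt_swapAt (i : ℕ) (t : TensorAlgebra K L) :
    𝔤.bracketAt b i (swapAt χ b deg i t) = -𝔤.bracketAt b i t := by
  suffices H : 𝔤.bracketAt b i ∘ₗ swapAt χ b deg i =
      -𝔤.bracketAt b i by
    simpa only [LinearMap.comp_apply, LinearMap.add_apply, LinearMap.neg_apply] using
      LinearMap.congr_fun H t
  refine hom_ext_word b fun w => ?_
  simp only [LinearMap.comp_apply, LinearMap.neg_apply]
  induction i generalizing w with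
  | zero =>
    match w with
    | [] => simp
    | [a] => simp [-mul_one]
    | a :: c :: w =>
      rw [word_cons, word_cons, 𝔤.swapAt_zero_basis hb, map_smul, bracketAt_zero_mul,
        bracketAt_zero_mul, 𝔤.isColorLieBracket.skew (hb.mem a) (hb.mem c), map_neg, map_smul]
      simp
  | succ i ih =>
    match w with
    | [] => simp
    | a :: w => simp [ih]

theorem swapAt_comm (i j : ℕ) (hij : i + 2 ≤ j) (t : TensorAlgebra K L) :
    swapAt χ b deg i (swapAt χ b deg j t) = swapAt χ b deg j (swapAt χ b deg i t) := by
  suffices H : swapAt χ b deg i ∘ₗ swapAt χ b deg j =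
      swapAt χ b deg j ∘ₗ swapAt χ b deg i by
    simpa only [LinearMap.comp_apply, LinearMap.add_apply, LinearMap.neg_apply] using
      LinearMap.congr_fun H t
  refine hom_ext_word b fun w => ?_
  simp only [LinearMap.comp_apply]
  induction i generalizing w j with
  | zero =>
    obtain ⟨j, rfl⟩ : ∃ k, j = k + 2 := ⟨j - 2, by omega⟩
    match w with
    | [] => simp
    | [a] => simp [-mul_one]
    | a :: c :: w => simp [𝔤.swapAt_zero_basis hb]
  | succ i ih =>
    obtain ⟨j, rfl⟩ : ∃ k, j = k + 1 := ⟨j - 1, by omega⟩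
    match w with
    | [] => simp
    | a :: w => simp [ih j (by omega)]

/-- Both sides reverse three consecutive letters and produce the same three values of χ. -/
theorem swapAt_braid (i : ℕ) (t : TensorAlgebra K L) :
    swapAt χ b deg i (swapAt χ b deg (i + 1) (swapAt χ b deg i t)) =
      swapAt χ b deg (i + 1) (swapAt χ b deg i (swapAt χ b deg (i + 1) t)) := by
  suffices H : swapAt χ b deg i ∘ₗ swapAt χ b deg (i + 1) ∘ₗ swapAt χ b deg i =
      swapAt χ b deg (i + 1) ∘ₗ swapAt χ b deg i ∘ₗ swapAt χ b deg (i + 1) by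
    simpa only [LinearMap.comp_apply, LinearMap.add_apply, LinearMap.neg_apply] using
      LinearMap.congr_fun H t
  refine hom_ext_word b fun w => ?_
  simp only [LinearMap.comp_apply]
  induction i generalizing w with
  | zero =>
    match w with
    | [] => simp
    | [a] => simp [-mul_one]
    | [a, c] => simp [-mul_one, 𝔤.swapAt_zero_basis hb]
    | a :: c :: d :: w =>
      simp [𝔤.swapAt_zero_basis hb, smul_smul, mul_assoc, mul_comm]
  | succ i ih =>
    match w with
    | [] => simp
    | a :: w => simp [ih]

omit hb in
-- Bracketing merges two letters into one, so the positions to its right drop by one.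
theorem bracketAt_swapAt_far_right (i j : ℕ) (hij : i + 1 ≤ j) (t : TensorAlgebra K L) :
    𝔤.bracketAt b i (swapAt χ b deg (j + 1) t) = swapAt χ b deg j (𝔤.bracketAt b i t) := by
  suffices H : 𝔤.bracketAt b i ∘ₗ swapAt χ b deg (j + 1) =
      swapAt χ b deg j ∘ₗ 𝔤.bracketAt b i by
    simpa only [LinearMap.comp_apply, LinearMap.add_apply, LinearMap.neg_apply] using
      LinearMap.congr_fun H t
  refine hom_ext_word b fun w => ?_
  simp only [LinearMap.comp_apply]
  induction i generalizing w j with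
  | zero =>
    obtain ⟨j, rfl⟩ : ∃ k, j = k + 1 := ⟨j - 1, by omega⟩
    match w with
    | [] => simp
    | [a] => simp [-mul_one]
    | a :: c :: w => simp
  | succ i ih =>
    obtain ⟨j, rfl⟩ : ∃ k, j = k + 1 := ⟨j - 1, by omega⟩
    match w with
    | [] => simp
    | a :: w => simp [ih j (by omega)]

theorem bracketAt_swapAt_far_left (i j : ℕ) (hij : i + 2 ≤ j) (t : TensorAlgebra K L) :
    𝔤.bracketAt b j (swapAt χ b deg i t) = swapAt χ b deg i (𝔤.bracketAt b j t) := by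
  suffices H : 𝔤.bracketAt b j ∘ₗ swapAt χ b deg i =
      swapAt χ b deg i ∘ₗ 𝔤.bracketAt b j by
    simpa only [LinearMap.comp_apply, LinearMap.add_apply, LinearMap.neg_apply] using
      LinearMap.congr_fun H t
  refine hom_ext_word b fun w => ?_
  simp only [LinearMap.comp_apply]
  induction i generalizing w j with
  | zero =>
    obtain ⟨j, rfl⟩ : ∃ k, j = k + 2 := ⟨j - 2, by omega⟩
    match w with
    | [] => simp
    | [a] => simp [-mul_one]
    | a :: c :: w => simp [𝔤.swapAt_zero_basis hb]
  | succ i ih =>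
    obtain ⟨j, rfl⟩ : ∃ k, j = k + 1 := ⟨j - 1, by omega⟩
    match w with
    | [] => simp
    | a :: w => simp [ih j (by omega)]

omit hb in
theorem bracketAt_comm (i j : ℕ) (hij : i + 1 ≤ j) (t : TensorAlgebra K L) :
    𝔤.bracketAt b j (𝔤.bracketAt b i t) = 𝔤.bracketAt b i (𝔤.bracketAt b (j + 1) t) := by
  suffices H : 𝔤.bracketAt b j ∘ₗ 𝔤.bracketAt b i =
      𝔤.bracketAt b i ∘ₗ 𝔤.bracketAt b (j + 1) by
    simpa only [LinearMap.comp_apply, LinearMap.add_apply, LinearMap.neg_apply] using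
      LinearMap.congr_fun H t
  refine hom_ext_word b fun w => ?_
  simp only [LinearMap.comp_apply]
  induction i generalizing w j with
  | zero =>
    obtain ⟨j, rfl⟩ : ∃ k, j = k + 1 := ⟨j - 1, by omega⟩
    match w with
    | [] => simp
    | [a] => simp [-mul_one]
    | a :: c :: w => simp
  | succ i ih =>
    obtain ⟨j, rfl⟩ : ∃ k, j = k + 1 := ⟨j - 1, by omega⟩
    match w with
    | [] => simp
    | a :: w => simp [ih j (by omega)]

/-- Moving a letter past two neighbours and then bracketing them agrees with moving it past their
bracket, because χ is multiplicative and |[a, c]| = |a||c|. The next two lemmas are variants of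
this. -/
theorem bracketAt_succ_swapAt_swapAt (i : ℕ) (t : TensorAlgebra K L) :
    𝔤.bracketAt b (i + 1) (swapAt χ b deg i (swapAt χ b deg (i + 1) t)) =
      swapAt χ b deg i (𝔤.bracketAt b i t) := by
  suffices H : 𝔤.bracketAt b (i + 1) ∘ₗ swapAt χ b deg i ∘ₗ swapAt χ b deg (i + 1) =
      swapAt χ b deg i ∘ₗ 𝔤.bracketAt b i by
    simpa only [LinearMap.comp_apply, LinearMap.add_apply, LinearMap.neg_apply] using
      LinearMap.congr_fun H t
  refine hom_ext_word b fun w => ?_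
  simp only [LinearMap.comp_apply]
  induction i generalizing w with
  | zero =>
    match w with
    | [] => simp
    | [a] => simp [-mul_one]
    | [a, c] => simp [-mul_one]
    | a :: c :: d :: w =>
      simp [𝔤.swapAt_zero_basis hb, smul_smul, mul_comm,
        𝔤.swapAt_zero_mul hb (𝔤.isColorLieBracket.mem (hb.mem a) (hb.mem c)) (hb.mem d),
        χ.coe_mul_left]
  | succ i ih =>
    match w with
    | [] => simp
    | a :: w => simp [ih]

theorem bracketAt_swapAt_swapAt_succ (i : ℕ) (t : TensorAlgebra K L) :
    𝔤.bracketAt b i (swapAt χ b deg (i + 1) (swapAt χ b deg i t)) =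
      swapAt χ b deg i (𝔤.bracketAt b (i + 1) t) := by
  suffices H : 𝔤.bracketAt b i ∘ₗ swapAt χ b deg (i + 1) ∘ₗ swapAt χ b deg i =
      swapAt χ b deg i ∘ₗ 𝔤.bracketAt b (i + 1) by
    simpa only [LinearMap.comp_apply, LinearMap.add_apply, LinearMap.neg_apply] using
      LinearMap.congr_fun H t
  refine hom_ext_word b fun w => ?_
  simp only [LinearMap.comp_apply]
  induction i generalizing w with
  | zero =>
    match w with
    | [] => simp
    | [a] => simp [-mul_one]
    | [a, c] => simp [-mul_one, 𝔤.swapAt_zero_basis hb]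
    | a :: c :: d :: w =>
      simp [𝔤.swapAt_zero_basis hb, smul_smul,
        𝔤.swapAt_zero_mul hb (hb.mem a) (𝔤.isColorLieBracket.mem (hb.mem c) (hb.mem d)),
        χ.coe_mul_right]
  | succ i ih =>
    match w with
    | [] => simp
    | a :: w => simp [ih]

theorem swapAt_bracketAt_succ_swapAt (i : ℕ) (t : TensorAlgebra K L) :
    swapAt χ b deg i (𝔤.bracketAt b (i + 1) (swapAt χ b deg i t)) =
      𝔤.bracketAt b i (swapAt χ b deg (i + 1) t) := by
  suffices H : swapAt χ b deg i ∘ₗ 𝔤.bracketAt b (i + 1) ∘ₗ swapAt χ b deg i =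
      𝔤.bracketAt b i ∘ₗ swapAt χ b deg (i + 1) by
    simpa only [LinearMap.comp_apply, LinearMap.add_apply, LinearMap.neg_apply] using
      LinearMap.congr_fun H t
  refine hom_ext_word b fun w => ?_
  simp only [LinearMap.comp_apply]
  induction i generalizing w with
  | zero =>
    match w with
    | [] => simp
    | [a] => simp [-mul_one]
    | [a, c] => simp [-mul_one, 𝔤.swapAt_zero_basis hb]
    | a :: c :: d :: w =>
      simp [𝔤.swapAt_zero_basis hb, smul_smul,
        𝔤.swapAt_zero_mul hb (hb.mem c) (𝔤.isColorLieBracket.mem (hb.mem a) (hb.mem d)),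
        χ.coe_mul_right]
      rw [← mul_assoc, χ.coe_mul_swap, one_mul]
  | succ i ih =>
    match w with
    | [] => simp
    | a :: w => simp [ih]

omit hb in
-- This is the derivation form of the Jacobi identity, obtained from the cyclic form by
-- skew-symmetry and multiplication by χ(g, k).
theorem jacobi_bracket {g h k : G} {x y z : L} (hx : x ∈ 𝔤.grading g) (hy : y ∈ 𝔤.grading h)
    (hz : z ∈ 𝔤.grading k) :
    𝔤.bracket (𝔤.bracket x y) z + (χ g h : K) • 𝔤.bracket y (𝔤.bracket x z) =
      𝔤.bracket x (𝔤.bracket y z) := by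
  have h1 := 𝔤.isColorLieBracket.jacobi hx hy hz
  have h2 := 𝔤.isColorLieBracket.skew (𝔤.isColorLieBracket.mem hx hy) hz
  have h3 := 𝔤.isColorLieBracket.skew hx hz
  rw [h2, h3, map_neg, map_smul, χ.coe_mul_left]
  have h4 := congr((χ g k : K) • $h1)
  rw [smul_add, smul_add, smul_smul, smul_smul, smul_smul, χ.coe_mul_swap, one_smul, smul_zero] at h4
  linear_combination (norm := module) -h4

/-- It is the Jacobi identity in operator form, as needed for the braid relation of the twisted
transpositions. -/
theorem bracketAt_jacobi (i : ℕ) (t : TensorAlgebra K L) :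
    𝔤.bracketAt b i (𝔤.bracketAt b i t) + 𝔤.bracketAt b i (𝔤.bracketAt b (i + 1) (swapAt χ b deg i t))
      = 𝔤.bracketAt b i (𝔤.bracketAt b (i + 1) t) := by
  suffices H : 𝔤.bracketAt b i ∘ₗ 𝔤.bracketAt b i +
      𝔤.bracketAt b i ∘ₗ 𝔤.bracketAt b (i + 1) ∘ₗ swapAt χ b deg i =
      𝔤.bracketAt b i ∘ₗ 𝔤.bracketAt b (i + 1) by
    simpa only [LinearMap.comp_apply, LinearMap.add_apply, LinearMap.neg_apply] using
      LinearMap.congr_fun H t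
  refine hom_ext_word b fun w => ?_
  simp only [LinearMap.comp_apply, LinearMap.add_apply]
  induction i generalizing w with
  | zero =>
    match w with
    | [] => simp
    | [a] => simp [-mul_one]
    | [a, c] => simp [-mul_one, 𝔤.swapAt_zero_basis hb]
    | a :: c :: d :: w =>
      simp only [word_cons, bracketAt_zero_mul, bracketAt_succ_mul, 𝔤.swapAt_zero_basis hb,
        map_smul]
      rw [← smul_mul_assoc, ← add_mul, ← map_smul, ← map_add,
        𝔤.jacobi_bracket (hb.mem a) (hb.mem c) (hb.mem d)]
  | succ i ih =>
    match w with
    | [] => simp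
    | a :: w => simp [← ih, mul_add]

end Relations

end ColorLieAlgebra

/-! ### The PBW step: extending maps compatible with the relations. -/

namespace ColorLieAlgebra

open Module

variable {K G L I V : Type*} [Field K] [CommGroup G] [DecidableEq G]
  [AddCommGroup L] [Module K L] {χ : AntisymmBicharacter K G} (𝔤 : ColorLieAlgebra χ L)
  {b : Basis I K L} {deg : I → G} [AddCommGroup V] [Module K V]

/-- The endomorphism `(x, v) ↦ (A x, f x + v)` of `T(L) × V`. -/
def twist (A : TensorAlgebra K L →ₗ[K] TensorAlgebra K L) (f : TensorAlgebra K L →ₗ[K] V) :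
    Module.End K (TensorAlgebra K L × V) :=
  (A ∘ₗ LinearMap.fst K _ _).prod (f ∘ₗ LinearMap.fst K _ _ + LinearMap.snd K _ _)

/-- The projection of the tensor algebra onto its part of degree `n`. -/
def projPow (b : Basis I K L) (n : ℕ) : TensorAlgebra K L →ₗ[K] TensorAlgebra K L :=
  ofWords b fun w => if w.length = n then word b w else 0

theorem projPow_of_mem (b : Basis I K L) {n : ℕ} {t : TensorAlgebra K L}
    (ht : t ∈ tensorPow K L n) : projPow b n t = t :=
  eqOn_tensorPow b (f := projPow b n) (f' := LinearMap.id)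
    (fun w hw => by simp [projPow, hw]) ht

theorem projPow_mem (b : Basis I K L) (n : ℕ) (t : TensorAlgebra K L) :
    projPow b n t ∈ tensorPow K L n := by
  have h : Submodule.span K (Set.range b.tensorAlgebra) ≤ (tensorPow K L n).comap (projPow b n) := by
    rw [Submodule.span_le]
    rintro _ ⟨w, rfl⟩
    rw [tensorAlgebra_basis_apply, SetLike.mem_coe, Submodule.mem_comap, projPow, ofWords_word]
    split_ifs with hw
    · rw [← hw]; exact word_mem_tensorPow b _
    · exact Submodule.zero_mem _
  rw [b.tensorAlgebra.span_eq] at h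
  exact h trivial

/-- `Φ` respects the defining relations of `U(𝔤)` in tensor degree `n`. -/
def RespectsRel (b : Basis I K L) (deg : I → G) (Φ : TensorAlgebra K L →ₗ[K] V) (n : ℕ) : Prop :=
  ∀ t ∈ tensorPow K L n, ∀ i, i + 2 ≤ n →
    Φ t = Φ (swapAt χ b deg i t) + Φ (𝔤.bracketAt b i t)

/-- The condition on `c` says that (t, v) ↦ c(t) + v is invariant under the affine-type operators
(x, v) ↦ (σ_i x, Φ(β_i x) + v). These generate an action of a symmetric group on T^{n+1} × V, and a
symmetrizer of that action supplies such a map. Compatibility of Φ is only needed in degree n, where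
the β_i x live. -/
theorem exists_extension [CharZero K] (hb : 𝔤.IsHomogeneousBasis b deg)
    (Φ : TensorAlgebra K L →ₗ[K] V) (n : ℕ) (hΦ : 𝔤.RespectsRel b deg Φ n) :
    ∃ c : TensorAlgebra K L →ₗ[K] V, ∀ t ∈ tensorPow K L (n + 1), ∀ i, i + 2 ≤ n + 1 →
      c t = c (swapAt χ b deg i t) + Φ (𝔤.bracketAt b i t) := by
  have hp : ∀ x, projPow b (n + 1) x ∈ tensorPow K L (n + 1) := projPow_mem b (n + 1)
  have hpp : ∀ x ∈ tensorPow K L (n + 1), projPow b (n + 1) x = x :=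
    fun x hx => projPow_of_mem b hx
  -- The idempotent `e` projects onto T^{n+1} × V. Outside this subspace the swaps need not be
  -- involutive, so `e` plays the role of the identity in the Coxeter relations.
  let e : Module.End K (TensorAlgebra K L × V) := twist (projPow b (n + 1)) 0
  let s : ℕ → Module.End K (TensorAlgebra K L × V) := fun i =>
    twist (swapAt χ b deg i ∘ₗ projPow b (n + 1)) (Φ ∘ₗ 𝔤.bracketAt b i ∘ₗ projPow b (n + 1))
  have he : ∀ x v, e (x, v) = (projPow b (n + 1) x, v) := fun x v => by
    simp [e, twist]
  have hs : ∀ i x v, s i (x, v) = (swapAt χ b deg i (projPow b (n + 1) x),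
      Φ (𝔤.bracketAt b i (projPow b (n + 1) x)) + v) := fun i x v => rfl
  have hps : ∀ i, ∀ x ∈ tensorPow K L (n + 1),
      projPow b (n + 1) (swapAt χ b deg i x) = swapAt χ b deg i x :=
    fun i x hx => hpp _ (𝔤.swapAt_mem hb i hx)
  obtain ⟨P, -, hPs, hPr⟩ := exists_symmetrizer (K := K) s e n
    (by
      intro i hi
      refine LinearMap.ext fun ⟨x, v⟩ => ?_
      rw [Module.End.mul_apply, hs, hs, he]
      have hx := hp x
      generalize projPow b (n + 1) x = y at hx
      rw [hps i y hx, 𝔤.swapAt_swapAt hb (by omega) hx, 𝔤.bracketAt_swapAt hb, map_neg,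
        neg_add_cancel_left])
    (by
      intro i hi
      refine LinearMap.ext fun ⟨x, v⟩ => ?_
      rw [Module.End.mul_apply, he, hs, hs, hpp _ (hp x)])
    (by
      refine LinearMap.ext fun ⟨x, v⟩ => ?_
      rw [Module.End.mul_apply, he, he, hpp _ (hp x)])
    (by
      intro i hi
      refine LinearMap.ext fun ⟨x, v⟩ => ?_
      rw [Module.End.mul_apply, hs, he, hps i _ (hp x)])
    (by
      intro i j hij hj
      refine LinearMap.ext fun ⟨x, v⟩ => ?_
      rw [Module.End.mul_apply, Module.End.mul_apply, hs, hs, hs, hs]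
      have hx := hp x
      generalize projPow b (n + 1) x = y at hx
      obtain ⟨j, rfl⟩ : ∃ k, j = k + 1 := ⟨j - 1, by omega⟩
      rw [hps i y hx, hps _ y hx, 𝔤.swapAt_comm hb i _ hij,
        𝔤.bracketAt_swapAt_far_right i j (by omega), 𝔤.bracketAt_swapAt_far_left hb i (j + 1) hij]
      -- The two V-components agree after Φ is rewritten on β_i y and on β_{j+1} y, since the
      -- resulting double brackets coincide.
      have h1 := hΦ _ (𝔤.bracketAt_mem (b := b) i hx) j (by omega)
      have h2 := hΦ _ (𝔤.bracketAt_mem (b := b) (j + 1) hx) i (by omega)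
      rw [𝔤.bracketAt_comm i j (by omega)] at h1
      refine Prod.ext rfl ?_
      change _ + (_ + v) = _ + (_ + v)
      rw [h1, h2]
      abel)
    (by
      intro i hi
      refine LinearMap.ext fun ⟨x, v⟩ => ?_
      simp only [Module.End.mul_apply, hs]
      have hx := hp x
      generalize projPow b (n + 1) x = y at hx
      have m1 := 𝔤.swapAt_mem hb i hx
      have m2 := 𝔤.swapAt_mem hb (i + 1) hx
      rw [hps _ y hx, hps _ _ m1, hps _ y hx, hps _ _ m2, 𝔤.swapAt_braid hb,
        𝔤.bracketAt_swapAt_swapAt_succ hb, 𝔤.bracketAt_succ_swapAt_swapAt hb,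
        ← 𝔤.swapAt_bracketAt_succ_swapAt hb]
      -- Three uses of compatibility in degree n turn the braid relation on the V-components into
      -- the Jacobi identity.
      have h1 := hΦ _ (𝔤.bracketAt_mem (b := b) i hx) i (by omega)
      have h2 := hΦ _ (𝔤.bracketAt_mem (b := b) (i + 1) hx) i (by omega)
      have h3 := hΦ _ (𝔤.bracketAt_mem (b := b) (i + 1) m1) i (by omega)
      rw [← 𝔤.bracketAt_jacobi hb, map_add] at h2
      refine Prod.ext rfl ?_
      change _ + (_ + (_ + v)) = _ + (_ + (_ + v))
      rw [h1, h2, h3]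
      abel)
  -- All the operators fix 0 × V pointwise, hence so does the symmetrizer.
  have hPv : ∀ v, P (0, v) = (0, v) := by
    intro v
    have h := hPr (LinearMap.inr K _ _ ∘ₗ LinearMap.snd K _ _)
      (LinearMap.ext fun ⟨x, v⟩ => by
        rw [Module.End.mul_apply]
        change e (0, v) = (0, v)
        rw [he, map_zero])
      (fun i _ => LinearMap.ext fun ⟨x, v⟩ => by
        rw [Module.End.mul_apply]
        change s i (0, v) = (0, v)
        rw [hs, map_zero, map_zero, map_zero, map_zero, zero_add])
    exact LinearMap.congr_fun h (0, v)
  -- Take for c(t) the V-component of P(t, 0). Then P s_i = P gives P(t, 0) = P(σ_i t, 0) + (0,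
  -- Φ(β_i t)).
  refine ⟨LinearMap.snd K _ _ ∘ₗ P ∘ₗ LinearMap.inl K _ _, fun t ht i hi => ?_⟩
  have h := LinearMap.congr_fun (hPs i (by omega)) (t, 0)
  rw [Module.End.mul_apply, hs, hpp t ht, add_zero] at h
  have h' : P (swapAt χ b deg i t, 0) + P (0, Φ (𝔤.bracketAt b i t)) = P (t, 0) := by
    rw [← map_add, ← h]
    simp
  rw [hPv] at h'
  exact (congrArg Prod.snd h').symm

/-- The relations of degree m involve only T^m and T^{m-1}, so replacing Φ on T^{n+1} leaves those
of degree at most n intact. -/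
theorem exists_respectsRel_step [CharZero K] (hb : 𝔤.IsHomogeneousBasis b deg)
    (Φ : TensorAlgebra K L →ₗ[K] V) (n : ℕ) (hΦ : ∀ m ≤ n, 𝔤.RespectsRel b deg Φ m) :
    ∃ Φ' : TensorAlgebra K L →ₗ[K] V, (∀ m ≤ n + 1, 𝔤.RespectsRel b deg Φ' m) ∧
      ∀ m ≤ n, ∀ t ∈ tensorPow K L m, Φ' t = Φ t := by
  obtain ⟨c, hc⟩ := 𝔤.exists_extension hb Φ n (hΦ n le_rfl)
  let Φ' : TensorAlgebra K L →ₗ[K] V :=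
    ofWords b fun w => if w.length = n + 1 then c (word b w) else Φ (word b w)
  have h1 : ∀ t ∈ tensorPow K L (n + 1), Φ' t = c t := fun t ht =>
    eqOn_tensorPow b (fun w hw => by simp [Φ', hw]) ht
  have h2 : ∀ m ≤ n, ∀ t ∈ tensorPow K L m, Φ' t = Φ t := fun m hm t ht =>
    eqOn_tensorPow b (fun w hw => by
      rw [ofWords_word, if_neg]
      omega) ht
  refine ⟨Φ', fun m hm t ht i hi => ?_, h2⟩
  obtain rfl | hm := Nat.eq_or_lt_of_le hm
  · rw [h1 t ht, h1 _ (𝔤.swapAt_mem hb i ht), h2 n le_rfl _ (𝔤.bracketAt_mem (b := b) i ht)]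
    exact hc t ht i hi
  · obtain ⟨m, rfl⟩ : ∃ k, m = k + 1 := ⟨m - 1, by omega⟩
    rw [h2 _ (by omega) t ht, h2 _ (by omega) _ (𝔤.swapAt_mem hb i ht),
      h2 m (by omega) _ (𝔤.bracketAt_mem (b := b) i ht)]
    exact hΦ _ (by omega) t ht i hi

/-- A map which respects the relations up to tensor degree `n` can be modified in higher degrees so
as to respect all of them. -/
theorem exists_respectsRel [CharZero K] (hb : 𝔤.IsHomogeneousBasis b deg)
    (Φ : TensorAlgebra K L →ₗ[K] V) (n : ℕ) (hΦ : ∀ m ≤ n, 𝔤.RespectsRel b deg Φ m) :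
    ∃ Φ' : TensorAlgebra K L →ₗ[K] V, (∀ m, 𝔤.RespectsRel b deg Φ' m) ∧
      ∀ m ≤ n, ∀ t ∈ tensorPow K L m, Φ' t = Φ t := by
  choose F hF hF' using fun (k : ℕ) (Ψ : {Ψ : TensorAlgebra K L →ₗ[K] V //
    ∀ m ≤ n + k, 𝔤.RespectsRel b deg Ψ m}) => 𝔤.exists_respectsRel_step hb Ψ.1 (n + k) Ψ.2
  let S : ∀ k : ℕ, {Ψ : TensorAlgebra K L →ₗ[K] V // ∀ m ≤ n + k, 𝔤.RespectsRel b deg Ψ m} :=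
    fun k => Nat.rec ⟨Φ, hΦ⟩ (fun k Ψ => ⟨F k Ψ, hF k Ψ⟩) k
  have hS : ∀ k, ∀ m ≤ n + k, ∀ t ∈ tensorPow K L m, (S (k + 1)).1 t = (S k).1 t :=
    fun k => hF' k (S k)
  have hS' : ∀ k l, ∀ m ≤ n + k, ∀ t ∈ tensorPow K L m, (S (k + l)).1 t = (S k).1 t := by
    intro k l m hm t ht
    induction l with
    | zero => rfl
    | succ l ih => rw [← ih]; exact hS (k + l) m (by omega) t ht
  -- Stage k is final on tensor degrees at most n + k, so stage `w.length` already has the limiting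
  -- value on `w`.
  let Φ' : TensorAlgebra K L →ₗ[K] V := ofWords b fun w => (S w.length).1 (word b w)
  have h : ∀ k, ∀ m ≤ n + k, ∀ t ∈ tensorPow K L m, Φ' t = (S k).1 t := by
    intro k m hm t ht
    refine eqOn_tensorPow b (fun w hw => ?_) ht
    rw [ofWords_word]
    have hw' : word b w ∈ tensorPow K L m := hw ▸ word_mem_tensorPow b w
    have hcongr : ∀ l, l = k + w.length → (S l).1 (word b w) = (S (k + w.length)).1 (word b w) := by
      rintro _ rfl
      rfl
    rw [← hS' k w.length m hm _ hw', ← hcongr _ (Nat.add_comm _ _),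
      hS' w.length k m (by omega) _ hw']
  refine ⟨Φ', fun m t ht i hi => ?_, fun m hm t ht => h 0 m hm t ht⟩
  obtain ⟨m, rfl⟩ : ∃ k, m = k + 1 := ⟨m - 1, by omega⟩
  rw [h (m + 1) _ (by omega) t ht, h (m + 1) _ (by omega) _ (𝔤.swapAt_mem hb i ht),
    h (m + 1) m (by omega) _ (𝔤.bracketAt_mem (b := b) i ht)]
  exact (S (m + 1)).2 _ (by omega) t ht i hi

/-- A linear map on a ring which is compatible with the relations descends to `RingQuot`. -/
theorem eq_of_mkAlgHom_eq {R W : Type*} [Ring R] [Algebra K R] [AddCommGroup W] (r : R → R → Prop)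
    (Φ : R →+ W) (hΦ : ∀ x y, r x y → ∀ u v, Φ (u * x * v) = Φ (u * y * v)) {x y : R}
    (h : RingQuot.mkAlgHom K r x = RingQuot.mkAlgHom K r y) : Φ x = Φ y := by
  have hrel : ∀ x y, RingQuot.Rel r x y → ∀ u v, Φ (u * x * v) = Φ (u * y * v) := by
    intro x y hxy
    induction hxy with
    | of h => exact hΦ _ _ h
    | add_left _ ih => intro u v; simp only [mul_add, add_mul, map_add, ih]
    | mul_left _ ih => intro u v; rw [mul_assoc, mul_assoc, mul_assoc, ← mul_assoc, ih]; simp only [mul_assoc]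
    | mul_right _ ih => intro u v; rw [← mul_assoc, ← mul_assoc, ih]
  have h' : Quot.mk (RingQuot.Rel r) x = Quot.mk (RingQuot.Rel r) y := by
    simpa [RingQuot.mkAlgHom, RingQuot.mkRingHom] using h
  have h2 := Quot.eqvGen_exact h'
  have key : ∀ x y, Relation.EqvGen (RingQuot.Rel r) x y → Φ x = Φ y := by
    intro x y hxy
    induction hxy with
    | rel x y h => simpa using hrel x y h 1 1
    | refl => rfl
    | symm _ _ _ ih => exact ih.symm
    | trans _ _ _ _ _ ih ih' => exact ih.trans ih'
  exact key x y h2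

/-- The canonical projection of the tensor algebra onto `U(𝔤)`. -/
def mkU : TensorAlgebra K L →ₐ[K] 𝔤.U := RingQuot.mkAlgHom K 𝔤.Rel

theorem mkU_ι (x : L) : 𝔤.mkU (TensorAlgebra.ι K x) = 𝔤.ι x := rfl

theorem mkU_surjective : Function.Surjective 𝔤.mkU := RingQuot.mkAlgHom_surjective K 𝔤.Rel

/-- The operators at position `w.length` act on the two factors just after `w`. This converts
compatibility into the vanishing of Φ on relations multiplied by words on both sides. -/
theorem respectsRel_word (hb : 𝔤.IsHomogeneousBasis b deg) {Φ : TensorAlgebra K L →ₗ[K] V}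
    (hΦ : ∀ m, 𝔤.RespectsRel b deg Φ m) (w w' : List I) {g h : G} {x y : L}
    (hx : x ∈ 𝔤.grading g) (hy : y ∈ 𝔤.grading h) :
    Φ (word b w * (TensorAlgebra.ι K x * TensorAlgebra.ι K y) * word b w') =
      Φ (word b w * ((χ g h : K) • (TensorAlgebra.ι K y * TensorAlgebra.ι K x) +
          TensorAlgebra.ι K (𝔤.bracket x y)) * word b w') := by
  set t := word b w * (TensorAlgebra.ι K x * TensorAlgebra.ι K y) * word b w' with ht
  have ht' : t ∈ tensorPow K L (w.length + 2 + w'.length) := by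
    rw [tensorPow, pow_add, pow_add, pow_two]
    exact Submodule.mul_mem_mul (Submodule.mul_mem_mul (word_mem_tensorPow b w)
      (Submodule.mul_mem_mul ⟨x, rfl⟩ ⟨y, rfl⟩)) (word_mem_tensorPow b w')
  have h1 : ∀ w : List I, swapAt χ b deg w.length
      (word b w * (TensorAlgebra.ι K x * TensorAlgebra.ι K y) * word b w') =
      word b w * ((χ g h : K) • (TensorAlgebra.ι K y * TensorAlgebra.ι K x)) * word b w' := by
    intro w
    induction w with
    | nil => simp [mul_assoc, 𝔤.swapAt_zero_mul hb hx hy]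
    | cons a w ih => simp only [word_cons, mul_assoc, List.length_cons, swapAt_succ_mul] at ih ⊢; rw [ih]
  have h2 : ∀ w : List I, 𝔤.bracketAt b w.length
      (word b w * (TensorAlgebra.ι K x * TensorAlgebra.ι K y) * word b w') =
      word b w * TensorAlgebra.ι K (𝔤.bracket x y) * word b w' := by
    intro w
    induction w with
    | nil => simp [mul_assoc]
    | cons a w ih => simp only [word_cons, mul_assoc, List.length_cons, bracketAt_succ_mul] at ih ⊢; rw [ih]
  rw [hΦ _ t ht' w.length (by omega), h1, h2, mul_add, add_mul, map_add]

theorem exists_linearMap_U (hb : 𝔤.IsHomogeneousBasis b deg) (Φ : TensorAlgebra K L →ₗ[K] V)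
    (hΦ : ∀ m, 𝔤.RespectsRel b deg Φ m) : ∃ Ψ : 𝔤.U →ₗ[K] V, ∀ t, Ψ (𝔤.mkU t) = Φ t := by
  have hker : LinearMap.ker 𝔤.mkU.toLinearMap ≤ LinearMap.ker Φ := by
    intro t ht
    rw [LinearMap.mem_ker] at ht ⊢
    rw [← map_zero Φ]
    refine eq_of_mkAlgHom_eq (K := K) 𝔤.Rel Φ.toAddMonoidHom ?_ (ht.trans (map_zero 𝔤.mkU).symm)
    rintro _ _ ⟨hx, hy⟩ u v
    rename_i g h x y
    change Φ _ = Φ _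
    set r := TensorAlgebra.ι K x * TensorAlgebra.ι K y
    set r' := (χ g h : K) • (TensorAlgebra.ι K y * TensorAlgebra.ι K x) +
          TensorAlgebra.ι K (𝔤.bracket x y)
    have h1 : ∀ w : List I, Φ ∘ₗ LinearMap.mulLeft K (word b w * r) =
        Φ ∘ₗ LinearMap.mulLeft K (word b w * r') := fun w =>
      hom_ext_word b fun w' => 𝔤.respectsRel_word hb hΦ w w' hx hy
    have h2 : Φ ∘ₗ LinearMap.mulRight K (r * v) = Φ ∘ₗ LinearMap.mulRight K (r' * v) :=
      hom_ext_word b fun w => by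
        have := LinearMap.congr_fun (h1 w) v
        simpa only [LinearMap.comp_apply, LinearMap.mulLeft_apply, LinearMap.mulRight_apply,
          mul_assoc] using this
    have := LinearMap.congr_fun h2 u
    simpa only [LinearMap.comp_apply, LinearMap.mulLeft_apply, LinearMap.mulRight_apply,
      mul_assoc] using this
  refine ⟨(LinearMap.ker 𝔤.mkU.toLinearMap).liftQ Φ hker ∘ₗ
    (𝔤.mkU.toLinearMap.quotKerEquivOfSurjective 𝔤.mkU_surjective).symm.toLinearMap, fun t => ?_⟩
  have : (𝔤.mkU.toLinearMap.quotKerEquivOfSurjective 𝔤.mkU_surjective).symm (𝔤.mkU t) =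
      Submodule.Quotient.mk t := by
    rw [LinearEquiv.symm_apply_eq]
    rfl
  rw [LinearMap.comp_apply, LinearEquiv.coe_coe, this]
  rfl

end ColorLieAlgebra

namespace AlgFiltration

variable {K A : Type*} [Field K] [Ring A] [Algebra K A] (F : AlgFiltration K A)

theorem pred_mono : Monotone F.pred := by
  intro n m h
  cases n with
  | zero => exact bot_le
  | succ n =>
    obtain ⟨m, rfl⟩ : ∃ k, m = k + 1 := ⟨m - 1, by omega⟩
    exact F.mono (by omega)

theorem pred_le_fil (n : ℕ) : F.pred n ≤ F.fil n := by
  cases n with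
  | zero => exact bot_le
  | succ n => exact F.mono n.le_succ

theorem pred_le_fil_pred (n : ℕ) : F.pred n ≤ F.fil (n - 1) := by
  cases n with
  | zero => exact bot_le
  | succ n => exact le_rfl

theorem fil_le_pred {n m : ℕ} (h : n < m) : F.fil n ≤ F.pred m := by
  obtain ⟨m, rfl⟩ : ∃ k, m = k + 1 := ⟨m - 1, by omega⟩
  exact F.mono (by omega)

end AlgFiltration

/-! ### The enveloping algebra: homogeneous basis, universal property, monomials. -/

namespace ColorLieAlgebra

open Module

variable {K G L : Type*} [Field K] [CommGroup G] [DecidableEq G]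
  [AddCommGroup L] [Module K L] {χ : AntisymmBicharacter K G} (𝔤 : ColorLieAlgebra χ L)

/-- A basis of `L` obtained from bases of the homogeneous subspaces. -/
def homogeneousBasis : Basis (Σ g, Basis.ofVectorSpaceIndex K (𝔤.grading g)) K L :=
  𝔤.isInternal.collectedBasis fun g => Basis.ofVectorSpace K (𝔤.grading g)

theorem homogeneousBasis_apply (i : Σ g, Basis.ofVectorSpaceIndex K (𝔤.grading g)) :
    𝔤.homogeneousBasis i = Basis.ofVectorSpace K (𝔤.grading i.1) i.2 := by
  rw [homogeneousBasis, DirectSum.IsInternal.collectedBasis_coe]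

theorem isHomogeneousBasis : 𝔤.IsHomogeneousBasis 𝔤.homogeneousBasis Sigma.fst := by
  refine ⟨fun i => 𝔤.isInternal.collectedBasis_mem _ i, fun g x hx => ?_⟩
  have h : (⟨x, hx⟩ : 𝔤.grading g) ∈
      Submodule.span K (Set.range (Basis.ofVectorSpace K (𝔤.grading g))) := by
    rw [Basis.span_eq]; trivial
  have h2 := Submodule.mem_map_of_mem (f := (𝔤.grading g).subtype) h
  rw [Submodule.map_span] at h2
  refine Submodule.span_mono ?_ h2
  rintro _ ⟨_, ⟨i, rfl⟩, rfl⟩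
  exact ⟨⟨g, i⟩, rfl, 𝔤.homogeneousBasis_apply _⟩

theorem ι_mul_ι {g h : G} {x y : L} (hx : x ∈ 𝔤.grading g) (hy : y ∈ 𝔤.grading h) :
    𝔤.ι x * 𝔤.ι y = (χ g h : K) • (𝔤.ι y * 𝔤.ι x) + 𝔤.ι (𝔤.bracket x y) := by
  have h1 := RingQuot.mkAlgHom_rel K (Rel.commutator (𝔤 := 𝔤) hx hy)
  rw [map_mul, map_add, map_smul, map_mul] at h1
  exact h1

/-- The universal property of `U(𝔤)`. -/
theorem exists_lift {B : Type*} [Ring B] [Algebra K B] (f : L →ₗ[K] B)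
    (hf : ∀ (g h : G) (x y : L), x ∈ 𝔤.grading g → y ∈ 𝔤.grading h →
      f x * f y = (χ g h : K) • (f y * f x) + f (𝔤.bracket x y)) :
    ∃ F : 𝔤.U →ₐ[K] B, ∀ x, F (𝔤.ι x) = f x := by
  refine ⟨RingQuot.liftAlgHom K ⟨TensorAlgebra.lift K f, ?_⟩, fun x => ?_⟩
  · rintro _ _ ⟨hx, hy⟩
    simpa using hf _ _ _ _ hx hy
  · have := RingQuot.liftAlgHom_mkAlgHom_apply (S := K) (s := 𝔤.Rel) (TensorAlgebra.lift K f)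
      (by
        rintro _ _ ⟨hx, hy⟩
        simpa using hf _ _ _ _ hx hy) (TensorAlgebra.ι K x)
    rw [TensorAlgebra.lift_ι_apply] at this
    exact this

section Monomials

/-- The product in `U(𝔤)` of a list of elements of `𝔤` labelled by their degrees. -/
def monomial (l : List (G × L)) : 𝔤.U := (l.map fun x => 𝔤.ι x.2).prod

/-- The labels in a list are the degrees of its elements. -/
def IsHomogeneousList (l : List (G × L)) : Prop := ∀ x ∈ l, x.2 ∈ 𝔤.grading x.1

/-- The total degree of a labelled list. -/
def totalDegree (l : List (G × L)) : G := (l.map Prod.fst).prod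

@[simp] theorem monomial_nil : 𝔤.monomial [] = 1 := rfl

@[simp] theorem monomial_cons (x : G × L) (l : List (G × L)) :
    𝔤.monomial (x :: l) = 𝔤.ι x.2 * 𝔤.monomial l := by simp [monomial]

variable {𝔤} in
theorem IsHomogeneousList.of_cons {x : G × L} {l : List (G × L)}
    (h : 𝔤.IsHomogeneousList (x :: l)) : 𝔤.IsHomogeneousList l :=
  fun y hy => h y (List.mem_cons_of_mem _ hy)

variable {𝔤} in
theorem IsHomogeneousList.head {x : G × L} {l : List (G × L)}
    (h : 𝔤.IsHomogeneousList (x :: l)) : x.2 ∈ 𝔤.grading x.1 := h x List.mem_cons_self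

theorem ι_mem_fil (x : L) : 𝔤.ι x ∈ 𝔤.filtration.fil 1 :=
  Submodule.subset_span ⟨[x], le_rfl, by simp⟩

theorem monomial_mem_fil (l : List (G × L)) : 𝔤.monomial l ∈ 𝔤.filtration.fil l.length :=
  Submodule.subset_span ⟨l.map Prod.snd, by simp, by simp [monomial, Function.comp_def]⟩

theorem monomial_mem_uGrading {l : List (G × L)} (hl : 𝔤.IsHomogeneousList l) :
    𝔤.monomial l ∈ 𝔤.uGrading (totalDegree l) :=
  Submodule.subset_span ⟨l, hl, rfl, rfl⟩

theorem prod_map_ι_mem_span (l : List L) : (l.map 𝔤.ι).prod ∈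
    Submodule.span K {y | ∃ l' : List (G × L), 𝔤.IsHomogeneousList l' ∧
      l'.length = l.length ∧ 𝔤.monomial l' = y} := by
  induction l with
  | nil => exact Submodule.subset_span ⟨[], by simp [IsHomogeneousList], rfl, by simp⟩
  | cons x l ih =>
    rw [List.map_cons, List.prod_cons]
    have hx : x ∈ ⨆ g, 𝔤.grading g := by
      rw [𝔤.isInternal.submodule_iSup_eq_top]; trivial
    induction hx using Submodule.iSup_induction' with
    | mem g x hx =>
      have h := Submodule.mem_map_of_mem (f := LinearMap.mulLeft K (𝔤.ι x)) ih
      rw [Submodule.map_span] at h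
      refine Submodule.span_mono ?_ h
      rintro _ ⟨_, ⟨l', hl', hlen, rfl⟩, rfl⟩
      refine ⟨(g, x) :: l', ?_, by simp [hlen], by simp⟩
      intro y hy
      rcases List.mem_cons.1 hy with rfl | hy
      · exact hx
      · exact hl' y hy
    | zero => simp
    | add x y _ _ hx hy =>
      rw [map_add, add_mul]
      exact Submodule.add_mem _ hx hy

/-- The filtration is spanned by the products of homogeneous elements. -/
theorem fil_le_of_monomial {n : ℕ} {N : Submodule K 𝔤.U}
    (h : ∀ l, 𝔤.IsHomogeneousList l → l.length ≤ n → 𝔤.monomial l ∈ N) :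
    𝔤.filtration.fil n ≤ N := by
  refine Submodule.span_le.2 ?_
  rintro _ ⟨l, hl, rfl⟩
  refine Submodule.span_le.2 ?_ (𝔤.prod_map_ι_mem_span l)
  rintro _ ⟨l', hl', hlen, rfl⟩
  exact h l' hl' (hlen.trans_le hl)

theorem exists_mem_fil (u : 𝔤.U) : ∃ n, u ∈ 𝔤.filtration.fil n := by
  obtain ⟨t, rfl⟩ := 𝔤.mkU_surjective u
  induction t using TensorAlgebra.induction with
  | algebraMap r =>
    refine ⟨0, ?_⟩
    rw [AlgHom.commutes, Algebra.algebraMap_eq_smul_one]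
    exact Submodule.smul_mem _ _ 𝔤.filtration.one_mem
  | ι x => exact ⟨1, 𝔤.ι_mem_fil x⟩
  | mul a b ha hb =>
    obtain ⟨n, hn⟩ := ha
    obtain ⟨m, hm⟩ := hb
    exact ⟨n + m, by rw [map_mul]; exact 𝔤.filtration.mul_mem hn hm⟩
  | add a b ha hb =>
    obtain ⟨n, hn⟩ := ha
    obtain ⟨m, hm⟩ := hb
    refine ⟨n + m, ?_⟩
    rw [map_add]
    exact Submodule.add_mem _ (𝔤.filtration.mono (Nat.le_add_right n m) hn)
      (𝔤.filtration.mono (Nat.le_add_left m n) hm)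

theorem linearMap_ext_monomial {V : Type*} [AddCommGroup V] [Module K V] {f f' : 𝔤.U →ₗ[K] V}
    (h : ∀ l, 𝔤.IsHomogeneousList l → f (𝔤.monomial l) = f' (𝔤.monomial l)) : f = f' := by
  refine LinearMap.ext fun u => ?_
  obtain ⟨n, hn⟩ := 𝔤.exists_mem_fil u
  exact 𝔤.fil_le_of_monomial (N := LinearMap.eqLocus f f') (fun l hl _ => h l hl) hn

theorem one_mem_uGrading : (1 : 𝔤.U) ∈ 𝔤.uGrading 1 :=
  𝔤.monomial_mem_uGrading (l := []) (by simp [IsHomogeneousList])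

theorem mul_mem_uGrading {g h : G} {u v : 𝔤.U} (hu : u ∈ 𝔤.uGrading g) (hv : v ∈ 𝔤.uGrading h) :
    u * v ∈ 𝔤.uGrading (g * h) := by
  have hle : 𝔤.uGrading g * 𝔤.uGrading h ≤ 𝔤.uGrading (g * h) := by
    rw [uGrading, uGrading, Submodule.span_mul_span, Submodule.span_le]
    rintro _ ⟨_, ⟨l, hl, rfl, rfl⟩, _, ⟨l', hl', rfl, rfl⟩, rfl⟩
    refine Submodule.subset_span ⟨l ++ l', ?_, by simp, by simp⟩
    intro x hx
    rcases List.mem_append.1 hx with hx | hx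
    · exact hl x hx
    · exact hl' x hx
  exact hle (Submodule.mul_mem_mul hu hv)

theorem ι_mem_uGrading {g : G} {x : L} (hx : x ∈ 𝔤.grading g) : 𝔤.ι x ∈ 𝔤.uGrading g :=
  Submodule.subset_span ⟨[(g, x)], by simpa using hx, by simp, by simp⟩

end Monomials

/-! ### The G-grading of U through a coaction, and the color commutator. -/

section Coaction

/-- The defining relations are G-homogeneous, G being commutative, so x ↦ x g on degree g extends to
U by the universal property. Reading off coefficients then separates the degrees of U without a
basis of U. -/
theorem exists_coaction : ∃ δ : 𝔤.U →ₐ[K] MonoidAlgebra 𝔤.U G,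
    ∀ (g : G) (x : L), x ∈ 𝔤.grading g → δ (𝔤.ι x) = MonoidAlgebra.single g (𝔤.ι x) := by
  have hb := 𝔤.isHomogeneousBasis
  let b := 𝔤.homogeneousBasis
  let f : L →ₗ[K] MonoidAlgebra 𝔤.U G :=
    b.constr K fun i => MonoidAlgebra.single i.1 (𝔤.ι (b i))
  have hf : ∀ g x, x ∈ 𝔤.grading g → f x = MonoidAlgebra.single g (𝔤.ι x) := by
    intro g x hx
    refine 𝔤.eq_of_mem_grading hb (f := f)
      (f' := (MonoidAlgebra.coeffLinearEquiv K).symm.toLinearMap ∘ₗ Finsupp.lsingle g ∘ₗ 𝔤.ι)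
      (fun a ha => ?_) hx
    subst ha
    exact b.constr_basis K _ a
  obtain ⟨δ, hδ⟩ := 𝔤.exists_lift f (by
    intro g h x y hx hy
    rw [hf g x hx, hf h y hy, hf _ _ (𝔤.isColorLieBracket.mem hx hy),
      MonoidAlgebra.single_mul_single, MonoidAlgebra.single_mul_single, 𝔤.ι_mul_ι hx hy,
      mul_comm h g, MonoidAlgebra.smul_single, ← MonoidAlgebra.single_add])
  exact ⟨δ, fun g x hx => (hδ x).trans (hf g x hx)⟩

/-- The coaction `U(𝔤) → U(𝔤)[G]` which records the `G`-degree. -/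
def coaction : 𝔤.U →ₐ[K] MonoidAlgebra 𝔤.U G := 𝔤.exists_coaction.choose

theorem coaction_ι {g : G} {x : L} (hx : x ∈ 𝔤.grading g) :
    𝔤.coaction (𝔤.ι x) = MonoidAlgebra.single g (𝔤.ι x) := 𝔤.exists_coaction.choose_spec g x hx

theorem coaction_of_mem {g : G} {u : 𝔤.U} (hu : u ∈ 𝔤.uGrading g) :
    𝔤.coaction u = MonoidAlgebra.single g u := by
  have h : 𝔤.uGrading g ≤ LinearMap.eqLocus 𝔤.coaction.toLinearMap
      ((MonoidAlgebra.coeffLinearEquiv K).symm.toLinearMap ∘ₗ Finsupp.lsingle g) := by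
    refine Submodule.span_le.2 ?_
    rintro _ ⟨l, hl, rfl, rfl⟩
    change 𝔤.coaction _ = MonoidAlgebra.single _ _
    clear hu
    induction l with
    | nil => simp [MonoidAlgebra.one_def]
    | cons x l ih =>
      simp only [List.map_cons, List.prod_cons, map_mul]
      rw [ih (IsHomogeneousList.of_cons hl),
        𝔤.coaction_ι (IsHomogeneousList.head hl),
        MonoidAlgebra.single_mul_single]
  exact h hu

/-- The coaction with values in finitely supported functions. -/
def coactionFinsupp : 𝔤.U →ₗ[K] G →₀ 𝔤.U :=
  (MonoidAlgebra.coeffLinearEquiv K).toLinearMap ∘ₗ 𝔤.coaction.toLinearMap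

theorem coactionFinsupp_of_mem {g : G} {u : 𝔤.U} (hu : u ∈ 𝔤.uGrading g) :
    𝔤.coactionFinsupp u = Finsupp.single g u := by
  change MonoidAlgebra.coeffLinearEquiv K (𝔤.coaction u) = _
  rw [𝔤.coaction_of_mem hu]
  rfl

/-- The projection of `U(𝔤)` onto its part of degree `g`. -/
def degProj (g : G) : 𝔤.U →ₗ[K] 𝔤.U := Finsupp.lapply g ∘ₗ 𝔤.coactionFinsupp

theorem degProj_of_mem {g : G} {u : 𝔤.U} (hu : u ∈ 𝔤.uGrading g) : 𝔤.degProj g u = u := by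
  rw [degProj, LinearMap.comp_apply, 𝔤.coactionFinsupp_of_mem hu]
  simp

theorem degProj_of_mem_ne {g h : G} (hgh : g ≠ h) {u : 𝔤.U} (hu : u ∈ 𝔤.uGrading h) :
    𝔤.degProj g u = 0 := by
  rw [degProj, LinearMap.comp_apply, 𝔤.coactionFinsupp_of_mem hu]
  simp [hgh.symm]

theorem degProj_monomial (g : G) {l : List (G × L)} (hl : 𝔤.IsHomogeneousList l) :
    𝔤.degProj g (𝔤.monomial l) = if totalDegree l = g then 𝔤.monomial l else 0 := by
  split_ifs with h
  · exact 𝔤.degProj_of_mem (h ▸ 𝔤.monomial_mem_uGrading hl)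
  · exact 𝔤.degProj_of_mem_ne (fun h' => h h'.symm) (𝔤.monomial_mem_uGrading hl)

theorem degProj_mem_uGrading (g : G) (u : 𝔤.U) : 𝔤.degProj g u ∈ 𝔤.uGrading g := by
  obtain ⟨n, hn⟩ := 𝔤.exists_mem_fil u
  refine 𝔤.fil_le_of_monomial (N := (𝔤.uGrading g).comap (𝔤.degProj g)) (fun l hl _ => ?_) hn
  rw [Submodule.mem_comap, 𝔤.degProj_monomial g hl]
  split_ifs with h
  · exact h ▸ 𝔤.monomial_mem_uGrading hl
  · exact Submodule.zero_mem _

theorem degProj_mem_fil (g : G) {n : ℕ} {u : 𝔤.U} (hu : u ∈ 𝔤.filtration.fil n) :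
    𝔤.degProj g u ∈ 𝔤.filtration.fil n := by
  refine 𝔤.fil_le_of_monomial (N := (𝔤.filtration.fil n).comap (𝔤.degProj g)) (fun l hl hn => ?_) hu
  rw [Submodule.mem_comap, 𝔤.degProj_monomial g hl]
  split_ifs with h
  · exact 𝔤.filtration.mono hn (𝔤.monomial_mem_fil l)
  · exact Submodule.zero_mem _

/-- Scaling by `χ(g, h)` in degree `h`. -/
def scale (g : G) : 𝔤.U →ₗ[K] 𝔤.U :=
  Finsupp.lsum K (fun h => (χ g h : K) • (LinearMap.id : 𝔤.U →ₗ[K] 𝔤.U)) ∘ₗ 𝔤.coactionFinsupp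

theorem scale_of_mem (g : G) {h : G} {v : 𝔤.U} (hv : v ∈ 𝔤.uGrading h) :
    𝔤.scale g v = (χ g h : K) • v := by
  rw [scale, LinearMap.comp_apply, 𝔤.coactionFinsupp_of_mem hv]
  simp

/-- The color commutator on `U(𝔤)`. -/
def comm : 𝔤.U →ₗ[K] 𝔤.U →ₗ[K] 𝔤.U :=
  LinearMap.mul K 𝔤.U -
    Finsupp.lsum K (fun g => (LinearMap.mul K 𝔤.U).flip.compl₂ (𝔤.scale g)) ∘ₗ 𝔤.coactionFinsupp

/-- The formula makes sense only for homogeneous pairs; the coaction serves to extend it to a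
bilinear map on all of U. -/
theorem comm_apply {g h : G} {u v : 𝔤.U} (hu : u ∈ 𝔤.uGrading g) (hv : v ∈ 𝔤.uGrading h) :
    𝔤.comm u v = u * v - (χ g h : K) • (v * u) := by
  rw [comm, LinearMap.sub_apply, LinearMap.sub_apply, LinearMap.comp_apply,
    𝔤.coactionFinsupp_of_mem hu]
  simp [𝔤.scale_of_mem g hv]

theorem comm_mem_uGrading {g h : G} {u v : 𝔤.U} (hu : u ∈ 𝔤.uGrading g) (hv : v ∈ 𝔤.uGrading h) :
    𝔤.comm u v ∈ 𝔤.uGrading (g * h) := by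
  rw [𝔤.comm_apply hu hv]
  exact Submodule.sub_mem _ (𝔤.mul_mem_uGrading hu hv)
    (Submodule.smul_mem _ _ (mul_comm h g ▸ 𝔤.mul_mem_uGrading hv hu))

theorem comm_mul_left {g h k : G} {u v w : 𝔤.U} (hu : u ∈ 𝔤.uGrading g) (hv : v ∈ 𝔤.uGrading h)
    (hw : w ∈ 𝔤.uGrading k) :
    𝔤.comm (u * v) w = u * 𝔤.comm v w + (χ h k : K) • (𝔤.comm u w * v) := by
  rw [𝔤.comm_apply hu hw, 𝔤.comm_apply hv hw, 𝔤.comm_apply (𝔤.mul_mem_uGrading hu hv) hw,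
    χ.coe_mul_left]
  simp only [mul_sub, sub_mul, smul_sub, mul_smul_comm, smul_mul_assoc, smul_smul, mul_assoc]
  rw [mul_comm (χ g k : K)]
  abel

theorem comm_mul_right {g h k : G} {u v w : 𝔤.U} (hu : u ∈ 𝔤.uGrading g) (hv : v ∈ 𝔤.uGrading h)
    (hw : w ∈ 𝔤.uGrading k) :
    𝔤.comm u (v * w) = 𝔤.comm u v * w + (χ g h : K) • (v * 𝔤.comm u w) := by
  rw [𝔤.comm_apply hu hw, 𝔤.comm_apply hu hv, 𝔤.comm_apply hu (𝔤.mul_mem_uGrading hv hw),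
    χ.coe_mul_right]
  simp only [mul_sub, sub_mul, smul_sub, mul_smul_comm, smul_mul_assoc, smul_smul, mul_assoc]
  abel

theorem comm_one_left (v : 𝔤.U) : 𝔤.comm 1 v = 0 := by
  have h : 𝔤.comm 1 = 0 := 𝔤.linearMap_ext_monomial fun l hl => by
    rw [𝔤.comm_apply 𝔤.one_mem_uGrading (𝔤.monomial_mem_uGrading hl)]
    simp
  rw [h, LinearMap.zero_apply]

theorem comm_one_right (v : 𝔤.U) : 𝔤.comm v 1 = 0 := by
  have h : 𝔤.comm.flip 1 = 0 := 𝔤.linearMap_ext_monomial fun l hl => by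
    rw [LinearMap.flip_apply, 𝔤.comm_apply (𝔤.monomial_mem_uGrading hl) 𝔤.one_mem_uGrading]
    simp
  exact LinearMap.congr_fun h v

/-- For two generators the commutator is ι[x, y], in U_1 instead of U_2. The Leibniz rule propagates
this loss of one degree. -/
theorem comm_ι_monomial_mem_pred {x : G × L} (hx : x.2 ∈ 𝔤.grading x.1) {l : List (G × L)}
    (hl : 𝔤.IsHomogeneousList l) :
    𝔤.comm (𝔤.ι x.2) (𝔤.monomial l) ∈ 𝔤.filtration.pred (1 + l.length) := by
  induction l with
  | nil => rw [monomial_nil, comm_one_right]; exact Submodule.zero_mem _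
  | cons y l ih =>
    have hy := hl.head
    rw [monomial_cons, 𝔤.comm_mul_right (𝔤.ι_mem_uGrading hx) (𝔤.ι_mem_uGrading hy)
      (𝔤.monomial_mem_uGrading hl.of_cons), List.length_cons]
    refine Submodule.add_mem _ ?_ (Submodule.smul_mem _ _ ?_)
    · have h : 𝔤.comm (𝔤.ι x.2) (𝔤.ι y.2) ∈ 𝔤.filtration.pred (1 + 1) := by
        rw [𝔤.comm_apply (𝔤.ι_mem_uGrading hx) (𝔤.ι_mem_uGrading hy), 𝔤.ι_mul_ι hx hy,
          add_sub_cancel_left]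
        exact 𝔤.ι_mem_fil _
      have := 𝔤.filtration.mul_mem_pred_left h (𝔤.monomial_mem_fil l)
      rwa [add_assoc, add_comm 1 l.length] at this
    · have := 𝔤.filtration.mul_mem_pred_right (𝔤.ι_mem_fil y.2) (ih hl.of_cons)
      rwa [add_comm 1 l.length] at this

theorem comm_monomial_mem_pred {l l' : List (G × L)} (hl : 𝔤.IsHomogeneousList l)
    (hl' : 𝔤.IsHomogeneousList l') :
    𝔤.comm (𝔤.monomial l) (𝔤.monomial l') ∈ 𝔤.filtration.pred (l.length + l'.length) := by
  induction l with
  | nil => rw [monomial_nil, comm_one_left]; exact Submodule.zero_mem _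
  | cons x l ih =>
    have hx := hl.head
    rw [monomial_cons, 𝔤.comm_mul_left (𝔤.ι_mem_uGrading hx) (𝔤.monomial_mem_uGrading hl.of_cons)
      (𝔤.monomial_mem_uGrading hl'), List.length_cons]
    refine Submodule.add_mem _ ?_ (Submodule.smul_mem _ _ ?_)
    · have := 𝔤.filtration.mul_mem_pred_right (𝔤.ι_mem_fil x.2) (ih hl.of_cons)
      rwa [show 1 + (l.length + l'.length) = l.length + 1 + l'.length by omega] at this
    · have := 𝔤.filtration.mul_mem_pred_left (𝔤.comm_ι_monomial_mem_pred hx hl')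
        (𝔤.monomial_mem_fil l)
      rwa [show 1 + l'.length + l.length = l.length + 1 + l'.length by omega] at this

/-- The color commutator lowers the filtration degree. -/
theorem comm_mem_pred {n m : ℕ} {u v : 𝔤.U} (hu : u ∈ 𝔤.filtration.fil n)
    (hv : v ∈ 𝔤.filtration.fil m) : 𝔤.comm u v ∈ 𝔤.filtration.pred (n + m) := by
  refine 𝔤.fil_le_of_monomial (N := (𝔤.filtration.pred (n + m)).comap (𝔤.comm.flip v))
    (fun l hl hn => ?_) hu
  refine 𝔤.fil_le_of_monomial (N := (𝔤.filtration.pred (n + m)).comap (𝔤.comm (𝔤.monomial l)))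
    (fun l' hl' hm => ?_) hv
  exact 𝔤.filtration.pred_mono (add_le_add hn hm) (𝔤.comm_monomial_mem_pred hl hl')

end Coaction

end ColorLieAlgebra

/-! ### Linear maps on the associated graded algebra. -/

namespace AlgFiltration

variable {K A V : Type*} [Field K] [Ring A] [Algebra K A] (F : AlgFiltration K A)
  [AddCommGroup V] [Module K V]

theorem toGr_congr {n m : ℕ} (h : n = m) (u : F.fil n) (v : F.fil m) (huv : (u : A) = v) :
    F.toGr n u = F.toGr m v := by
  subst h
  rw [Subtype.ext huv]

theorem toGr_eq_zero {n : ℕ} (u : F.fil n) (h : (u : A) ∈ F.pred n) : F.toGr n u = 0 := by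
  rw [toGr, LinearMap.comp_apply, F.proj_eq_zero u h, map_zero]

theorem toGr_eq_zero_of_eq_zero {n : ℕ} (u : F.fil n) (h : (u : A) = 0) : F.toGr n u = 0 := by
  have h0 : u = 0 := Subtype.ext h
  rw [h0, map_zero]

theorem toGr_eq_of_sub_mem {n : ℕ} (u v : F.fil n) (h : (u - v : A) ∈ F.pred n) :
    F.toGr n u = F.toGr n v := by
  rw [← sub_eq_zero, ← map_sub]
  exact F.toGr_eq_zero _ h

theorem toGr_mul {n m : ℕ} (u : F.fil n) (v : F.fil m) :
    F.toGr n u * F.toGr m v = F.toGr (n + m) ⟨(u : A) * v, F.mul_mem u.2 v.2⟩ :=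
  DirectSum.of_mul_of _ _

theorem lof_surjective_toGr (n : ℕ) (a : F.gr n) :
    ∃ u : F.fil n, F.toGr n u = DirectSum.lof K ℕ F.gr n a := by
  obtain ⟨u, rfl⟩ := F.proj_surjective n a
  exact ⟨u, rfl⟩

/-- Linear maps out of `gr(A)`. -/
def grLift (φ : ∀ n, F.fil n →ₗ[K] V) (h : ∀ n (u : F.fil n), (u : A) ∈ F.pred n → φ n u = 0) :
    F.Gr →ₗ[K] V :=
  DirectSum.toModule K ℕ V fun n =>
    ((F.pred n).submoduleOf (F.fil n)).liftQ (φ n) fun u hu => h n u hu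

theorem grLift_toGr (φ : ∀ n, F.fil n →ₗ[K] V)
    (h : ∀ n (u : F.fil n), (u : A) ∈ F.pred n → φ n u = 0) (n : ℕ) (u : F.fil n) :
    F.grLift φ h (F.toGr n u) = φ n u := by
  exact (DirectSum.toModule_lof (M := F.gr) K n (F.proj n u)).trans rfl

/-- The map induced on `gr(A)` by a filtered linear map. -/
def grMap (f : A →ₗ[K] A) (hf : ∀ n, ∀ u ∈ F.fil n, f u ∈ F.fil n) : F.Gr →ₗ[K] F.Gr :=
  F.grLift (fun n => F.toGr n ∘ₗ f.restrict (hf n)) fun n u hu => F.toGr_eq_zero _ (by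
    cases n with
    | zero =>
      have h0 : (u : A) = 0 := hu
      change f u ∈ _
      rw [h0, map_zero]
      exact Submodule.zero_mem _
    | succ n => exact hf n _ hu)

theorem grMap_toGr (f : A →ₗ[K] A) (hf : ∀ n, ∀ u ∈ F.fil n, f u ∈ F.fil n) (n : ℕ) (u : F.fil n) :
    F.grMap f hf (F.toGr n u) = F.toGr n ⟨f u, hf n u u.2⟩ :=
  F.grLift_toGr _ _ n u

theorem gr_le {N : Submodule K F.Gr} (h : ∀ n u, F.toGr n u ∈ N) (x : F.Gr) : x ∈ N := by
  induction x using DirectSum.induction_on with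
  | zero => exact N.zero_mem
  | of n a =>
    obtain ⟨u, rfl⟩ := F.proj_surjective n a
    exact h n u
  | add x y hx hy => exact N.add_mem hx hy

end AlgFiltration

/-! ### The color Poisson structure on gr(U). -/

namespace ColorLieAlgebra

open AlgFiltration

variable {K G L V : Type*} [Field K] [CommGroup G] [DecidableEq G]
  [AddCommGroup L] [Module K L] {χ : AntisymmBicharacter K G} (𝔤 : ColorLieAlgebra χ L)
  [AddCommGroup V] [Module K V]

/-- The class of a monomial in the associated graded algebra. -/
def grMonomial (l : List (G × L)) : 𝔤.GrU :=
  𝔤.filtration.toGr l.length ⟨𝔤.monomial l, 𝔤.monomial_mem_fil l⟩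

/-- Monomials shorter than n have zero class in gr^n, so the classes of monomials in the degree
equal to their length suffice. -/
theorem grU_le {N : Submodule K 𝔤.GrU}
    (h : ∀ l, 𝔤.IsHomogeneousList l → 𝔤.grMonomial l ∈ N) (x : 𝔤.GrU) : x ∈ N := by
  refine 𝔤.filtration.gr_le (fun n u => ?_) x
  have hle : 𝔤.filtration.fil n ≤ (N.comap (𝔤.filtration.toGr n)).map (Submodule.subtype _) := by
    refine 𝔤.fil_le_of_monomial fun l hl hn => ?_
    refine ⟨⟨𝔤.monomial l, 𝔤.filtration.mono hn (𝔤.monomial_mem_fil l)⟩, ?_, rfl⟩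
    rw [SetLike.mem_coe, Submodule.mem_comap]
    obtain hn' | hn' := Nat.eq_or_lt_of_le hn
    · rw [𝔤.filtration.toGr_congr hn'.symm _ ⟨𝔤.monomial l, 𝔤.monomial_mem_fil l⟩ rfl]
      exact h l hl
    · rw [toGr_eq_zero _ _ (𝔤.filtration.fil_le_pred hn' (𝔤.monomial_mem_fil l))]
      exact N.zero_mem
  obtain ⟨u', hu', h'⟩ := hle u.2
  rwa [← Subtype.ext h']

theorem linearMap_ext_grMonomial {f f' : 𝔤.GrU →ₗ[K] V}
    (h : ∀ l, 𝔤.IsHomogeneousList l → f (𝔤.grMonomial l) = f' (𝔤.grMonomial l)) : f = f' :=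
  LinearMap.ext fun x => 𝔤.grU_le (N := LinearMap.eqLocus f f') h x

theorem toGr_mem_grGrading {g : G} {n : ℕ} (u : 𝔤.filtration.fil n)
    (hu : (u : 𝔤.U) ∈ 𝔤.uGrading g) : 𝔤.filtration.toGr n u ∈ 𝔤.grGrading g :=
  Submodule.subset_span ⟨n, u, hu, rfl⟩

theorem grMonomial_mem_grGrading {l : List (G × L)} (hl : 𝔤.IsHomogeneousList l) :
    𝔤.grMonomial l ∈ 𝔤.grGrading (totalDegree l) :=
  𝔤.toGr_mem_grGrading _ (𝔤.monomial_mem_uGrading hl)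

/-- Each Poisson axiom is linear in every argument. This reduces it to classes of homogeneous
elements of U, where it follows from the same identity in U. -/
theorem grGrading_induction {g : G} {p : 𝔤.GrU → Prop} (hadd : ∀ a b, p a → p b → p (a + b))
    (hsmul : ∀ (c : K) a, p a → p (c • a))
    (h : ∀ n (u : 𝔤.filtration.fil n), (u : 𝔤.U) ∈ 𝔤.uGrading g → p (𝔤.filtration.toGr n u))
    {a : 𝔤.GrU} (ha : a ∈ 𝔤.grGrading g) : p a := by
  induction ha using Submodule.span_induction with
  | mem x hx =>
    obtain ⟨n, u, hu, rfl⟩ := hx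
    exact h n u hu
  | zero => simpa using h 0 0 (Submodule.zero_mem _)
  | add x y _ _ hx hy => exact hadd x y hx hy
  | smul c x _ hx => exact hsmul c x hx

/-- The projection of `gr(U(𝔤))` onto its part of `G`-degree `g`. -/
def grDegProj (g : G) : 𝔤.GrU →ₗ[K] 𝔤.GrU :=
  𝔤.filtration.grMap (𝔤.degProj g) fun _ _ hu => 𝔤.degProj_mem_fil g hu

theorem grDegProj_of_mem {g : G} {a : 𝔤.GrU} (ha : a ∈ 𝔤.grGrading g) : 𝔤.grDegProj g a = a := by
  refine 𝔤.grGrading_induction (p := fun a => 𝔤.grDegProj g a = a)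
    (fun a b ha hb => by rw [map_add, ha, hb]) (fun c a ha => by rw [map_smul, ha])
    (fun n u hu => ?_) ha
  rw [grDegProj, grMap_toGr]
  exact toGr_congr _ rfl _ _ (𝔤.degProj_of_mem hu)

theorem grDegProj_of_mem_ne {g h : G} (hgh : g ≠ h) {a : 𝔤.GrU} (ha : a ∈ 𝔤.grGrading h) :
    𝔤.grDegProj g a = 0 := by
  refine 𝔤.grGrading_induction (p := fun a => 𝔤.grDegProj g a = 0)
    (fun a b ha hb => by rw [map_add, ha, hb, add_zero])
    (fun c a ha => by rw [map_smul, ha, smul_zero]) (fun n u hu => ?_) ha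
  rw [grDegProj, grMap_toGr]
  exact toGr_eq_zero_of_eq_zero _ _ (𝔤.degProj_of_mem_ne hgh hu)

theorem grDegProj_mem (g : G) (a : 𝔤.GrU) : 𝔤.grDegProj g a ∈ 𝔤.grGrading g := by
  refine 𝔤.filtration.gr_le (N := (𝔤.grGrading g).comap (𝔤.grDegProj g)) (fun n u => ?_) a
  rw [Submodule.mem_comap, grDegProj, grMap_toGr]
  exact 𝔤.toGr_mem_grGrading _ (𝔤.degProj_mem_uGrading g u)

theorem isInternal_grGrading : DirectSum.IsInternal 𝔤.grGrading :=
  DirectSum.isInternal_of_projections _ 𝔤.grDegProj (fun _ _ ha => 𝔤.grDegProj_of_mem ha)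
    (fun _ _ hgh _ ha => 𝔤.grDegProj_of_mem_ne hgh ha) fun x =>
      𝔤.grU_le (fun l hl => (le_iSup 𝔤.grGrading (totalDegree l)) (𝔤.grMonomial_mem_grGrading hl)) x

section Bracket

theorem comm_mem_fil {n m : ℕ} {u v : 𝔤.U} (hu : u ∈ 𝔤.filtration.fil n)
    (hv : v ∈ 𝔤.filtration.fil m) : 𝔤.comm u v ∈ 𝔤.filtration.fil (n + m - 1) :=
  𝔤.filtration.pred_le_fil_pred _ (𝔤.comm_mem_pred hu hv)

/-- The color commutator as a map `U_n × U_m → gr^{n+m-1}(U)`. -/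
def commGr (n m : ℕ) : 𝔤.filtration.fil n →ₗ[K] 𝔤.filtration.fil m →ₗ[K] 𝔤.GrU :=
  LinearMap.mk₂ K
    (fun u v => 𝔤.filtration.toGr (n + m - 1) ⟨𝔤.comm u v, 𝔤.comm_mem_fil u.2 v.2⟩)
    (fun u u' v => by
      rw [← map_add]
      exact toGr_congr _ rfl _ _ (LinearMap.map_add₂ _ _ _ _))
    (fun c u v => by
      rw [← map_smul]
      exact toGr_congr _ rfl _ _ (LinearMap.map_smul₂ _ _ _ _))
    (fun u v v' => by
      rw [← map_add]
      exact toGr_congr _ rfl _ _ (map_add _ _ _))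
    (fun c u v => by
      rw [← map_smul]
      exact toGr_congr _ rfl _ _ (map_smul _ _ _))

/-- U_0 consists of scalars. This settles the degree-zero cases, where the truncated n + m - 1
breaks the index arithmetic. -/
theorem comm_eq_zero_left {u : 𝔤.U} (hu : u ∈ 𝔤.filtration.fil 0) (v : 𝔤.U) : 𝔤.comm u v = 0 := by
  refine 𝔤.fil_le_of_monomial (N := LinearMap.ker (𝔤.comm.flip v)) (fun l _ hl => ?_) hu
  obtain rfl : l = [] := by simpa using hl
  exact 𝔤.comm_one_left v

theorem comm_eq_zero_right {v : 𝔤.U} (hv : v ∈ 𝔤.filtration.fil 0) (u : 𝔤.U) : 𝔤.comm u v = 0 := by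
  refine 𝔤.fil_le_of_monomial (N := LinearMap.ker (𝔤.comm u)) (fun l _ hl => ?_) hv
  obtain rfl : l = [] := by simpa using hl
  exact 𝔤.comm_one_right u

theorem commGr_eq_zero_right {n m : ℕ} (u : 𝔤.filtration.fil n) (v : 𝔤.filtration.fil m)
    (hv : (v : 𝔤.U) ∈ 𝔤.filtration.pred m) : 𝔤.commGr n m u v = 0 := by
  cases m with
  | zero =>
    have h0 : (v : 𝔤.U) = 0 := hv
    exact toGr_eq_zero_of_eq_zero _ _ (by simp [h0])
  | succ m => exact toGr_eq_zero _ _ (𝔤.comm_mem_pred u.2 hv)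

theorem commGr_eq_zero_left {n m : ℕ} (u : 𝔤.filtration.fil n) (v : 𝔤.filtration.fil m)
    (hu : (u : 𝔤.U) ∈ 𝔤.filtration.pred n) : 𝔤.commGr n m u v = 0 := by
  cases n with
  | zero =>
    have h0 : (u : 𝔤.U) = 0 := hu
    exact toGr_eq_zero_of_eq_zero _ _ (by simp [h0])
  | succ n =>
    have h := 𝔤.comm_mem_pred hu v.2
    rw [show n + m = n + 1 + m - 1 by omega] at h
    exact toGr_eq_zero _ _ h

/-- The Poisson bracket on `gr(U(𝔤))`. -/
def grBracket : 𝔤.GrU →ₗ[K] 𝔤.GrU →ₗ[K] 𝔤.GrU :=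
  𝔤.filtration.grLift
    (fun n => (𝔤.filtration.grLift (fun m => (𝔤.commGr n m).flip) fun _ v hv =>
      LinearMap.ext fun u => 𝔤.commGr_eq_zero_right u v hv).flip)
    fun n u hu => LinearMap.ext fun y => 𝔤.filtration.gr_le
      (N := LinearMap.ker (LinearMap.flip (𝔤.filtration.grLift (fun m => (𝔤.commGr n m).flip) _) u))
      (fun m v => by
        rw [LinearMap.mem_ker, LinearMap.flip_apply, grLift_toGr]
        exact 𝔤.commGr_eq_zero_left u v hu) y

theorem grBracket_toGr {n m : ℕ} (u : 𝔤.filtration.fil n) (v : 𝔤.filtration.fil m) :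
    𝔤.grBracket (𝔤.filtration.toGr n u) (𝔤.filtration.toGr m v) =
      𝔤.filtration.toGr (n + m - 1) ⟨𝔤.comm u v, 𝔤.comm_mem_fil u.2 v.2⟩ := by
  rw [grBracket, grLift_toGr, LinearMap.flip_apply, grLift_toGr]
  rfl

theorem isCommutatorBracket_grBracket : 𝔤.IsCommutatorBracket 𝔤.grBracket := by
  intro n m g h u v hu hv
  refine ⟨𝔤.comm_apply hu hv ▸ 𝔤.comm_mem_fil u.2 v.2, ?_⟩
  rw [grBracket_toGr]
  exact toGr_congr _ rfl _ _ (𝔤.comm_apply hu hv)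

variable {𝔤} in
theorem IsCommutatorBracket.eq {P : 𝔤.GrU →ₗ[K] 𝔤.GrU →ₗ[K] 𝔤.GrU}
    (hP : 𝔤.IsCommutatorBracket P) : P = 𝔤.grBracket := by
  refine 𝔤.linearMap_ext_grMonomial fun l hl => 𝔤.linearMap_ext_grMonomial fun l' hl' => ?_
  have hu := 𝔤.monomial_mem_uGrading hl
  have hv := 𝔤.monomial_mem_uGrading hl'
  obtain ⟨_, h1⟩ := hP l.length l'.length _ _ ⟨_, 𝔤.monomial_mem_fil l⟩ ⟨_, 𝔤.monomial_mem_fil l'⟩ hu hv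
  obtain ⟨_, h2⟩ := 𝔤.isCommutatorBracket_grBracket l.length l'.length _ _
    ⟨_, 𝔤.monomial_mem_fil l⟩ ⟨_, 𝔤.monomial_mem_fil l'⟩ hu hv
  exact h1.trans h2.symm

theorem grBracket_zero_left (u : 𝔤.filtration.fil 0) (b : 𝔤.GrU) :
    𝔤.grBracket (𝔤.filtration.toGr 0 u) b = 0 := by
  refine 𝔤.filtration.gr_le (N := LinearMap.ker (𝔤.grBracket (𝔤.filtration.toGr 0 u)))
    (fun m v => ?_) b
  rw [LinearMap.mem_ker, grBracket_toGr]
  exact toGr_eq_zero_of_eq_zero _ _ (𝔤.comm_eq_zero_left u.2 _)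

theorem grBracket_zero_right (u : 𝔤.filtration.fil 0) (b : 𝔤.GrU) :
    𝔤.grBracket b (𝔤.filtration.toGr 0 u) = 0 := by
  refine 𝔤.filtration.gr_le (N := LinearMap.ker (𝔤.grBracket.flip (𝔤.filtration.toGr 0 u)))
    (fun m v => ?_) b
  rw [LinearMap.mem_ker, LinearMap.flip_apply, grBracket_toGr]
  exact toGr_eq_zero_of_eq_zero _ _ (𝔤.comm_eq_zero_right u.2 _)

theorem comm_skew {g h : G} {u v : 𝔤.U} (hu : u ∈ 𝔤.uGrading g) (hv : v ∈ 𝔤.uGrading h) :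
    𝔤.comm u v = -((χ g h : K) • 𝔤.comm v u) := by
  rw [𝔤.comm_apply hu hv, 𝔤.comm_apply hv hu, smul_sub, smul_smul, χ.coe_mul_swap, one_smul,
    neg_sub]

theorem comm_jacobi {g h k : G} {u v w : 𝔤.U} (hu : u ∈ 𝔤.uGrading g) (hv : v ∈ 𝔤.uGrading h)
    (hw : w ∈ 𝔤.uGrading k) :
    (χ k g : K) • 𝔤.comm u (𝔤.comm v w) + (χ g h : K) • 𝔤.comm v (𝔤.comm w u) +
      (χ h k : K) • 𝔤.comm w (𝔤.comm u v) = 0 := by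
  rw [𝔤.comm_apply hu (𝔤.comm_mem_uGrading hv hw), 𝔤.comm_apply hv (𝔤.comm_mem_uGrading hw hu),
    𝔤.comm_apply hw (𝔤.comm_mem_uGrading hu hv), 𝔤.comm_apply hu hv, 𝔤.comm_apply hv hw,
    𝔤.comm_apply hw hu]
  simp only [χ.coe_mul_right]
  have h1 := χ.coe_mul_swap g h
  have h2 := χ.coe_mul_swap h k
  have h3 := χ.coe_mul_swap k g
  generalize (χ g h : K) = a at *
  generalize (χ h g : K) = a' at *
  generalize (χ h k : K) = b at *
  generalize (χ k h : K) = b' at *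
  generalize (χ k g : K) = c at *
  generalize (χ g k : K) = c' at *
  have ha : a ≠ 0 := left_ne_zero_of_mul_eq_one h1
  have hb : b ≠ 0 := left_ne_zero_of_mul_eq_one h2
  have hc : c ≠ 0 := left_ne_zero_of_mul_eq_one h3
  obtain rfl : a' = a⁻¹ := eq_inv_of_mul_eq_one_right h1
  obtain rfl : b' = b⁻¹ := eq_inv_of_mul_eq_one_right h2
  obtain rfl : c' = c⁻¹ := eq_inv_of_mul_eq_one_right h3
  simp only [mul_sub, sub_mul, mul_smul_comm, smul_mul_assoc, mul_assoc]
  match_scalars <;> field_simp <;> ring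

/-- The color commutator of representatives lies one filtration step lower, hence has zero class in
degree n + m. -/
theorem grU_mul_comm {g h : G} {a b : 𝔤.GrU} (ha : a ∈ 𝔤.grGrading g) (hb : b ∈ 𝔤.grGrading h) :
    a * b = (χ g h : K) • (b * a) := by
  refine 𝔤.grGrading_induction (p := fun a => a * b = (χ g h : K) • (b * a))
    (fun a a' h h' => by rw [add_mul, mul_add, h, h', smul_add])
    (fun c a h => by rw [smul_mul_assoc, mul_smul_comm, h, smul_comm]) (fun n u hu => ?_) ha
  refine 𝔤.grGrading_induction (p := fun b => _ * b = (χ g h : K) • (b * _))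
    (fun a a' h h' => by rw [add_mul, mul_add, h, h', smul_add])
    (fun c a h => by rw [smul_mul_assoc, mul_smul_comm, h, smul_comm]) (fun m v hv => ?_) hb
  rw [toGr_mul, toGr_mul, ← map_smul,
    toGr_congr _ (Nat.add_comm m n) _ ⟨_, Submodule.smul_mem _ _
      (Nat.add_comm m n ▸ 𝔤.filtration.mul_mem v.2 u.2)⟩ rfl]
  refine toGr_eq_of_sub_mem _ _ _ ?_
  have := 𝔤.comm_mem_pred u.2 v.2
  rwa [𝔤.comm_apply hu hv] at this

theorem isColorLieBracket_grBracket : IsColorLieBracket χ 𝔤.grGrading 𝔤.grBracket where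
  mem g h a b ha hb := by
    refine 𝔤.grGrading_induction (p := fun a => 𝔤.grBracket a b ∈ 𝔤.grGrading (g * h))
      (fun a a' h h' => by rw [LinearMap.map_add₂]; exact Submodule.add_mem _ h h')
      (fun c a h => by rw [LinearMap.map_smul₂]; exact Submodule.smul_mem _ _ h)
      (fun n u hu => ?_) ha
    refine 𝔤.grGrading_induction (p := fun b => 𝔤.grBracket _ b ∈ 𝔤.grGrading (g * h))
      (fun a a' h h' => by rw [map_add]; exact Submodule.add_mem _ h h')
      (fun c a h => by rw [map_smul]; exact Submodule.smul_mem _ _ h)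
      (fun m v hv => ?_) hb
    rw [grBracket_toGr]
    exact 𝔤.toGr_mem_grGrading _ (𝔤.comm_mem_uGrading hu hv)
  skew g h a b ha hb := by
    refine 𝔤.grGrading_induction (p := fun a => 𝔤.grBracket a b = -((χ g h : K) • 𝔤.grBracket b a))
      (fun a a' h h' => by rw [LinearMap.map_add₂, map_add, h, h']; module)
      (fun c a h => by rw [LinearMap.map_smul₂, map_smul, h]; module)
      (fun n u hu => ?_) ha
    refine 𝔤.grGrading_induction (p := fun b => 𝔤.grBracket _ b = -((χ g h : K) • 𝔤.grBracket b _))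
      (fun a a' h h' => by rw [LinearMap.map_add₂, map_add, h, h']; module)
      (fun c a h => by rw [LinearMap.map_smul₂, map_smul, h]; module)
      (fun m v hv => ?_) hb
    rw [grBracket_toGr, grBracket_toGr, ← map_smul, ← map_neg]
    exact toGr_congr _ (by omega) _ _ (𝔤.comm_skew hu hv)
  jacobi g h k a b c ha hb hc := by
    refine 𝔤.grGrading_induction (p := fun a => (χ k g : K) • 𝔤.grBracket a (𝔤.grBracket b c) +
        (χ g h : K) • 𝔤.grBracket b (𝔤.grBracket c a) +
        (χ h k : K) • 𝔤.grBracket c (𝔤.grBracket a b) = 0)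
      (fun a a' h h' => by
        simp only [map_add, LinearMap.add_apply]
        linear_combination (norm := module) h + h')
      (fun r a h => by
        simp only [map_smul, LinearMap.smul_apply]
        linear_combination (norm := module) r • h)
      (fun n u hu => ?_) ha
    refine 𝔤.grGrading_induction (p := fun b => (χ k g : K) • 𝔤.grBracket _ (𝔤.grBracket b c) +
        (χ g h : K) • 𝔤.grBracket b (𝔤.grBracket c _) +
        (χ h k : K) • 𝔤.grBracket c (𝔤.grBracket _ b) = 0)
      (fun a a' h h' => by
        simp only [map_add, LinearMap.add_apply]
        linear_combination (norm := module) h + h')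
      (fun r a h => by
        simp only [map_smul, LinearMap.smul_apply]
        linear_combination (norm := module) r • h)
      (fun m v hv => ?_) hb
    refine 𝔤.grGrading_induction (p := fun c => (χ k g : K) • 𝔤.grBracket _ (𝔤.grBracket _ c) +
        (χ g h : K) • 𝔤.grBracket _ (𝔤.grBracket c _) +
        (χ h k : K) • 𝔤.grBracket c (𝔤.grBracket _ _) = 0)
      (fun a a' h h' => by
        simp only [map_add, LinearMap.add_apply]
        linear_combination (norm := module) h + h')
      (fun r a h => by
        simp only [map_smul, LinearMap.smul_apply]
        linear_combination (norm := module) r • h)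
      (fun l w hw => ?_) hc
    -- If one degree is zero, every term vanishes. Otherwise the three iterated brackets live in the
    -- same degree and the Jacobi identity of U applies.
    match n, m, l with
    | 0, _, _ => simp [grBracket_zero_left, grBracket_zero_right]
    | _, 0, _ => simp [grBracket_zero_left, grBracket_zero_right]
    | _, _, 0 => simp [grBracket_zero_left, grBracket_zero_right]
    | n + 1, m + 1, l + 1 =>
      have e1 : n + 1 + (m + 1 + (l + 1) - 1) - 1 = n + m + l + 1 := by omega
      have e2 : m + 1 + (l + 1 + (n + 1) - 1) - 1 = n + m + l + 1 := by omega
      have e3 : l + 1 + (n + 1 + (m + 1) - 1) - 1 = n + m + l + 1 := by omega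
      have h1 := 𝔤.comm_mem_fil u.2 (𝔤.comm_mem_fil v.2 w.2)
      have h2 := 𝔤.comm_mem_fil v.2 (𝔤.comm_mem_fil w.2 u.2)
      have h3 := 𝔤.comm_mem_fil w.2 (𝔤.comm_mem_fil u.2 v.2)
      simp only [grBracket_toGr]
      rw [toGr_congr _ e1 _ ⟨_, e1 ▸ h1⟩ rfl, toGr_congr _ e2 _ ⟨_, e2 ▸ h2⟩ rfl,
        toGr_congr _ e3 _ ⟨_, e3 ▸ h3⟩ rfl, ← map_smul, ← map_smul, ← map_smul, ← map_add, ← map_add]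
      exact toGr_eq_zero_of_eq_zero _ _ (𝔤.comm_jacobi hu hv hw)

theorem isColorPoissonAlgebra : IsColorPoissonAlgebra χ 𝔤.grGrading 𝔤.grBracket where
  isInternal := 𝔤.isInternal_grGrading
  one_mem := 𝔤.toGr_mem_grGrading _ 𝔤.one_mem_uGrading
  mul_mem g h a b ha hb := by
    refine 𝔤.grGrading_induction (p := fun a => a * b ∈ 𝔤.grGrading (g * h))
      (fun a a' h h' => by rw [add_mul]; exact Submodule.add_mem _ h h')
      (fun c a h => by rw [smul_mul_assoc]; exact Submodule.smul_mem _ _ h)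
      (fun n u hu => ?_) ha
    refine 𝔤.grGrading_induction (p := fun b => _ * b ∈ 𝔤.grGrading (g * h))
      (fun a a' h h' => by rw [mul_add]; exact Submodule.add_mem _ h h')
      (fun c a h => by rw [mul_smul_comm]; exact Submodule.smul_mem _ _ h)
      (fun m v hv => ?_) hb
    rw [toGr_mul]
    exact 𝔤.toGr_mem_grGrading _ (𝔤.mul_mem_uGrading hu hv)
  mul_comm _ _ _ _ ha hb := 𝔤.grU_mul_comm ha hb
  isColorLieBracket := 𝔤.isColorLieBracket_grBracket
  leibniz g h k a b c ha hb hc := by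
    refine 𝔤.grGrading_induction (p := fun a => 𝔤.grBracket a (b * c) = 𝔤.grBracket a b * c +
        (χ g h : K) • (b * 𝔤.grBracket a c))
      (fun a a' h h' => by
        simp only [map_add, LinearMap.add_apply, add_mul, mul_add]
        linear_combination (norm := module) h + h')
      (fun r a h => by
        simp only [map_smul, LinearMap.smul_apply, smul_mul_assoc, mul_smul_comm]
        linear_combination (norm := module) r • h)
      (fun n u hu => ?_) ha
    refine 𝔤.grGrading_induction (p := fun b => 𝔤.grBracket _ (b * c) = 𝔤.grBracket _ b * c +
        (χ g h : K) • (b * 𝔤.grBracket _ c))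
      (fun a a' h h' => by
        simp only [map_add, add_mul]
        linear_combination (norm := module) h + h')
      (fun r a h => by
        simp only [map_smul, smul_mul_assoc]
        linear_combination (norm := module) r • h)
      (fun m v hv => ?_) hb
    refine 𝔤.grGrading_induction (p := fun c => 𝔤.grBracket _ (_ * c) = 𝔤.grBracket _ _ * c +
        (χ g h : K) • (_ * 𝔤.grBracket _ c))
      (fun a a' h h' => by
        simp only [map_add, mul_add]
        linear_combination (norm := module) h + h')
      (fun r a h => by
        simp only [map_smul, mul_smul_comm]
        linear_combination (norm := module) r • h)
      (fun l w hw => ?_) hc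
    match n with
    | 0 => simp [grBracket_zero_left]
    | n + 1 =>
      have e1 : n + 1 + (m + l) - 1 = n + m + l := by omega
      have e2 : n + 1 + m - 1 + l = n + m + l := by omega
      have e3 : m + (n + 1 + l - 1) = n + m + l := by omega
      have h1 := 𝔤.comm_mem_fil u.2 (𝔤.filtration.mul_mem v.2 w.2)
      have h2 := 𝔤.filtration.mul_mem (𝔤.comm_mem_fil u.2 v.2) w.2
      have h3 := 𝔤.filtration.mul_mem v.2 (𝔤.comm_mem_fil u.2 w.2)
      simp only [grBracket_toGr, toGr_mul]
      rw [toGr_congr _ e1 _ ⟨_, e1 ▸ h1⟩ rfl, toGr_congr _ e2 _ ⟨_, e2 ▸ h2⟩ rfl,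
        toGr_congr _ e3 _ ⟨_, e3 ▸ h3⟩ rfl, ← map_smul, ← map_add]
      exact toGr_congr _ rfl _ _ (𝔤.comm_mul_right hu hv hw)

end Bracket

end ColorLieAlgebra

/-! ### Color signs and symmetrization on tensor powers. -/

namespace ColorLieAlgebra

open Module AlgFiltration

section ColorSign

variable {K G : Type*} [Field K] [CommGroup G] (χ : AntisymmBicharacter K G)

theorem swap_lt_swap_iff {p : ℕ} {a b r s : Fin p} (hab : b.val = a.val + 1)
    (h1 : (r, s) ≠ (a, b)) (h2 : (r, s) ≠ (b, a)) :
    Equiv.swap a b r < Equiv.swap a b s ↔ r < s := by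
  rw [Ne, Prod.mk.injEq] at h1 h2
  simp only [Equiv.swap_apply_def, Fin.ext_iff, Fin.lt_def] at *
  split_ifs <;> omega

/-- This is the cocycle rule for color signs. An adjacent transposition preserves the relative order
of every pair other than {a, b}, so after reindexing only that pair contributes differently. -/
theorem colorSign_swap_mul {p : ℕ} (d : Fin p → G) (σ : Equiv.Perm (Fin p)) {a b : Fin p}
    (hab : b.val = a.val + 1) :
    colorSign χ d σ =
      colorSign χ (d ∘ Equiv.swap a b) (Equiv.swap a b * σ) * (χ (d a) (d b) : K) := by
  set τ := Equiv.swap a b with hτ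
  have h1 : colorSign χ (d ∘ τ) (τ * σ) = ∏ x : Fin p × Fin p,
      if τ x.1 < τ x.2 ∧ σ.symm x.2 < σ.symm x.1 then (χ (d x.1) (d x.2) : K) else 1 := by
    rw [colorSign, Finset.prod_filter, ← Equiv.prod_comp (Equiv.prodCongr τ τ)]
    refine Finset.prod_congr rfl fun x _ => ?_
    have hs : ∀ y, (τ * σ).symm (τ y) = σ.symm y := fun y => by
      rw [Equiv.symm_apply_eq, Equiv.Perm.mul_apply, Equiv.apply_symm_apply]
    have hd : ∀ y, (d ∘ τ) (τ y) = d y := fun y => by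
      rw [Function.comp_apply, hτ, Equiv.swap_apply_self]
    simp only [Equiv.prodCongr_apply, Prod.map_fst, Prod.map_snd, hs, hd]
  -- The extra factor is placed at (a, b) if σ inverts this pair, where it supplies the missing
  -- factor, and at (b, a) otherwise, where it cancels χ(d b, d a). The two products then agree
  -- factor by factor.
  have h2 : (χ (d a) (d b) : K) = ∏ x : Fin p × Fin p,
      if (if σ.symm b < σ.symm a then (a, b) else (b, a)) = x then (χ (d a) (d b) : K) else 1 := by
    rw [Finset.prod_ite_eq, if_pos (Finset.mem_univ _)]
  have hne : a ≠ b := by rintro rfl; omega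
  have hlt : a < b := by rw [Fin.lt_def]; omega
  rw [h1, h2, ← Finset.prod_mul_distrib, colorSign, Finset.prod_filter]
  refine Finset.prod_congr rfl fun x _ => ?_
  obtain ⟨r, s⟩ := x
  by_cases hx1 : (r, s) = (a, b)
  · obtain ⟨rfl, rfl⟩ := Prod.mk.inj hx1
    have h3 : (s, r) ≠ (r, s) := fun h => hne (Prod.mk.inj h).2
    simp only [hτ, Equiv.swap_apply_left, Equiv.swap_apply_right, hlt, hlt.not_gt, true_and,
      false_and, if_false, one_mul]
    split_ifs <;> simp_all
  · by_cases hx2 : (r, s) = (b, a)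
    · obtain ⟨rfl, rfl⟩ := Prod.mk.inj hx2
      have h4 : σ.symm r < σ.symm s ↔ ¬ σ.symm s < σ.symm r := by
        rw [not_lt, le_iff_lt_or_eq, or_iff_left]
        exact fun h => hne (σ.symm.injective h).symm
      have h3 := χ.coe_mul_swap (d r) (d s)
      simp only [hτ, Equiv.swap_apply_left, Equiv.swap_apply_right, hlt, hlt.not_gt, true_and,
        false_and, if_false]
      by_cases h5 : σ.symm s < σ.symm r
      · simp [h4, h5, h3]
      · simp [h4, h5, hne]
    · have h6 : (if σ.symm b < σ.symm a then (a, b) else (b, a)) ≠ (r, s) := by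
        split_ifs
        · exact fun h => hx1 h.symm
        · exact fun h => hx2 h.symm
      rw [if_neg h6, mul_one]
      simp only [hτ, swap_lt_swap_iff hab hx1 hx2]

theorem colorSign_one {p : ℕ} (d : Fin p → G) : colorSign χ d 1 = 1 := by
  rw [colorSign, Finset.prod_eq_one]
  intro x hx
  rw [Finset.mem_filter] at hx
  exact absurd hx.2.1 (not_lt_of_gt hx.2.2)

/-- The sum over all permutations, with color signs, of the reordered products. -/
def colorSum {L R : Type*} [Ring R] [Algebra K R] (f : L → R) {p : ℕ} (d : Fin p → G)
    (x : Fin p → L) : R :=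
  ∑ σ : Equiv.Perm (Fin p), colorSign χ d σ • (List.ofFn fun i => f (x (σ i))).prod

theorem colorSum_swap {L R : Type*} [Ring R] [Algebra K R] (f : L → R) {p : ℕ} (d : Fin p → G)
    (x : Fin p → L) {a b : Fin p} (hab : b.val = a.val + 1) :
    colorSum χ f d x =
      (χ (d a) (d b) : K) • colorSum χ f (d ∘ Equiv.swap a b) (x ∘ Equiv.swap a b) := by
  rw [colorSum, colorSum]
  conv_rhs => rw [← Equiv.sum_comp (Equiv.mulLeft (Equiv.swap a b)), Finset.smul_sum]
  refine Finset.sum_congr rfl fun σ _ => ?_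
  rw [colorSign_swap_mul χ d σ hab, smul_smul, mul_comm]
  simp

end ColorSign

variable {K G L I : Type*} [Field K] [CommGroup G] [DecidableEq G]
  [AddCommGroup L] [Module K L] {χ : AntisymmBicharacter K G} (𝔤 : ColorLieAlgebra χ L)
  {b : Basis I K L} {deg : I → G}

/-- The product of a finite family of vectors in the tensor algebra. -/
def tprod {p : ℕ} (x : Fin p → L) : TensorAlgebra K L :=
  (List.ofFn fun i => TensorAlgebra.ι K (x i)).prod

theorem tprod_succ {p : ℕ} (x : Fin (p + 1) → L) :
    tprod (K := K) x = TensorAlgebra.ι K (x 0) * tprod fun i => x i.succ := by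
  rw [tprod, List.ofFn_succ, List.prod_cons, tprod]

theorem tprod_mem {p : ℕ} (x : Fin p → L) : tprod x ∈ tensorPow K L p := by
  induction p with
  | zero => simp [tprod, tensorPow]
  | succ p ih => rw [tprod_succ]; exact ι_mul_mem_tensorPow _ (ih _)

theorem word_ofFn {p : ℕ} (b : Basis I K L) (c : Fin p → I) :
    word b (List.ofFn c) = tprod fun i => b (c i) := by
  rw [word, tprod, List.map_ofFn]
  rfl

theorem swapAt_tprod (hb : 𝔤.IsHomogeneousBasis b deg) {p : ℕ} {d : Fin p → G} {x : Fin p → L}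
    (hx : ∀ i, x i ∈ 𝔤.grading (d i)) {a c : Fin p} (hac : c.val = a.val + 1) :
    swapAt χ b deg a (tprod x) = (χ (d a) (d c) : K) • tprod (x ∘ Equiv.swap a c) := by
  obtain ⟨i, hi⟩ := a
  obtain ⟨j, hj⟩ := c
  obtain rfl : j = i + 1 := hac
  induction i generalizing p with
  | zero =>
    obtain ⟨q, rfl⟩ : ∃ q, p = q + 2 := ⟨p - 2, by omega⟩
    rw [tprod_succ, tprod_succ, tprod_succ, tprod_succ]
    change swapAt χ b deg 0 _ = (χ (d 0) (d 1) : K) • (TensorAlgebra.ι K ((x ∘ Equiv.swap 0 1) 0) *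
      (TensorAlgebra.ι K ((x ∘ Equiv.swap 0 1) 1) *
        tprod fun i : Fin q => (x ∘ Equiv.swap 0 1) i.succ.succ))
    have h : ∀ i : Fin q, Equiv.swap 0 1 i.succ.succ = i.succ.succ := fun i =>
      Equiv.swap_apply_of_ne_of_ne (Fin.succ_ne_zero _) (by simp [Fin.ext_iff])
    simp only [Function.comp_apply, Equiv.swap_apply_left, Equiv.swap_apply_right, h]
    exact 𝔤.swapAt_zero_mul hb (hx 0) (hx 1) _
  | succ i ih =>
    obtain ⟨q, rfl⟩ : ∃ q, p = q + 1 := ⟨p - 1, by omega⟩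
    have h0 : Equiv.swap (⟨i + 1, hi⟩ : Fin (q + 1)) ⟨i + 1 + 1, hj⟩ 0 = 0 :=
      Equiv.swap_apply_of_ne_of_ne (by simp [Fin.ext_iff]) (by simp [Fin.ext_iff])
    have hs : (fun k : Fin q => (x ∘ Equiv.swap ⟨i + 1, hi⟩ ⟨i + 1 + 1, hj⟩) k.succ) =
        (fun k => x k.succ) ∘ Equiv.swap ⟨i, by omega⟩ ⟨i + 1, by omega⟩ := by
      funext k
      exact congrArg x ((Fin.succ_injective q).swap_apply ⟨i, by omega⟩ ⟨i + 1, by omega⟩ k)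
    rw [tprod_succ, tprod_succ, hs, ← mul_smul_comm, swapAt_succ_mul,
      ih (x := fun i => x i.succ) (d := fun i => d i.succ) (fun k => hx k.succ)
        (by omega) (by omega), Function.comp_apply, h0]
    rfl

theorem respectsRel_mkU (hb : 𝔤.IsHomogeneousBasis b deg) (n : ℕ) :
    𝔤.RespectsRel b deg 𝔤.mkU.toLinearMap n := by
  intro t ht i hi
  refine eqOn_tensorPow b (f := 𝔤.mkU.toLinearMap) (f' := 𝔤.mkU.toLinearMap ∘ₗ swapAt χ b deg i +
    𝔤.mkU.toLinearMap ∘ₗ 𝔤.bracketAt b i) (fun w hw => ?_) ht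
  clear ht
  simp only [LinearMap.add_apply, LinearMap.comp_apply, AlgHom.toLinearMap_apply]
  induction i generalizing w n with
  | zero =>
    match w with
    | [] => simp at hw; omega
    | [a] => simp at hw; omega
    | a :: c :: w =>
      rw [word_cons, word_cons, 𝔤.swapAt_zero_basis hb, bracketAt_zero_mul]
      simp only [map_mul, map_smul, mkU_ι]
      rw [← mul_assoc, 𝔤.ι_mul_ι (hb.mem a) (hb.mem c), add_mul, smul_mul_assoc, mul_assoc]
  | succ i ih =>
    match w with
    | [] => simp at hw; omega
    | a :: w =>
      simp only [List.length_cons] at hw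
      rw [word_cons, swapAt_succ_mul, bracketAt_succ_mul]
      simp only [map_mul]
      rw [ih (n - 1) (by omega) w (by omega), mul_add]

theorem mkU_mem_fil {n : ℕ} {t : TensorAlgebra K L} (ht : t ∈ tensorPow K L n) :
    𝔤.mkU t ∈ 𝔤.filtration.fil n := by
  refine mapsTo_tensorPow 𝔤.homogeneousBasis (f := 𝔤.mkU.toLinearMap) (fun w hw => ?_) ht
  refine Submodule.subset_span ⟨w.map 𝔤.homogeneousBasis, by simp [hw], ?_⟩
  rw [word, AlgHom.toLinearMap_apply, map_list_prod, List.map_map, List.map_map]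
  rfl

theorem mkU_tprod {p : ℕ} (x : Fin p → L) :
    𝔤.mkU (tprod x) = (List.ofFn fun i => 𝔤.ι (x i)).prod := by
  rw [tprod, map_list_prod, List.map_ofFn]
  rfl

theorem mkU_tprod_swap {p : ℕ} {d : Fin p → G} {x : Fin p → L}
    (hx : ∀ i, x i ∈ 𝔤.grading (d i)) {a c : Fin p} (hac : c.val = a.val + 1) :
    𝔤.mkU (tprod x) - (χ (d a) (d c) : K) • 𝔤.mkU (tprod (x ∘ Equiv.swap a c)) ∈
      𝔤.filtration.pred p := by
  have hb := 𝔤.isHomogeneousBasis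
  have h := 𝔤.respectsRel_mkU hb p (tprod x) (tprod_mem x) a (by omega)
  rw [𝔤.swapAt_tprod hb hx hac, map_smul] at h
  simp only [AlgHom.toLinearMap_apply] at h
  rw [h, add_sub_cancel_left]
  obtain ⟨q, rfl⟩ : ∃ q, p = q + 1 := ⟨p - 1, by omega⟩
  exact 𝔤.mkU_mem_fil (𝔤.bracketAt_mem (b := 𝔤.homogeneousBasis) _ (tprod_mem x))

/-- One adjacent swap costs χ and a bracket term in U_{p-1}. Adjacent transpositions generate the
symmetric group and the cocycle rule accumulates the signs. Consequently all summands of the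
symmetrization agree modulo U_{p-1}. -/
theorem mkU_tprod_perm {p : ℕ} (σ : Equiv.Perm (Fin p)) {d : Fin p → G} {x : Fin p → L}
    (hx : ∀ i, x i ∈ 𝔤.grading (d i)) :
    𝔤.mkU (tprod x) - colorSign χ d σ • 𝔤.mkU (tprod (x ∘ σ)) ∈ 𝔤.filtration.pred p := by
  have base : ∀ {d : Fin p → G} {x : Fin p → L}, 𝔤.mkU (tprod x) - colorSign χ d 1 •
      𝔤.mkU (tprod (x ∘ (1 : Equiv.Perm (Fin p)))) ∈ 𝔤.filtration.pred p := by
    intro d x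
    rw [colorSign_one, one_smul, Equiv.Perm.coe_one, Function.comp_id, sub_self]
    exact Submodule.zero_mem _
  cases p with
  | zero => rw [Subsingleton.elim σ 1]; exact base
  | succ n =>
    have hσ : σ ∈ Submonoid.closure
        (Set.range fun i : Fin n => Equiv.swap i.castSucc i.succ) := by
      rw [Equiv.Perm.mclosure_swap_castSucc_succ]; trivial
    induction hσ using Submonoid.closure_induction_left generalizing d x with
    | one => exact base
    | mul_left τ hτ σ _ ih =>
      obtain ⟨i, rfl⟩ := hτ
      have hi : i.succ.val = i.castSucc.val + 1 := by simp
      dsimp only at *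
      set τ := Equiv.swap i.castSucc i.succ with hτ
      have hττ : ∀ {α : Type _} (f : Fin (n + 1) → α), (f ∘ τ) ∘ τ = f := fun f => by
        funext j
        simp [hτ]
      have h1 := 𝔤.mkU_tprod_swap hx hi
      have h2 := ih (d := d ∘ τ) (x := x ∘ τ) fun j => hx (τ j)
      -- The rule is applied to `d ∘ τ` and `σ`, so that τ² = 1 produces the wanted sign of τσ with
      -- respect to `d`.
      have h3 := colorSign_swap_mul χ (d ∘ τ) σ hi
      rw [← hτ, hττ] at h3
      have h4 : (d ∘ τ) i.castSucc = d i.succ := by simp [hτ]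
      have h5 : (d ∘ τ) i.succ = d i.castSucc := by simp [hτ]
      rw [h4, h5] at h3
      have h6 := Submodule.add_mem _ h1
        (Submodule.smul_mem _ (χ (d i.castSucc) (d i.succ) : K) h2)
      have h7 := χ.coe_mul_swap (d i.castSucc) (d i.succ)
      rw [h3, smul_sub, smul_smul, mul_left_comm, h7, mul_one, sub_add_sub_cancel] at h6
      exact h6

/-- The value of the symmetrization map on a word. -/
def symWord (b : Basis I K L) (deg : I → G) {p : ℕ} (c : Fin p → I) : 𝔤.U :=
  (p.factorial : K)⁻¹ • colorSum χ 𝔤.ι (fun i => deg (c i)) (fun i => b (c i))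

/-- The symmetrization map on the tensor power of degree `p`, extended by zero. -/
def symPow (b : Basis I K L) (deg : I → G) (p : ℕ) : TensorAlgebra K L →ₗ[K] 𝔤.U :=
  ofWords b fun w => if w.length = p then 𝔤.symWord b deg w.get else 0

theorem symPow_tprod (b : Basis I K L) (deg : I → G) {p : ℕ} (c : Fin p → I) :
    𝔤.symPow b deg p (tprod fun i => b (c i)) = 𝔤.symWord b deg c := by
  have h : ∀ (w : List I) (hw : w.length = p),
      𝔤.symWord b deg w.get = 𝔤.symWord b deg fun i : Fin p => w.get (i.cast hw.symm) := by
    rintro w rfl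
    rfl
  rw [← word_ofFn, symPow, ofWords_word, if_pos (by simp), h _ (by simp)]
  congr 1
  funext i
  simp

theorem exists_ofFn {p : ℕ} (w : List I) (hw : w.length = p) : ∃ c : Fin p → I, w = List.ofFn c := by
  subst hw
  exact ⟨w.get, (List.ofFn_get w).symm⟩

theorem symPow_of_ne (b : Basis I K L) (deg : I → G) {p n : ℕ} (hn : n ≠ p)
    {t : TensorAlgebra K L} (ht : t ∈ tensorPow K L n) : 𝔤.symPow b deg p t = 0 :=
  eqOn_tensorPow b (f := 𝔤.symPow b deg p) (f' := 0)
    (fun w hw => by rw [symPow, ofWords_word, if_neg (by omega)]; rfl) ht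

/-- Bracket terms fall in degrees below p, where `symPow` is zero; in degree p the rest is
swap-invariance of the color sum. The restriction n ≤ p is genuine: in degree p+1 only the bracket
term survives. -/
theorem respectsRel_symPow (hb : 𝔤.IsHomogeneousBasis b deg) (p : ℕ) :
    ∀ n ≤ p, 𝔤.RespectsRel b deg (𝔤.symPow b deg p) n := by
  intro n hn t ht i hi
  obtain ⟨n, rfl⟩ : ∃ k, n = k + 1 := ⟨n - 1, by omega⟩
  rw [𝔤.symPow_of_ne b deg (by omega) (𝔤.bracketAt_mem (b := b) i ht), add_zero]
  obtain hn | rfl := Nat.lt_or_eq_of_le hn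
  · rw [𝔤.symPow_of_ne b deg (by omega) ht, 𝔤.symPow_of_ne b deg (by omega) (𝔤.swapAt_mem hb i ht)]
  · suffices h : ∀ w : List I, w.length = n + 1 → 𝔤.symPow b deg (n + 1) (word b w) =
        (𝔤.symPow b deg (n + 1) ∘ₗ swapAt χ b deg i) (word b w) by
      have h' := eqOn_tensorPow b h ht
      rwa [LinearMap.comp_apply] at h'
    intro w hw
    obtain ⟨c, rfl⟩ := exists_ofFn w hw
    rw [LinearMap.comp_apply, word_ofFn, 𝔤.swapAt_tprod hb (d := fun i => deg (c i))
      (fun i => hb.mem (c i)) (a := ⟨i, by omega⟩) (c := ⟨i + 1, by omega⟩) rfl, map_smul,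
      symPow_tprod]
    have := 𝔤.symPow_tprod b deg
      (c ∘ Equiv.swap (⟨i, by omega⟩ : Fin (n + 1)) ⟨i + 1, by omega⟩)
    simp only [Function.comp_def] at this ⊢
    rw [this, symWord, symWord, smul_comm, colorSum_swap χ 𝔤.ι _ _
      (a := (⟨i, by omega⟩ : Fin (n + 1))) (b := ⟨i + 1, by omega⟩) rfl]
    rfl

/-- With the degrees `d` fixed, the color signs are constants and both sides are multilinear on the
product of the spaces 𝔤_{d i}; it suffices to compare them on basis vectors. -/
theorem symPow_tprod_of_mem {p : ℕ} {d : Fin p → G} {x : Fin p → L}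
    (hx : ∀ i, x i ∈ 𝔤.grading (d i)) :
    𝔤.symPow 𝔤.homogeneousBasis Sigma.fst p (tprod x) =
      (p.factorial : K)⁻¹ • colorSum χ 𝔤.ι d x := by
  let M₁ : MultilinearMap K (fun _ : Fin p => L) 𝔤.U :=
    (𝔤.symPow 𝔤.homogeneousBasis Sigma.fst p).compMultilinearMap
      ((MultilinearMap.mkPiAlgebraFin K p (TensorAlgebra K L)).compLinearMap
        fun _ => TensorAlgebra.ι K)
  let M₂ : MultilinearMap K (fun _ : Fin p => L) 𝔤.U :=
    (p.factorial : K)⁻¹ • ∑ σ : Equiv.Perm (Fin p), colorSign χ d σ •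
      ((MultilinearMap.mkPiAlgebraFin K p 𝔤.U).compLinearMap fun _ => 𝔤.ι).domDomCongr σ
  have h₁ : ∀ y, M₁ y = 𝔤.symPow 𝔤.homogeneousBasis Sigma.fst p (tprod y) := fun y => rfl
  have h₂ : ∀ y, M₂ y = (p.factorial : K)⁻¹ • colorSum χ 𝔤.ι d y := fun y => by
    simp [M₂, colorSum]
  have h : M₁.compLinearMap (fun i => (𝔤.grading (d i)).subtype) =
      M₂.compLinearMap (fun i => (𝔤.grading (d i)).subtype) := by
    refine Basis.ext_multilinear (fun i => Basis.ofVectorSpace K (𝔤.grading (d i))) fun v => ?_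
    rw [MultilinearMap.compLinearMap_apply, MultilinearMap.compLinearMap_apply, h₁, h₂]
    have := 𝔤.symPow_tprod 𝔤.homogeneousBasis Sigma.fst fun i => ⟨d i, v i⟩
    simp only [symWord, homogeneousBasis_apply] at this
    exact this
  have := congrArg (fun M => M fun i => (⟨x i, hx i⟩ : 𝔤.grading (d i))) h
  simpa only [MultilinearMap.compLinearMap_apply, h₁, h₂, Submodule.subtype_apply]
    using this

end ColorLieAlgebra

/-! ### Splittings of a filtration and their components. -/

namespace AlgFiltration

variable {K A : Type*} [Field K] [Ring A] [Algebra K A] (F : AlgFiltration K A)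

/-- The linear map `ω : gr(A) → A` splits the canonical projections. -/
def IsSplitting (ω : F.Gr →ₗ[K] A) : Prop :=
  ∀ n (u : F.fil n), ω (F.toGr n u) - u ∈ F.pred n

variable {F} {ω : F.Gr →ₗ[K] A}

theorem IsSplitting.mem_fil (hω : F.IsSplitting ω) {n : ℕ} (u : F.fil n) :
    ω (F.toGr n u) ∈ F.fil n := by
  have h := Submodule.add_mem _ (F.pred_le_fil n (hω n u)) u.2
  rwa [sub_add_cancel] at h

theorem IsSplitting.lof_mem_fil (hω : F.IsSplitting ω) {n : ℕ} (a : F.gr n) :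
    ω (DirectSum.lof K ℕ F.gr n a) ∈ F.fil n := by
  obtain ⟨u, hu⟩ := F.lof_surjective_toGr n a
  rw [← hu]
  exact hω.mem_fil u

theorem IsSplitting.fil_le_range (hω : F.IsSplitting ω) (n : ℕ) :
    F.fil n ≤ LinearMap.range ω := by
  induction n with
  | zero =>
    intro u hu
    have h : ω (F.toGr 0 ⟨u, hu⟩) - u = 0 := hω 0 ⟨u, hu⟩
    exact ⟨_, sub_eq_zero.1 h⟩
  | succ n ih =>
    intro u hu
    have h := Submodule.sub_mem _ (LinearMap.mem_range_self ω (F.toGr (n + 1) ⟨u, hu⟩))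
      (ih (hω (n + 1) ⟨u, hu⟩))
    rwa [sub_sub_cancel] at h

theorem IsSplitting.mem_pred (hω : F.IsSplitting ω) {n : ℕ} {a : F.Gr} (ha : ∀ k, n ≤ k → a k = 0) :
    ω a ∈ F.pred n := by
  classical
  rw [← DirectSum.sum_support_of a, map_sum]
  refine Submodule.sum_mem _ fun i hi => ?_
  have hin : i < n := by
    by_contra h
    exact (DFinsupp.mem_support_iff.1 hi) (ha i (not_lt.1 h))
  exact F.fil_le_pred hin (hω.lof_mem_fil (a i))

/-- If ω a = 0 and the top component of a is π_n(u), the lower components map into U_{n-1}. Hence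
ω(π_n(u)), and with it u, lies in U_{n-1}, so the top component is zero. -/
theorem IsSplitting.injective (hω : F.IsSplitting ω) : Function.Injective ω := by
  classical
  have key : ∀ (n : ℕ) (a : F.Gr), (∀ k, n ≤ k → a k = 0) → ω a = 0 → a = 0 := by
    intro n
    induction n with
    | zero => intro a ha _; exact DFinsupp.ext fun k => ha k (Nat.zero_le k)
    | succ n ih =>
      intro a ha h
      obtain ⟨u, hu⟩ := F.lof_surjective_toGr n (a n)
      have h1 : ∀ k, n ≤ k → (a - F.toGr n u) k = 0 := by
        intro k hk
        rw [hu, DirectSum.sub_apply]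
        obtain rfl | hk := Nat.eq_or_lt_of_le hk
        · rw [DirectSum.lof_apply, sub_self]
        · rw [ha k hk, DirectSum.lof_eq_of, DirectSum.of_eq_of_ne _ _ _ hk.ne', sub_zero]
      have h2 := hω.mem_pred h1
      rw [map_sub, h, zero_sub, neg_mem_iff] at h2
      have h3 := Submodule.sub_mem _ h2 (hω n u)
      rw [sub_sub_cancel] at h3
      rw [F.toGr_eq_zero u h3, sub_zero] at h1
      exact ih a h1 h
  rw [injective_iff_map_eq_zero]
  intro a ha
  obtain ⟨n, hn⟩ : ∃ n, ∀ k, n ≤ k → a k = 0 := by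
    refine ⟨(DFinsupp.support a).sup id + 1, fun k hk => ?_⟩
    by_contra h
    have := Finset.le_sup (f := id) (DFinsupp.mem_support_iff.2 h)
    simp only [id_eq] at this
    omega
  exact key n a hn ha

theorem IsSplitting.bijective (hω : F.IsSplitting ω) (hF : ∀ u, ∃ n, u ∈ F.fil n) :
    Function.Bijective ω := by
  refine ⟨hω.injective, fun u => ?_⟩
  obtain ⟨n, hn⟩ := hF u
  exact hω.fil_le_range n hn

variable (F) in
/-- The map `x ↦ ω⁻¹(x_k)`. -/
def symbolAt (e : F.Gr ≃ₗ[K] A) (k : ℕ) : A →ₗ[K] F.Gr :=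
  DirectSum.lof K ℕ F.gr k ∘ₗ DirectSum.component K ℕ F.gr k ∘ₗ e.symm.toLinearMap

theorem symm_component (e : F.Gr ≃ₗ[K] A) (k : ℕ) (x : A) :
    e.symm (F.component e k x) = F.symbolAt e k x := by
  simp [component, symbolAt]

theorem component_eq (e : F.Gr ≃ₗ[K] A) (k : ℕ) (x : A) :
    F.component e k x = e (F.symbolAt e k x) := rfl

theorem symbolAt_toGr (e : F.Gr ≃ₗ[K] A) {k n : ℕ} (u : F.fil n) :
    F.symbolAt e k (e (F.toGr n u)) = if n = k then F.toGr n u else 0 := by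
  rw [symbolAt, LinearMap.comp_apply, LinearMap.comp_apply, LinearEquiv.coe_coe,
    LinearEquiv.symm_apply_apply, toGr, LinearMap.comp_apply]
  split_ifs with h
  · subst h
    rw [DirectSum.component.lof_self]
  · rw [DirectSum.component.of, dif_neg h, map_zero]

theorem symbolAt_lof (e : F.Gr ≃ₗ[K] A) {k n : ℕ} (a : F.gr n) :
    F.symbolAt e k (e (DirectSum.lof K ℕ F.gr n a)) =
      if n = k then DirectSum.lof K ℕ F.gr n a else 0 := by
  obtain ⟨u, hu⟩ := F.lof_surjective_toGr n a
  rw [← hu, symbolAt_toGr]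

variable {e : F.Gr ≃ₗ[K] A}

theorem symbolAt_eq_zero (he : F.IsSplitting e.toLinearMap) {n k : ℕ} (hnk : n < k) {x : A}
    (hx : x ∈ F.fil n) : F.symbolAt e k x = 0 := by
  induction n generalizing x with
  | zero =>
    have h : e (F.toGr 0 ⟨x, hx⟩) - x = 0 := he 0 ⟨x, hx⟩
    rw [← sub_eq_zero.1 h, symbolAt_toGr, if_neg (by omega)]
  | succ n ih =>
    have h := ih (by omega) (he (n + 1) ⟨x, hx⟩)
    rw [map_sub, LinearEquiv.coe_coe, symbolAt_toGr, if_neg (by omega), zero_sub, neg_eq_zero] at h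
    exact h

theorem symbolAt_eq_toGr (he : F.IsSplitting e.toLinearMap) {n : ℕ} (u : F.fil n) :
    F.symbolAt e n u = F.toGr n u := by
  have h : F.symbolAt e n (e (F.toGr n u) - u) = 0 := by
    cases n with
    | zero =>
      have h : e (F.toGr 0 u) - u = 0 := he 0 u
      rw [h, map_zero]
    | succ n => exact symbolAt_eq_zero he n.lt_succ_self (he (n + 1) u)
  rw [map_sub, symbolAt_toGr, if_pos rfl, sub_eq_zero] at h
  exact h.symm

theorem sum_symbolAt (he : F.IsSplitting e.toLinearMap) {n : ℕ} {x : A} (hx : x ∈ F.fil n) :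
    ∑ k ∈ Finset.range (n + 1), e (F.symbolAt e k x) = x := by
  induction n generalizing x with
  | zero =>
    have h : e (F.toGr 0 ⟨x, hx⟩) - x = 0 := he 0 ⟨x, hx⟩
    rw [Finset.sum_range_one, symbolAt_eq_toGr he ⟨x, hx⟩, sub_eq_zero.1 h]
  | succ n ih =>
    have h := ih (he (n + 1) ⟨x, hx⟩)
    rw [Finset.sum_range_succ, symbolAt_eq_toGr he ⟨x, hx⟩]
    have h2 : ∀ k ∈ Finset.range (n + 1),
        e (F.symbolAt e k (e.toLinearMap (F.toGr (n + 1) ⟨x, hx⟩) - x)) =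
          -e (F.symbolAt e k x) := by
      intro k hk
      rw [Finset.mem_range] at hk
      rw [map_sub, LinearEquiv.coe_coe, symbolAt_toGr, if_neg (by omega), zero_sub, map_neg]
    rw [Finset.sum_congr rfl h2, Finset.sum_neg_distrib, LinearEquiv.coe_coe] at h
    rw [neg_eq_iff_add_eq_zero, ← add_sub_assoc, sub_eq_zero] at h
    exact h

theorem isInternal_map_range_lof (e : F.Gr ≃ₗ[K] A) :
    DirectSum.IsInternal (fun j : ℕ =>
      (LinearMap.range (DirectSum.lof K ℕ F.gr j)).map e.toLinearMap) := by
  refine DirectSum.isInternal_of_projections _ (F.component e) ?_ ?_ fun x => ?_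
  · rintro i _ ⟨_, ⟨a, rfl⟩, rfl⟩
    rw [component_eq, LinearEquiv.coe_coe, symbolAt_lof, if_pos rfl]
  · rintro i j hij _ ⟨_, ⟨a, rfl⟩, rfl⟩
    rw [component_eq, LinearEquiv.coe_coe, symbolAt_lof, if_neg hij.symm, map_zero]
  · obtain ⟨y, rfl⟩ := e.surjective x
    induction y using DirectSum.induction_on with
    | zero => rw [map_zero]; exact Submodule.zero_mem _
    | of n a => exact (le_iSup (fun j : ℕ =>
        (LinearMap.range (DirectSum.lof K ℕ F.gr j)).map e.toLinearMap) n) ⟨_, ⟨a, rfl⟩, rfl⟩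
    | add x y hx hy => rw [map_add]; exact Submodule.add_mem _ hx hy

end AlgFiltration

/-! ### Existence and properties of the color symmetrization map. -/

namespace ColorLieAlgebra

open Module AlgFiltration

variable {K G L : Type*} [Field K] [CommGroup G] [DecidableEq G]
  [AddCommGroup L] [Module K L] {χ : AntisymmBicharacter K G} (𝔤 : ColorLieAlgebra χ L)

theorem prod_ιGr {p : ℕ} (x : Fin p → L) : (List.ofFn fun i => 𝔤.ιGr (x i)).prod =
    𝔤.filtration.toGr p ⟨𝔤.mkU (tprod x), 𝔤.mkU_mem_fil (tprod_mem x)⟩ := by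
  induction p with
  | zero => exact toGr_congr _ rfl _ _ (by simp [tprod])
  | succ p ih =>
    rw [List.ofFn_succ, List.prod_cons, ih, ιGr, toGr_mul]
    refine toGr_congr _ (Nat.add_comm 1 p) _ _ ?_
    have h : 𝔤.mkU (tprod x) = 𝔤.ι (x 0) * 𝔤.mkU (tprod fun i => x i.succ) := by
      rw [tprod_succ, map_mul, mkU_ι]
    exact h.symm

theorem monomial_eq_mkU (l : List (G × L)) :
    𝔤.monomial l = 𝔤.mkU (tprod fun i : Fin l.length => (l.get i).2) := by
  rw [mkU_tprod, monomial]
  conv_lhs => rw [← List.ofFn_get l, List.map_ofFn]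
  rfl

theorem totalDegree_eq (l : List (G × L)) :
    totalDegree l = (List.ofFn fun i : Fin l.length => (l.get i).1).prod := by
  rw [totalDegree]
  conv_lhs => rw [← List.ofFn_get l, List.map_ofFn]
  rfl

theorem grMonomial_eq_prod (l : List (G × L)) :
    𝔤.grMonomial l = (List.ofFn fun i : Fin l.length => 𝔤.ιGr (l.get i).2).prod := by
  rw [prod_ιGr]
  exact toGr_congr _ rfl _ _ (𝔤.monomial_eq_mkU l)

variable {𝔤} in
theorem IsSymmetrization.apply_grMonomial {ω : 𝔤.GrU →ₗ[K] 𝔤.U} (hω : 𝔤.IsSymmetrization ω)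
    {l : List (G × L)} (hl : 𝔤.IsHomogeneousList l) :
    ω (𝔤.grMonomial l) = (l.length.factorial : K)⁻¹ •
      colorSum χ 𝔤.ι (fun i : Fin l.length => (l.get i).1) (fun i => (l.get i).2) := by
  rw [grMonomial_eq_prod]
  exact hω l.length _ _ fun i => hl _ (List.get_mem l i)

/-- For each p the map `symPow` is modified above degree p so that it factors through U. The
modification does not affect U_p, and the factored map vanishes on U_{p-1} because `symPow` does on
lower tensor powers. It therefore induces ω on gr^p. -/
theorem exists_isSymmetrization [CharZero K] : ∃ ω : 𝔤.GrU →ₗ[K] 𝔤.U, 𝔤.IsSymmetrization ω := by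
  have hb := 𝔤.isHomogeneousBasis
  have h : ∀ p, ∃ Ψ : 𝔤.U →ₗ[K] 𝔤.U, ∀ m ≤ p, ∀ t ∈ tensorPow K L m,
      Ψ (𝔤.mkU t) = 𝔤.symPow 𝔤.homogeneousBasis Sigma.fst p t := by
    intro p
    obtain ⟨Φ, hΦ, hΦ'⟩ := 𝔤.exists_respectsRel hb _ p (𝔤.respectsRel_symPow hb p)
    obtain ⟨Ψ, hΨ⟩ := 𝔤.exists_linearMap_U hb Φ hΦ
    exact ⟨Ψ, fun m hm t ht => (hΨ t).trans (hΦ' m hm t ht)⟩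
  choose Ψ hΨ using h
  refine ⟨𝔤.filtration.grLift (fun p => Ψ p ∘ₗ (𝔤.filtration.fil p).subtype) ?_, ?_⟩
  · rintro n u hu
    cases n with
    | zero =>
      have h0 : (u : 𝔤.U) = 0 := hu
      simp [h0]
    | succ n =>
      refine 𝔤.fil_le_of_monomial (n := n) (N := LinearMap.ker (Ψ (n + 1))) (fun l _ hn => ?_) hu
      rw [LinearMap.mem_ker, monomial_eq_mkU, hΨ _ _ (by omega) _ (tprod_mem _),
        𝔤.symPow_of_ne _ _ (by omega) (tprod_mem _)]
  · intro p d x hx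
    rw [prod_ιGr, grLift_toGr]
    change Ψ p (𝔤.mkU (tprod x)) = _
    rw [hΨ p p le_rfl _ (tprod_mem x), 𝔤.symPow_tprod_of_mem hx]
    rfl

variable {𝔤} {ω : 𝔤.GrU →ₗ[K] 𝔤.U}

theorem IsSymmetrization.unique (hω : 𝔤.IsSymmetrization ω) {ω' : 𝔤.GrU →ₗ[K] 𝔤.U}
    (hω' : 𝔤.IsSymmetrization ω') : ω = ω' :=
  𝔤.linearMap_ext_grMonomial fun _ hl => by
    rw [hω.apply_grMonomial hl, hω'.apply_grMonomial hl]

/-- ω of a class is the mean of p! signed reorderings of a monomial, each congruent to it modulo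
U_{p-1}. -/
theorem IsSymmetrization.isSplitting [CharZero K] (hω : 𝔤.IsSymmetrization ω) :
    𝔤.filtration.IsSplitting ω := by
  intro n u
  have hle : 𝔤.filtration.fil n ≤ ((𝔤.filtration.pred n).comap
      (ω ∘ₗ 𝔤.filtration.toGr n - (𝔤.filtration.fil n).subtype)).map (Submodule.subtype _) := by
    refine 𝔤.fil_le_of_monomial fun l hl hn => ?_
    refine ⟨⟨𝔤.monomial l, 𝔤.filtration.mono hn (𝔤.monomial_mem_fil l)⟩, ?_, rfl⟩
    rw [SetLike.mem_coe, Submodule.mem_comap]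
    change ω (𝔤.filtration.toGr n _) - 𝔤.monomial l ∈ _
    obtain rfl | hn' := Nat.eq_or_lt_of_le hn
    · change ω (𝔤.grMonomial l) - _ ∈ _
      rw [hω.apply_grMonomial hl, monomial_eq_mkU, ← neg_mem_iff, neg_sub]
      have hf : (l.length.factorial : K) ≠ 0 := Nat.cast_ne_zero.2 (Nat.factorial_ne_zero _)
      set x : Fin l.length → L := fun i => (l.get i).2
      set d : Fin l.length → G := fun i => (l.get i).1
      have h1 : ∑ σ : Equiv.Perm (Fin l.length), (𝔤.mkU (tprod x) -
          colorSign χ d σ • 𝔤.mkU (tprod (x ∘ σ))) ∈ 𝔤.filtration.pred l.length :=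
        Submodule.sum_mem _ fun σ _ => 𝔤.mkU_tprod_perm σ fun i => hl _ (List.get_mem l i)
      have h2 := Submodule.smul_mem _ (l.length.factorial : K)⁻¹ h1
      rw [Finset.sum_sub_distrib, Finset.sum_const, Finset.card_univ, Fintype.card_perm,
        Fintype.card_fin, smul_sub, ← Nat.cast_smul_eq_nsmul K, smul_smul, inv_mul_cancel₀ hf,
        one_smul] at h2
      simpa only [colorSum, mkU_tprod, Function.comp_apply] using h2
    · rw [toGr_eq_zero _ _ (𝔤.filtration.fil_le_pred hn' (𝔤.monomial_mem_fil l)), map_zero, zero_sub,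
        neg_mem_iff]
      exact 𝔤.filtration.fil_le_pred hn' (𝔤.monomial_mem_fil l)
  obtain ⟨u', hu', h'⟩ := hle u.2
  rw [← Subtype.ext h']
  exact hu'

theorem prod_ofFn_mem_uGrading {p : ℕ} {d : Fin p → G} {x : Fin p → L}
    (hx : ∀ i, x i ∈ 𝔤.grading (d i)) :
    (List.ofFn fun i => 𝔤.ι (x i)).prod ∈ 𝔤.uGrading (List.ofFn d).prod := by
  induction p with
  | zero => simpa using 𝔤.one_mem_uGrading
  | succ p ih =>
    rw [List.ofFn_succ, List.ofFn_succ, List.prod_cons, List.prod_cons]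
    exact 𝔤.mul_mem_uGrading (𝔤.ι_mem_uGrading (hx 0)) (ih fun i => hx i.succ)

theorem IsSymmetrization.apply_grMonomial_mem (hω : 𝔤.IsSymmetrization ω)
    {l : List (G × L)} (hl : 𝔤.IsHomogeneousList l) :
    ω (𝔤.grMonomial l) ∈ 𝔤.uGrading (totalDegree l) := by
  rw [hω.apply_grMonomial hl, colorSum]
  refine Submodule.smul_mem _ _ (Submodule.sum_mem _ fun σ _ => Submodule.smul_mem _ _ ?_)
  have h := prod_ofFn_mem_uGrading (𝔤 := 𝔤) (d := fun i : Fin l.length => (l.get (σ i)).1)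
    (x := fun i => (l.get (σ i)).2) fun i => hl _ (List.get_mem l _)
  rw [List.prod_ofFn, Equiv.prod_comp σ fun i => (l.get i).1, ← List.prod_ofFn] at h
  rwa [totalDegree_eq]

theorem IsSymmetrization.apply_grDegProj (hω : 𝔤.IsSymmetrization ω) (g : G) (a : 𝔤.GrU) :
    ω (𝔤.grDegProj g a) = 𝔤.degProj g (ω a) := by
  suffices h : ω ∘ₗ 𝔤.grDegProj g = 𝔤.degProj g ∘ₗ ω from LinearMap.congr_fun h a
  refine 𝔤.linearMap_ext_grMonomial fun l hl => ?_
  rw [LinearMap.comp_apply, LinearMap.comp_apply]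
  by_cases h : g = totalDegree l
  · subst h
    rw [𝔤.grDegProj_of_mem (𝔤.grMonomial_mem_grGrading hl),
      𝔤.degProj_of_mem (hω.apply_grMonomial_mem hl)]
  · rw [𝔤.grDegProj_of_mem_ne h (𝔤.grMonomial_mem_grGrading hl),
      𝔤.degProj_of_mem_ne h (hω.apply_grMonomial_mem hl), map_zero]

theorem IsSymmetrization.apply_mem (hω : 𝔤.IsSymmetrization ω) {g : G} {a : 𝔤.GrU}
    (ha : a ∈ 𝔤.grGrading g) : ω a ∈ 𝔤.uGrading g := by
  rw [← 𝔤.grDegProj_of_mem ha, hω.apply_grDegProj]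
  exact 𝔤.degProj_mem_uGrading g _

theorem IsSymmetrization.map_one (hω : 𝔤.IsSymmetrization ω) : ω 1 = 1 := by
  have h := hω.apply_grMonomial (l := []) (by simp [IsHomogeneousList])
  have h1 : 𝔤.grMonomial [] = 1 := rfl
  rw [h1] at h
  rw [h]
  simp [colorSum, colorSign]

end ColorLieAlgebra

/-! ### The star product attached to a splitting. -/

namespace AlgFiltration

variable {K A : Type*} [Field K] [Ring A] [Algebra K A] {F : AlgFiltration K A}

theorem starCoeff_lof (e : F.Gr ≃ₗ[K] A) (n p q : ℕ) (a : F.gr p) (b : F.gr q) :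
    F.starCoeff e n (DirectSum.lof K ℕ F.gr p a) (DirectSum.lof K ℕ F.gr q b) =
      if n ≤ p + q then F.symbolAt e (p + q - n)
        (e (DirectSum.lof K ℕ F.gr p a) * e (DirectSum.lof K ℕ F.gr q b)) else 0 := by
  rw [starCoeff, DirectSum.toModule_lof, LinearMap.flip_apply, DirectSum.toModule_lof,
    LinearMap.flip_apply, starPiece]
  split_ifs with h
  · exact F.symm_component e _ _
  · rfl

theorem gr_bilin_ext {V : Type*} [AddCommGroup V] [Module K V] {f f' : F.Gr →ₗ[K] F.Gr →ₗ[K] V}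
    (h : ∀ p q a b, f (DirectSum.lof K ℕ F.gr p a) (DirectSum.lof K ℕ F.gr q b) =
      f' (DirectSum.lof K ℕ F.gr p a) (DirectSum.lof K ℕ F.gr q b)) : f = f' :=
  DirectSum.linearMap_ext K fun p => LinearMap.ext fun a =>
    DirectSum.linearMap_ext K fun q => LinearMap.ext fun b => h p q a b

variable {e : F.Gr ≃ₗ[K] A}

theorem starCoeff_zero (he : F.IsSplitting e.toLinearMap) (a b : F.Gr) :
    F.starCoeff e 0 a b = a * b := by
  suffices h : F.starCoeff e 0 = LinearMap.mul K F.Gr from LinearMap.congr_fun₂ h a b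
  refine gr_bilin_ext fun p q a b => ?_
  rw [starCoeff_lof, if_pos (Nat.zero_le _), Nat.sub_zero, LinearMap.mul_apply']
  obtain ⟨u, hu⟩ := F.lof_surjective_toGr p a
  obtain ⟨v, hv⟩ := F.lof_surjective_toGr q b
  rw [← hu, ← hv, toGr_mul]
  have h1 : e (F.toGr p u) ∈ F.fil p := he.mem_fil u
  have h2 : e (F.toGr q v) ∈ F.fil q := he.mem_fil v
  rw [symbolAt_eq_toGr he ⟨_, F.mul_mem h1 h2⟩]
  refine F.toGr_eq_of_sub_mem _ _ ?_
  have h3 : e (F.toGr p u) * e (F.toGr q v) - (u : A) * v =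
      (e (F.toGr p u) - u) * e (F.toGr q v) + u * (e (F.toGr q v) - v) := by noncomm_ring
  change e (F.toGr p u) * e (F.toGr q v) - (u : A) * v ∈ _
  rw [h3]
  exact Submodule.add_mem _ (F.mul_mem_pred_left (he p u) h2) (F.mul_mem_pred_right u.2 (he q v))

/-- Decomposing x into components, applying B and extracting the component of degree P + r - N gives
that component of B x. With B a right or left multiplication, this evaluates the order-N coefficient
of either bracketing of a triple star product. -/
theorem sum_symbolAt_map (he : F.IsSplitting e.toLinearMap) (B : A →ₗ[K] A) {P r N : ℕ}
    (hB : ∀ n, ∀ y ∈ F.fil n, B y ∈ F.fil (n + r)) {x : A} (hx : x ∈ F.fil P) :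
    ∑ j ∈ Finset.range (N + 1), (if j ≤ P then
      (if N - j ≤ P - j + r then F.symbolAt e (P - j + r - (N - j)) (B (e (F.symbolAt e (P - j) x)))
        else 0) else 0) =
      if N ≤ P + r then F.symbolAt e (P + r - N) (B x) else 0 := by
  split_ifs with hN
  · have h1 : ∀ j ∈ Finset.range (N + 1), (if j ≤ P then
        (if N - j ≤ P - j + r then F.symbolAt e (P - j + r - (N - j))
          (B (e (F.symbolAt e (P - j) x))) else 0) else 0) =
        if j ≤ P then F.symbolAt e (P + r - N) (B (e (F.symbolAt e (P - j) x))) else 0 := by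
      intro j hj
      rw [Finset.mem_range] at hj
      split_ifs with h1 h2
      · rw [show P - j + r - (N - j) = P + r - N by omega]
      · omega
      · rfl
    rw [Finset.sum_congr rfl h1, ← Finset.sum_filter]
    rw [Finset.sum_subset (s₂ := Finset.range (P + 1))]
    · rw [← map_sum, ← map_sum]
      congr 2
      have h2 := Finset.sum_range_reflect (fun k => e (F.symbolAt e k x)) (P + 1)
      rw [sum_symbolAt he hx] at h2
      exact (Finset.sum_congr rfl fun j _ => by rw [Nat.add_sub_cancel]).trans h2
    · intro j hj
      rw [Finset.mem_filter] at hj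
      exact Finset.mem_range.2 (Nat.lt_succ_of_le hj.2)
    · intro j hj hj'
      rw [Finset.mem_filter, Finset.mem_range] at hj'
      rw [Finset.mem_range] at hj
      -- The components with j > N were absent from the sum, but B sends them into filtration degree
      -- P - j + r < P + r - N, where they contribute nothing.
      exact symbolAt_eq_zero he (n := P - j + r) (by omega) (hB _ _ (he.lof_mem_fil _))
  · refine Finset.sum_eq_zero fun j hj => ?_
    rw [Finset.mem_range] at hj
    split_ifs with h1 h2
    · omega
    · rfl
    · rfl

theorem sum_starCoeff_left (he : F.IsSplitting e.toLinearMap) (N p q r : ℕ) (a : F.gr p)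
    (b : F.gr q) (c : F.gr r) :
    ∑ j ∈ Finset.range (N + 1), F.starCoeff e (N - j)
      (F.starCoeff e j (DirectSum.lof K ℕ F.gr p a) (DirectSum.lof K ℕ F.gr q b))
        (DirectSum.lof K ℕ F.gr r c) =
      if N ≤ p + q + r then F.symbolAt e (p + q + r - N) (e (DirectSum.lof K ℕ F.gr p a) *
        e (DirectSum.lof K ℕ F.gr q b) * e (DirectSum.lof K ℕ F.gr r c)) else 0 := by
  have h := sum_symbolAt_map (N := N) he (LinearMap.mulRight K (e (DirectSum.lof K ℕ F.gr r c)))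
    (r := r) (fun n y hy => F.mul_mem hy (he.lof_mem_fil c))
    (F.mul_mem (he.lof_mem_fil a) (he.lof_mem_fil b))
  refine Eq.trans (Finset.sum_congr rfl fun j _ => ?_) h
  rw [starCoeff_lof]
  split_ifs with h1 h2
  · exact (starCoeff_lof e _ _ _ _ _).trans (if_pos h2)
  · exact (starCoeff_lof e _ _ _ _ _).trans (if_neg h2)
  · rw [map_zero, LinearMap.zero_apply]

theorem sum_starCoeff_right (he : F.IsSplitting e.toLinearMap) (N p q r : ℕ) (a : F.gr p)
    (b : F.gr q) (c : F.gr r) :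
    ∑ j ∈ Finset.range (N + 1), F.starCoeff e (N - j) (DirectSum.lof K ℕ F.gr p a)
      (F.starCoeff e j (DirectSum.lof K ℕ F.gr q b) (DirectSum.lof K ℕ F.gr r c)) =
      if N ≤ p + q + r then F.symbolAt e (p + q + r - N) (e (DirectSum.lof K ℕ F.gr p a) *
        e (DirectSum.lof K ℕ F.gr q b) * e (DirectSum.lof K ℕ F.gr r c)) else 0 := by
  have h := sum_symbolAt_map (N := N) he (LinearMap.mulLeft K (e (DirectSum.lof K ℕ F.gr p a)))
    (r := p) (fun n y hy => by
      rw [Nat.add_comm]; exact F.mul_mem (he.lof_mem_fil a) hy)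
    (F.mul_mem (he.lof_mem_fil b) (he.lof_mem_fil c))
  rw [LinearMap.mulLeft_apply, ← mul_assoc, Nat.add_comm (q + r) p, ← Nat.add_assoc] at h
  refine Eq.trans (Finset.sum_congr rfl fun j _ => ?_) h
  rw [starCoeff_lof]
  split_ifs with h1 h2
  · refine (starCoeff_lof e _ _ _ _ _).trans ?_
    rw [Nat.add_comm p, if_pos h2]
    rfl
  · refine (starCoeff_lof e _ _ _ _ _).trans ?_
    rw [Nat.add_comm p, if_neg h2]
  · rw [map_zero]

theorem sum_starCoeff_assoc (he : F.IsSplitting e.toLinearMap) (N : ℕ) (a b c : F.Gr) :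
    ∑ x ∈ Finset.HasAntidiagonal.antidiagonal N, F.starCoeff e x.1 (F.starCoeff e x.2 a b) c =
      ∑ x ∈ Finset.HasAntidiagonal.antidiagonal N,
        F.starCoeff e x.1 a (F.starCoeff e x.2 b c) := by
  -- After the swap, the summation index is the order of the inner product, as in the two preceding
  -- lemmas.
  rw [← Finset.Nat.sum_antidiagonal_swap, ← Finset.Nat.sum_antidiagonal_swap
    (f := fun x => F.starCoeff e x.1 a (F.starCoeff e x.2 b c))]
  simp only [Prod.fst_swap, Prod.snd_swap]
  rw [Finset.Nat.sum_antidiagonal_eq_sum_range_succ fun i j =>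
      F.starCoeff e j (F.starCoeff e i a b) c,
    Finset.Nat.sum_antidiagonal_eq_sum_range_succ fun i j =>
      F.starCoeff e j a (F.starCoeff e i b c)]
  induction a using DirectSum.induction_on with
  | zero => simp
  | add a a' ha ha' => simp only [map_add, LinearMap.add_apply, Finset.sum_add_distrib, ha, ha']
  | of p a =>
    induction b using DirectSum.induction_on with
    | zero => simp
    | add a a' ha ha' => simp only [map_add, LinearMap.add_apply, Finset.sum_add_distrib, ha, ha']
    | of q b =>
      induction c using DirectSum.induction_on with
      | zero => simp
      | add a a' ha ha' => simp only [map_add, Finset.sum_add_distrib, ha, ha']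
      | of r c =>
        exact (sum_starCoeff_left he N p q r a b c).trans
          (sum_starCoeff_right he N p q r a b c).symm

theorem one_eq_lof : (1 : F.Gr) = DirectSum.lof K ℕ F.gr 0 (F.proj 0 ⟨1, F.one_mem⟩) := rfl

theorem starCoeff_one_left (h1 : e 1 = 1) {n : ℕ} (hn : n ≠ 0) (b : F.Gr) :
    F.starCoeff e n 1 b = 0 := by
  induction b using DirectSum.induction_on with
  | zero => rw [map_zero]
  | add a b ha hb => rw [map_add, ha, hb, add_zero]
  | of q b =>
    rw [one_eq_lof]
    refine (starCoeff_lof e _ _ _ _ _).trans ?_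
    rw [← one_eq_lof, h1, one_mul, symbolAt_lof]
    split_ifs
    · omega
    · rfl
    · rfl

theorem starCoeff_one_right (h1 : e 1 = 1) {n : ℕ} (hn : n ≠ 0) (b : F.Gr) :
    F.starCoeff e n b 1 = 0 := by
  induction b using DirectSum.induction_on with
  | zero => rw [map_zero, LinearMap.zero_apply]
  | add a b ha hb => rw [map_add, LinearMap.add_apply, ha, hb, add_zero]
  | of q b =>
    rw [one_eq_lof]
    refine (starCoeff_lof e _ _ _ _ _).trans ?_
    rw [← one_eq_lof, h1, mul_one, symbolAt_lof]
    split_ifs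
    · omega
    · rfl
    · rfl

theorem formalMul_starCoeff_C_C (p q : ℕ) (a : F.gr p) (b : F.gr q) :
    formalMul (F.starCoeff e) (PowerSeries.C (DirectSum.lof K ℕ F.gr p a))
      (PowerSeries.C (DirectSum.lof K ℕ F.gr q b)) =
      ∑ n ∈ Finset.range (p + q + 1), PowerSeries.monomial n (F.symbolAt e (p + q - n)
        (e (DirectSum.lof K ℕ F.gr p a) * e (DirectSum.lof K ℕ F.gr q b))) := by
  ext r
  rw [formalMul_C_C, starCoeff_lof, map_sum]
  simp only [PowerSeries.coeff_monomial]
  rw [Finset.sum_ite_eq]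
  simp only [Finset.mem_range, Nat.lt_succ_iff]

end AlgFiltration

/-! ### The star product given by color symmetrization. -/

namespace ColorLieAlgebra

open AlgFiltration

variable {K G L : Type*} [Field K] [CommGroup G] [DecidableEq G]
  [AddCommGroup L] [Module K L] {χ : AntisymmBicharacter K G} (𝔤 : ColorLieAlgebra χ L)

theorem exists_augmentation : ∃ ε : 𝔤.U →ₐ[K] K, ∀ x, ε (𝔤.ι x) = 0 :=
  𝔤.exists_lift 0 fun _ _ _ _ _ _ => by simp

variable {𝔤}

section Equiv

variable {e : 𝔤.GrU ≃ₗ[K] 𝔤.U} (he : 𝔤.IsSymmetrization e.toLinearMap)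
include he

theorem IsSymmetrization.symm_mem {g : G} {u : 𝔤.U} (hu : u ∈ 𝔤.uGrading g) :
    e.symm u ∈ 𝔤.grGrading g := by
  have h := he.apply_grDegProj g (e.symm u)
  rw [LinearEquiv.coe_coe, LinearEquiv.apply_symm_apply, 𝔤.degProj_of_mem hu] at h
  rw [← h, LinearEquiv.symm_apply_apply]
  exact 𝔤.grDegProj_mem g _

omit he in
theorem lof_component_mem {g : G} {a : 𝔤.GrU} (ha : a ∈ 𝔤.grGrading g) (k : ℕ) :
    DirectSum.lof K ℕ 𝔤.filtration.gr k (DirectSum.component K ℕ 𝔤.filtration.gr k a) ∈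
      𝔤.grGrading g := by
  refine 𝔤.grGrading_induction (p := fun a => DirectSum.lof K ℕ 𝔤.filtration.gr k
    (DirectSum.component K ℕ 𝔤.filtration.gr k a) ∈ 𝔤.grGrading g)
    (fun a b ha hb => by rw [map_add, map_add]; exact Submodule.add_mem _ ha hb)
    (fun c a ha => by rw [map_smul, map_smul]; exact Submodule.smul_mem _ c ha) (fun n u hu => ?_) ha
  rw [toGr, LinearMap.comp_apply]
  by_cases h : n = k
  · subst h
    rw [DirectSum.component.lof_self]
    exact 𝔤.toGr_mem_grGrading u hu
  · rw [DirectSum.component.of, dif_neg h, map_zero]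
    exact Submodule.zero_mem _

theorem IsSymmetrization.symbolAt_mem {g : G} {u : 𝔤.U} (hu : u ∈ 𝔤.uGrading g) (k : ℕ) :
    𝔤.filtration.symbolAt e k u ∈ 𝔤.grGrading g :=
  lof_component_mem (he.symm_mem hu) k

theorem IsSymmetrization.starCoeff_mem (n : ℕ) {g h : G} {a b : 𝔤.GrU} (ha : a ∈ 𝔤.grGrading g)
    (hb : b ∈ 𝔤.grGrading h) : 𝔤.filtration.starCoeff e n a b ∈ 𝔤.grGrading (g * h) := by
  refine 𝔤.grGrading_induction (p := fun a => 𝔤.filtration.starCoeff e n a b ∈ 𝔤.grGrading (g * h))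
    (fun a b ha hb => by rw [map_add]; exact Submodule.add_mem _ ha hb)
    (fun c a ha => by rw [map_smul]; exact Submodule.smul_mem _ c ha) (fun p u hu => ?_) ha
  refine 𝔤.grGrading_induction (p := fun b => 𝔤.filtration.starCoeff e n (𝔤.filtration.toGr p u) b ∈
    𝔤.grGrading (g * h))
    (fun a b ha hb => by rw [map_add]; exact Submodule.add_mem _ ha hb)
    (fun c a ha => by rw [map_smul]; exact Submodule.smul_mem _ c ha) (fun q v hv => ?_) hb
  have h1 := starCoeff_lof e n p q (𝔤.filtration.proj p u) (𝔤.filtration.proj q v)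
  refine (congrArg (· ∈ 𝔤.grGrading (g * h)) h1).mpr ?_
  split_ifs
  · exact he.symbolAt_mem (𝔤.mul_mem_uGrading (he.apply_mem (𝔤.toGr_mem_grGrading u hu))
      (he.apply_mem (𝔤.toGr_mem_grGrading v hv))) _
  · exact Submodule.zero_mem _

variable [CharZero K]

theorem IsSymmetrization.toGr_apply (n : ℕ) (u : 𝔤.filtration.fil n) :
    𝔤.filtration.toGr n ⟨e (𝔤.filtration.toGr n u), he.isSplitting.mem_fil u⟩ =
      𝔤.filtration.toGr n u :=
  toGr_eq_of_sub_mem _ _ _ (he.isSplitting n u)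

/-- As ω preserves G-degrees, the left side is the component of degree p+q-1 of the color commutator
of ω(a) and ω(b). That commutator lies in U_{p+q-1}, so the component is its class, which is the
bracket because ω(a) and ω(b) represent a and b. -/
theorem IsSymmetrization.starCoeff_one_sub {g h : G} {a b : 𝔤.GrU} (ha : a ∈ 𝔤.grGrading g)
    (hb : b ∈ 𝔤.grGrading h) : 𝔤.filtration.starCoeff e 1 a b -
      (χ g h : K) • 𝔤.filtration.starCoeff e 1 b a = 𝔤.grBracket a b := by
  refine 𝔤.grGrading_induction (p := fun a => 𝔤.filtration.starCoeff e 1 a b -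
      (χ g h : K) • 𝔤.filtration.starCoeff e 1 b a = 𝔤.grBracket a b)
    (fun a b ha hb => ?_) (fun c a ha => ?_) (fun p u hu => ?_) ha
  · rw [map_add, map_add, map_add, LinearMap.add_apply, LinearMap.add_apply, ← ha, ← hb, smul_add]
    abel
  · rw [map_smul, map_smul, map_smul, LinearMap.smul_apply, LinearMap.smul_apply, ← ha, smul_sub,
      smul_comm c]
  refine 𝔤.grGrading_induction (p := fun b => 𝔤.filtration.starCoeff e 1 (𝔤.filtration.toGr p u) b -
      (χ g h : K) • 𝔤.filtration.starCoeff e 1 b (𝔤.filtration.toGr p u) =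
        𝔤.grBracket (𝔤.filtration.toGr p u) b)
    (fun a b ha hb => ?_) (fun c a ha => ?_) (fun q v hv => ?_) hb
  · rw [map_add, map_add, map_add, LinearMap.add_apply, ← ha, ← hb, smul_add]
    abel
  · rw [map_smul, map_smul, map_smul, LinearMap.smul_apply, ← ha, smul_sub, smul_comm c]
  have h1 : 𝔤.filtration.starCoeff e 1 (𝔤.filtration.toGr p u) (𝔤.filtration.toGr q v) = _ :=
    starCoeff_lof e 1 p q (𝔤.filtration.proj p u) (𝔤.filtration.proj q v)
  have h2 : 𝔤.filtration.starCoeff e 1 (𝔤.filtration.toGr q v) (𝔤.filtration.toGr p u) = _ :=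
    starCoeff_lof e 1 q p (𝔤.filtration.proj q v) (𝔤.filtration.proj p u)
  rw [h1, h2, Nat.add_comm q p]
  split_ifs with hpq
  · rw [← map_smul, ← map_sub]
    change 𝔤.filtration.symbolAt e _ (e (𝔤.filtration.toGr p u) * e (𝔤.filtration.toGr q v) -
      (χ g h : K) • (e (𝔤.filtration.toGr q v) * e (𝔤.filtration.toGr p u))) = _
    have hu' : e (𝔤.filtration.toGr p u) ∈ 𝔤.uGrading g :=
      he.apply_mem (𝔤.toGr_mem_grGrading u hu)
    have hv' : e (𝔤.filtration.toGr q v) ∈ 𝔤.uGrading h :=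
      he.apply_mem (𝔤.toGr_mem_grGrading v hv)
    have hup : e (𝔤.filtration.toGr p u) ∈ 𝔤.filtration.fil p := he.isSplitting.mem_fil u
    have hvq : e (𝔤.filtration.toGr q v) ∈ 𝔤.filtration.fil q := he.isSplitting.mem_fil v
    rw [← 𝔤.comm_apply hu' hv',
      symbolAt_eq_toGr he.isSplitting ⟨_, 𝔤.comm_mem_fil hup hvq⟩]
    have h3 := 𝔤.grBracket_toGr ⟨_, hup⟩ ⟨_, hvq⟩
    have h4 : 𝔤.filtration.toGr p ⟨_, hup⟩ = 𝔤.filtration.toGr p u := he.toGr_apply p u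
    have h5 : 𝔤.filtration.toGr q ⟨_, hvq⟩ = 𝔤.filtration.toGr q v := he.toGr_apply q v
    rw [h4, h5] at h3
    exact h3.symm
  -- Here p = q = 0: the coefficient of order 1 is zero by convention, and so is the bracket.
  · obtain rfl : p = 0 := by omega
    rw [smul_zero, sub_zero, 𝔤.grBracket_zero_left]

omit [CharZero K] in
theorem IsSymmetrization.augmentation_apply {ε : 𝔤.U →ₐ[K] K} (hε : ∀ x, ε (𝔤.ι x) = 0)
    {l : List (G × L)} (hl : 𝔤.IsHomogeneousList l) (h : l ≠ []) :
    ε (e (𝔤.grMonomial l)) = 0 := by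
  have h1 := he.apply_grMonomial hl
  rw [LinearEquiv.coe_coe] at h1
  rw [h1, colorSum, map_smul, map_sum, Finset.sum_eq_zero, smul_zero]
  intro σ _
  rw [map_smul, map_list_prod, List.prod_eq_zero, smul_zero]
  rw [List.mem_map]
  have hpos : 0 < l.length := List.length_pos_of_ne_nil h
  exact ⟨_, List.mem_ofFn.2 ⟨⟨0, hpos⟩, rfl⟩, hε _⟩

/-- Both sides vanish on symmetrized products of positive length and agree on 1. The component of
degree 0 thus becomes multiplicative, which is what removes the term n = p + q. -/
theorem IsSymmetrization.symbolAt_zero {ε : 𝔤.U →ₐ[K] K} (hε : ∀ x, ε (𝔤.ι x) = 0) (u : 𝔤.U) :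
    𝔤.filtration.symbolAt e 0 u = ε u • 1 := by
  obtain ⟨a, rfl⟩ := e.surjective u
  suffices h : 𝔤.filtration.symbolAt e 0 ∘ₗ e.toLinearMap =
      (LinearMap.toSpanSingleton K 𝔤.GrU 1 ∘ₗ ε.toLinearMap) ∘ₗ e.toLinearMap from
    LinearMap.congr_fun h a
  refine 𝔤.linearMap_ext_grMonomial fun l hl => ?_
  change 𝔤.filtration.symbolAt e 0 (e (𝔤.grMonomial l)) = ε (e (𝔤.grMonomial l)) • 1
  by_cases h : l = []
  · subst h
    rw [grMonomial, symbolAt_toGr, if_pos List.length_nil]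
    have h1 : 𝔤.filtration.toGr _ ⟨𝔤.monomial [], 𝔤.monomial_mem_fil []⟩ = 1 := rfl
    have h2 : e 1 = 1 := he.map_one
    rw [h1, h2, _root_.map_one, one_smul]
  · rw [he.augmentation_apply hε hl h, zero_smul, grMonomial, symbolAt_toGr,
      if_neg (by rwa [List.length_eq_zero_iff])]

theorem IsSymmetrization.augmentation_lof {ε : 𝔤.U →ₐ[K] K} (hε : ∀ x, ε (𝔤.ι x) = 0) {p : ℕ}
    (hp : p ≠ 0) (a : 𝔤.filtration.gr p) : ε (e (DirectSum.lof K ℕ 𝔤.filtration.gr p a)) = 0 := by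
  have h := he.symbolAt_zero hε (e (DirectSum.lof K ℕ 𝔤.filtration.gr p a))
  rw [symbolAt_lof, if_neg hp] at h
  have h2 := congrArg (fun x => ε (e x)) h
  have h3 : e 1 = 1 := he.map_one
  simpa [h3] using h2.symm

theorem IsSymmetrization.symbolAt_zero_mul {p q : ℕ} (hpq : 0 < p + q) (a : 𝔤.filtration.gr p)
    (b : 𝔤.filtration.gr q) : 𝔤.filtration.symbolAt e 0 (e (DirectSum.lof K ℕ 𝔤.filtration.gr p a) *
      e (DirectSum.lof K ℕ 𝔤.filtration.gr q b)) = 0 := by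
  obtain ⟨ε, hε⟩ := 𝔤.exists_augmentation
  rw [he.symbolAt_zero hε, map_mul]
  by_cases hp : p = 0
  · rw [he.augmentation_lof hε (p := q) (by omega), mul_zero, zero_smul]
  · rw [he.augmentation_lof hε hp, zero_mul, zero_smul]

theorem IsSymmetrization.isGradedStarProduct :
    IsGradedStarProduct χ 𝔤.grGrading 𝔤.grBracket (𝔤.filtration.starCoeff e) where
  isColorPoissonAlgebra := 𝔤.isColorPoissonAlgebra
  isGradedDeformation :=
    { coeff_zero := starCoeff_zero he.isSplitting
      mem := fun n _ _ _ _ ha hb => he.starCoeff_mem n ha hb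
      assoc := formalMul_assoc fun N a b c => sum_starCoeff_assoc he.isSplitting N a b c
      one_mul := formalMul_one_left
        (fun b => (starCoeff_zero he.isSplitting 1 b).trans (one_mul b))
        fun _ b hn => starCoeff_one_left he.map_one hn b
      mul_one := formalMul_one_right
        (fun b => (starCoeff_zero he.isSplitting b 1).trans (mul_one b))
        fun _ b hn => starCoeff_one_right he.map_one hn b }
  bracket_eq := fun _ _ _ _ ha hb => he.starCoeff_one_sub ha hb

end Equiv

end ColorLieAlgebra

end

/-! ### The main theorem. -/

open ColorLieAlgebra AlgFiltration in
theorem mainTheorem5 {K G L : Type*} [Field K] [CharZero K]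
    [CommGroup G] [DecidableEq G] [AddCommGroup L] [Module K L]
    (χ : AntisymmBicharacter K G) (𝔤 : ColorLieAlgebra χ L) :
    (∃! P : 𝔤.GrU →ₗ[K] 𝔤.GrU →ₗ[K] 𝔤.GrU, 𝔤.IsCommutatorBracket P) ∧
    (∃! ω : 𝔤.GrU →ₗ[K] 𝔤.U, 𝔤.IsSymmetrization ω) ∧
    ∀ P : 𝔤.GrU →ₗ[K] 𝔤.GrU →ₗ[K] 𝔤.GrU, 𝔤.IsCommutatorBracket P →
    ∀ ω : 𝔤.GrU →ₗ[K] 𝔤.U, 𝔤.IsSymmetrization ω →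
    ∃ e : 𝔤.GrU ≃ₗ[K] 𝔤.U, e.toLinearMap = ω ∧
      DirectSum.IsInternal (fun j : ℕ =>
        (LinearMap.range (DirectSum.lof K ℕ 𝔤.filtration.gr j)).map ω) ∧
      IsGradedStarProduct χ 𝔤.grGrading P (𝔤.filtration.starCoeff e) ∧
      ∀ (p q : ℕ) (u v : 𝔤.GrU),
        u ∈ LinearMap.range (DirectSum.lof K ℕ 𝔤.filtration.gr p) →
        v ∈ LinearMap.range (DirectSum.lof K ℕ 𝔤.filtration.gr q) →
        formalMul (𝔤.filtration.starCoeff e) (PowerSeries.C u) (PowerSeries.C v) =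
          ∑ n ∈ Finset.range (p + q + 1), PowerSeries.monomial n
            (e.symm (𝔤.filtration.component e (p + q - n) (ω u * ω v))) ∧
        (0 < p + q →
          formalMul (𝔤.filtration.starCoeff e) (PowerSeries.C u) (PowerSeries.C v) =
            ∑ n ∈ Finset.range (p + q), PowerSeries.monomial n
              (e.symm (𝔤.filtration.component e (p + q - n) (ω u * ω v)))) := by
  refine ⟨⟨_, 𝔤.isCommutatorBracket_grBracket, fun P hP => hP.eq⟩, ?_, ?_⟩
  · obtain ⟨ω, hω⟩ := 𝔤.exists_isSymmetrization
    exact ⟨ω, hω, fun ω' hω' => hω'.unique hω⟩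
  intro P hP ω hω
  obtain rfl := hP.eq
  obtain ⟨e, rfl⟩ : ∃ e : 𝔤.GrU ≃ₗ[K] 𝔤.U, e.toLinearMap = ω :=
    ⟨LinearEquiv.ofBijective ω (hω.isSplitting.bijective 𝔤.exists_mem_fil), rfl⟩
  refine ⟨e, rfl, isInternal_map_range_lof e, hω.isGradedStarProduct, ?_⟩
  rintro p q _ _ ⟨a, rfl⟩ ⟨b, rfl⟩
  simp only [symm_component, LinearEquiv.coe_coe]
  refine ⟨formalMul_starCoeff_C_C p q a b, fun hpq => ?_⟩
  -- The last summand n = p + q is the component of degree 0, which vanishes as soon as one factor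
  -- has positive degree.
  rw [formalMul_starCoeff_C_C, Finset.sum_range_succ, Nat.sub_self, hω.symbolAt_zero_mul hpq,
    map_zero, add_zero]
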